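/- Let $(F,v)$ be a henselian valued field with finite residue field $k$ of cardinality $q$ and characteristic $p$, whose value group is isomorphic to $\mathbb Z^d$ for some $d\ge 1$. Let $\ell\ne p$ be a prime, let $n$ be a power of $\ell$, put $m=\gcd(q-1,n)=|\mu_n(F)|$, and let $m'=m/2$ if $n$ is even and $m=2^{v_2(q-1)}$ (where $v_2$ is the $2$-adic valuation), and $m'=m$ otherwise. Let $F_{\mathrm{sep}}$ be a separable closure of $F$, $G_F=\mathrm{Gal}(F_{\mathrm{sep}}/F)$, $\mathrm X(F)=H^1(F,\mathbb Q/\mathbb Z)=\mathrm{Hom}_{\mathrm{cont}}(G_F,\mathbb Q/\mathbb Z)$ and $\mathrm{Br}(F)=H^2(G_F,F_{\mathrm{sep}}^\times)$. Let ${}_n2\mathrm X(F)$ and ${}_n2\mathrm{Br}(F)$ be the $n$-torsion subgroups of $2\mathrm X(F)$ and of $2\mathrm{Br}(F)$. Let $\mu_n$ be the group of $n$-th roots of unity in $F_{\mathrm{sep}}$, and let $Z^1(F,\mu_n)$ be the group of continuous $1$-cocycles $G_F\to\mu_n$; every such cocycle is of the form $\sigma\mapsto\sigma(t^{1/n})/t^{1/n}$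 with $t\in F^\times$ and $t^{1/n}$ an $n$-th root of $t$ in $F_{\mathrm{sep}}$, and is denoted by $t^{1/n}$. For $\theta\in{}_n2\mathrm X(F)$ and $t^{1/n}\in Z^1(F,\mu_n)$ let $(\theta,t)\in\mathrm{Br}(F)$ be the cup product, the class of $(\sigma,\tau)\mapsto\theta(\sigma)\otimes\sigma(t^{1/n}(\tau))$, where $\tfrac1n\mathbb Z/\mathbb Z\otimes\mu_n$ is identified with $\mu_n$ by $\tfrac an\otimes\zeta\mapsto\zeta^a$. Fix an isomorphism $\zeta_n^*:\mu_n\to\tfrac1n\mathbb Z/\mathbb Z$. For $g$ dividing $m$ and $t^{1/n}\in Z^1(F,\mu_n)$ let $(t)_g^*\in\mathrm X(F)$ be the character $\sigma\mapsto\zeta_n^*\big(t^{1/n}(\sigma)^{n/g}\big)$. Call a pair $(\theta,t^{1/n})$ \emph{normalized} if $\tfrac{|\theta|}{g'}\theta=(t)_{g'}^*$, where $|\theta|$ is the order of $\theta$ and $g'=\gcd(|\theta|,m')$. A \emph{basis} of a finite abelian group is a finite generating family of elements such that the group is the direct sum of the cyclic subgroups that they generate (zero elements are allowed). An \emph{adapted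 basis} consists of a basis $\chi_0,\dots,\chi_d$ of ${}_n2\mathrm X(F)$ with $|\chi_0|=n$ and $|\chi_i|=m'$ for $i\ge1$, and a basis $x_0^{1/n},\dots,x_d^{1/n}$ of $Z^1(F,\mu_n)$, such that $(\chi_0,x_0)=0$ and every pair $(\chi_i,x_i^{1/n})$, $0\le i\le d$, is normalized. The elements $\theta\in{}_n2\mathrm X(F)$ and $t^{1/n}\in Z^1(F,\mu_n)$ are \emph{matched} if the pair is normalized and there are an adapted basis and integers $b_i,c_i$ with $\theta=\sum_{i=0}^d b_i\chi_i$, $t^{1/n}=\prod_{i=0}^d x_i^{c_i/n}$, \[ b_0c_j\equiv\tfrac n{m'}c_0b_j\pmod n\quad\text{and}\quad b_ic_j\equiv c_ib_j\pmod{m'}\qquad\text{for all } i,j\ge1. \] Let $C\le{}_n2\mathrm X(F)\otimes_{\mathbb Z}Z^1(F,\mu_n)$ be the subgroup generated by all $\theta\otimes t^{1/n}$ with $\theta$ and $t^{1/n}$ matched, and put ${}_n2\mathrm X(F)\wedge Z^1(F,\mu_n):=\big({}_n2\mathrm X(F)\otimes Z^1(F,\mu_n)\big)/C$. \textbf{Theorem.}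 The cup product $\theta\otimes t^{1/n}\mapsto(\theta,t)$ maps ${}_n2\mathrm X(F)\otimes Z^1(F,\mu_n)$ to ${}_n2\mathrm{Br}(F)$, its kernel is exactly $C$, and it induces an isomorphism \[ {}_n2\mathrm X(F)\wedge Z^1(F,\mu_n)\;\overset{\sim}{\longrightarrow}\;{}_n2\mathrm{Br}(F). \] -/

import Mathlib

open scoped TensorProduct

noncomputable section

/-! ### Continuous cochains with values in a discrete module (written multiplicatively) -/

section Cochains

variable (G M : Type*) [Group G] [TopologicalSpace G] [CommGroup M] [MulDistribMulAction G M]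

/-- Continuous 2-cocycles of `G` with values in the discrete `G`-module `M`. -/
def contZ2 : Subgroup (G × G → M) where
  carrier := {f | IsLocallyConstant f ∧ groupCohomology.IsMulCocycle₂ f}
  one_mem' := ⟨IsLocallyConstant.const 1, fun g h j => by simp⟩
  mul_mem' := by
    rintro a b ⟨ha, ha'⟩ ⟨hb, hb'⟩
    refine ⟨ha.mul hb, fun g h j => ?_⟩
    simp only [Pi.mul_apply, smul_mul']
    rw [mul_mul_mul_comm, ha' g h j, hb' g h j, mul_mul_mul_comm]
  inv_mem' := by
    rintro a ⟨ha, ha'⟩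
    refine ⟨ha.inv, fun g h j => ?_⟩
    simp only [Pi.inv_apply, smul_inv', ← mul_inv]
    rw [ha' g h j]

/-- Continuous 2-coboundaries: the coboundaries of locally constant 1-cochains. -/
def contB2 : Subgroup (G × G → M) where
  carrier := {f | ∃ x : G → M, IsLocallyConstant x ∧
    ∀ g h : G, g • x h / x (g * h) * x g = f (g, h)}
  one_mem' := ⟨1, IsLocallyConstant.const 1, fun g h => by simp⟩
  mul_mem' := by
    rintro a b ⟨x, hx, hx'⟩ ⟨y, hy, hy'⟩
    refine ⟨x * y, hx.mul hy, fun g h => ?_⟩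
    simp only [Pi.mul_apply, smul_mul', ← hx', ← hy', div_eq_mul_inv, mul_inv]
    ac_rfl
  inv_mem' := by
    rintro a ⟨x, hx, hx'⟩
    refine ⟨x⁻¹, hx.inv, fun g h => ?_⟩
    simp only [Pi.inv_apply, smul_inv', ← hx', div_eq_mul_inv, mul_inv]

/-- Continuous 1-cocycles of `G` with values in the `n`-torsion subgroup of `M`. -/
def contZ1Torsion (n : ℕ) : Subgroup (G → M) where
  carrier := {z | IsLocallyConstant z ∧ groupCohomology.IsMulCocycle₁ z ∧ ∀ g, z g ^ n = 1}
  one_mem' := ⟨IsLocallyConstant.const 1, fun g h => by simp, fun g => by simp⟩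
  mul_mem' := by
    rintro a b ⟨ha, ha', ha''⟩ ⟨hb, hb', hb''⟩
    refine ⟨ha.mul hb, fun g h => ?_, fun g => ?_⟩
    · simp only [Pi.mul_apply, smul_mul']
      rw [ha' g h, hb' g h, mul_mul_mul_comm]
    · simp [mul_pow, ha'' g, hb'' g]
  inv_mem' := by
    rintro a ⟨ha, ha', ha''⟩
    refine ⟨ha.inv, fun g h => ?_, fun g => ?_⟩
    · simp only [Pi.inv_apply, smul_inv', ← mul_inv]
      rw [ha' g h]
    · simp [ha'' g]

end Cochains

/-- The `n`-torsion subgroup of `2A`. -/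
def nTorsionOfTwice (n : ℕ) (A : Type*) [AddCommGroup A] : AddSubgroup A :=
  (nsmulAddMonoidHom n : A →+ A).ker ⊓ (nsmulAddMonoidHom 2 : A →+ A).range

/-- A finite family `v` is a basis of the abelian group `A`: it generates `A`, and `A` is the
direct sum of the cyclic groups generated by the `v i` (some of which may be zero). -/
def IsAbelianBasis {ι A : Type*} [Fintype ι] [AddCommGroup A] (v : ι → A) : Prop :=
  AddSubgroup.closure (Set.range v) = ⊤ ∧
    ∀ b : ι → ℤ, ∑ i, b i • v i = 0 → ∀ i, b i • v i = 0

/-! ### Galois groups, characters, Kummer cocycles, the Brauer group -/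

/-- `ℚ/ℤ`, regarded as a discrete group. -/
abbrev QmodZ : Type := ℚ ⧸ AddSubgroup.zmultiples (1 : ℚ)

section Field

variable (F : Type*) [Field F]

/-- The multiplicative group of the separable closure. -/
def SepUnits : Type _ := (SeparableClosure F)ˣ

instance : CommGroup (SepUnits F) := inferInstanceAs (CommGroup (SeparableClosure F)ˣ)

/-- The absolute Galois group, with its Krull topology. -/
abbrev GalSep : Type _ := SeparableClosure F ≃ₐ[F] SeparableClosure F

/-- The natural action of the Galois group on `F_sepˣ`. -/
instance : MulDistribMulAction (GalSep F) (SepUnits F) :=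
  inferInstanceAs (MulDistribMulAction (SeparableClosure F ≃ₐ[F] SeparableClosure F)
    (SeparableClosure F)ˣ)

/-- The character group `X(F) = H¹(F, ℚ/ℤ)`: continuous homomorphisms from the absolute Galois
group to the discrete group `ℚ/ℤ`. -/
def CharGroup : AddSubgroup (GalSep F → QmodZ) where
  carrier := {χ | IsLocallyConstant χ ∧ ∀ σ τ, χ (σ * τ) = χ σ + χ τ}
  zero_mem' := ⟨IsLocallyConstant.const 0, fun σ τ => by simp⟩
  add_mem' := by
    rintro a b ⟨ha, ha'⟩ ⟨hb, hb'⟩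
    refine ⟨ha.add hb, fun σ τ => ?_⟩
    simp only [Pi.add_apply, ha', hb']
    abel
  neg_mem' := by
    rintro a ⟨ha, ha'⟩
    refine ⟨ha.neg, fun σ τ => ?_⟩
    simp only [Pi.neg_apply, ha']
    abel

/-- `Z¹(F, μₙ)`, written additively. By Hilbert 90 its elements are the cocycles
`σ ↦ σ(y)/y` with `y ^ n ∈ Fˣ`. -/
def KummerZ1 (n : ℕ) : Type _ := Additive (contZ1Torsion (GalSep F) (SepUnits F) n)

instance (n : ℕ) : AddCommGroup (KummerZ1 F n) :=
  inferInstanceAs (AddCommGroup (Additive (contZ1Torsion (GalSep F) (SepUnits F) n)))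

variable {F} in
/-- The function `σ ↦ z(σ)` underlying a cocycle. -/
def KummerZ1.val {n : ℕ} (z : KummerZ1 F n) : GalSep F → SepUnits F := (Additive.toMul z).1

variable {F} in
lemma KummerZ1.prop {n : ℕ} (z : KummerZ1 F n) : IsLocallyConstant z.val ∧
    groupCohomology.IsMulCocycle₁ z.val ∧ ∀ g, z.val g ^ n = 1 := (Additive.toMul z).2

/-- The Brauer group `Br(F) = H²(F, F_sepˣ)`, written additively. -/
def BrGroup : Type _ :=
  Additive (contZ2 (GalSep F) (SepUnits F) ⧸
    (contB2 (GalSep F) (SepUnits F)).subgroupOf (contZ2 (GalSep F) (SepUnits F)))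

instance : AddCommGroup (BrGroup F) :=
  inferInstanceAs (AddCommGroup (Additive (contZ2 (GalSep F) (SepUnits F) ⧸
    (contB2 (GalSep F) (SepUnits F)).subgroupOf (contZ2 (GalSep F) (SepUnits F)))))

variable {F} in
/-- The class in `Br(F)` of a 2-cocycle. -/
def BrGroup.mk (f : contZ2 (GalSep F) (SepUnits F)) : BrGroup F :=
  Additive.ofMul (QuotientGroup.mk f)

variable {F} in
lemma BrGroup.mk_mul (f g : contZ2 (GalSep F) (SepUnits F)) :
    BrGroup.mk (f * g) = BrGroup.mk f + BrGroup.mk g := rfl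

/-- The `n`-torsion of `2 X(F)`. -/
def CharTwice (n : ℕ) : Type _ := nTorsionOfTwice n (CharGroup F)

instance (n : ℕ) : AddCommGroup (CharTwice F n) :=
  inferInstanceAs (AddCommGroup (nTorsionOfTwice n (CharGroup F)))

variable {F} in
/-- The function `σ ↦ θ(σ)` underlying a character. -/
def CharTwice.val {n : ℕ} (θ : CharTwice F n) : GalSep F → QmodZ :=
  (Subtype.val θ : CharGroup F).1

variable {F} in
lemma CharTwice.prop {n : ℕ} (θ : CharTwice F n) :
    IsLocallyConstant θ.val ∧ ∀ σ τ, θ.val (σ * τ) = θ.val σ + θ.val τ :=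
  (Subtype.val θ : CharGroup F).2

/-- The `n`-torsion of `2 Br(F)`. -/
abbrev BrTwice (n : ℕ) : AddSubgroup (BrGroup F) := nTorsionOfTwice n (BrGroup F)

end Field

/-! ### The cup product -/

/-- For `a ∈ (1/n)ℤ/ℤ`, an integer `k` with `a = k/n` in `ℚ/ℤ`, well defined modulo `n`.
(It is `0` if `a` is not in `(1/n)ℤ/ℤ`, a case that is never used.) -/
def numer (n : ℕ) (a : QmodZ) : ℤ :=
  open Classical in
  if h : ∃ k : ℤ, (((k : ℚ) / (n : ℚ) : ℚ) : QmodZ) = a then h.choose else 0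

lemma numer_spec {n : ℕ} (hn : n ≠ 0) {a : QmodZ} (ha : n • a = 0) :
    (((numer n a : ℚ) / (n : ℚ) : ℚ) : QmodZ) = a := by
  have h : ∃ k : ℤ, (((k : ℚ) / (n : ℚ) : ℚ) : QmodZ) = a := by
    induction a using QuotientAddGroup.induction_on with
    | H r =>
      rw [← QuotientAddGroup.mk_nsmul, QuotientAddGroup.eq_zero_iff,
        AddSubgroup.mem_zmultiples_iff] at ha
      obtain ⟨k, hk⟩ := ha
      refine ⟨k, ?_⟩
      congr 1
      have : (n : ℚ) ≠ 0 := by exact_mod_cast hn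
      rw [div_eq_iff this]
      simp only [zsmul_eq_mul, mul_one, nsmul_eq_mul] at hk
      rw [hk, mul_comm]
  unfold numer
  rw [dif_pos h]
  exact h.choose_spec

lemma zpow_eq_of_div_eq {M : Type*} [CommGroup M] {n : ℕ} (hn : n ≠ 0) {w : M} (hw : w ^ n = 1)
    {k l : ℤ} (h : (((k : ℚ) / (n : ℚ) : ℚ) : QmodZ) = (((l : ℚ) / (n : ℚ) : ℚ) : QmodZ)) :
    w ^ k = w ^ l := by
  rw [QuotientAddGroup.eq, AddSubgroup.mem_zmultiples_iff] at h
  obtain ⟨c, hc⟩ := h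
  have hn' : (n : ℚ) ≠ 0 := by exact_mod_cast hn
  have : l = k + n * c := by
    have : (l : ℚ) = k + n * c := by
      simp only [zsmul_eq_mul, mul_one] at hc
      rw [hc]
      field_simp
      ring
    exact_mod_cast this
  rw [this, zpow_add, zpow_mul, zpow_natCast, hw, one_zpow, mul_one]

/-- `w ^ (numer n a)` is the image of `a ⊗ w` under `(1/n)ℤ/ℤ ⊗ μₙ → μₙ`. -/
lemma zpow_numer_add {M : Type*} [CommGroup M] {n : ℕ} (hn : n ≠ 0) {w : M} (hw : w ^ n = 1)
    {a b : QmodZ} (ha : n • a = 0) (hb : n • b = 0) :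
    w ^ numer n (a + b) = w ^ numer n a * w ^ numer n b := by
  rw [← zpow_add]
  apply zpow_eq_of_div_eq hn hw
  rw [numer_spec hn (by rw [nsmul_add, ha, hb, add_zero])]
  push_cast
  rw [add_div, QuotientAddGroup.mk_add, numer_spec hn ha, numer_spec hn hb]

section Cup

variable {F : Type*} [Field F] {n : ℕ}

lemma CharTwice.nsmul_apply (θ : CharTwice F n) (σ : GalSep F) : n • (θ.val σ) = 0 := by
  have h : n • (Subtype.val θ : CharGroup F) = 0 := (Subtype.property θ).1
  exact congrFun (congrArg Subtype.val h) σ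

lemma KummerZ1.smul_pow_eq_one (z : KummerZ1 F n) (σ τ : GalSep F) :
    (σ • z.val τ) ^ n = 1 := by
  rw [← smul_pow', z.prop.2.2 τ, smul_one]

/-- The cup product on cochains: `(θ ∪ z)(σ, τ) = θ(σ) ⊗ σ(z(τ))`, where `k/n ⊗ w = w ^ k`. -/
def cupCochain (θ : CharTwice F n) (z : KummerZ1 F n) : GalSep F × GalSep F → SepUnits F :=
  fun g => (g.1 • z.val g.2) ^ numer n (θ.val g.1)

lemma isLocallyConstant_galSep_smul (w : SepUnits F) :
    IsLocallyConstant (fun σ : GalSep F => σ • w) := by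
  rw [IsLocallyConstant.iff_exists_open]
  intro σ
  refine ⟨(fun τ => σ⁻¹ * τ) ⁻¹'
    (MulAction.stabilizer (GalSep F) (Units.val w) : Set (GalSep F)),
    (stabilizer_isOpen_of_isIntegral (Units.val w)).preimage
      (continuous_const_mul σ⁻¹), ?_, ?_⟩
  · simp
  · intro τ hτ
    have h : (σ⁻¹ * τ) • (Units.val w) = Units.val w := hτ
    rw [mul_smul, inv_smul_eq_iff] at h
    exact Units.ext h

lemma isLocallyConstant_cupCochain (θ : CharTwice F n) (z : KummerZ1 F n) :
    IsLocallyConstant (cupCochain θ z) := by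
  rw [IsLocallyConstant.iff_eventually_eq]
  rintro ⟨σ, τ⟩
  have h1 := ((IsLocallyConstant.iff_eventually_eq _).1
    (isLocallyConstant_galSep_smul (z.val τ)) σ).and
    ((IsLocallyConstant.iff_eventually_eq _).1 θ.prop.1 σ)
  have h2 := (IsLocallyConstant.iff_eventually_eq _).1 z.prop.1 τ
  rw [nhds_prod_eq]
  filter_upwards [h1.prod_mk h2] with g hg
  obtain ⟨⟨ha, hb⟩, hc⟩ := hg
  simp only [cupCochain]
  rw [hb, hc, ha]

lemma isMulCocycle₂_cupCochain [NeZero n] (θ : CharTwice F n) (z : KummerZ1 F n) :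
    groupCohomology.IsMulCocycle₂ (cupCochain θ z) := by
  intro g h j
  simp only [cupCochain]
  have hθ : θ.val (g * h) = θ.val g + θ.val h := θ.prop.2 g h
  have hz : z.val (h * j) = h • z.val j * z.val h := z.prop.2.1 h j
  rw [hθ, hz, zpow_numer_add (NeZero.ne n) (KummerZ1.smul_pow_eq_one z _ _)
    (θ.nsmul_apply g) (θ.nsmul_apply h), smul_mul', mul_zpow, smul_zpow', mul_smul]
  rw [mul_comm ((g • h • z.val j) ^ numer n (θ.val g)), mul_assoc]

/-- The cup product `θ ∪ z` as a Brauer class. -/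
def cupClass [NeZero n] (θ : CharTwice F n) (z : KummerZ1 F n) : BrGroup F :=
  BrGroup.mk ⟨cupCochain θ z, isLocallyConstant_cupCochain θ z, isMulCocycle₂_cupCochain θ z⟩

lemma cupClass_add_right [NeZero n] (θ : CharTwice F n) (z w : KummerZ1 F n) :
    cupClass θ (z + w) = cupClass θ z + cupClass θ w := by
  unfold cupClass
  rw [← BrGroup.mk_mul]
  congr 1
  apply Subtype.ext
  funext g
  change (g.1 • (z.val g.2 * w.val g.2)) ^ _ = _
  rw [smul_mul', mul_zpow]
  rfl

lemma cupClass_add_left [NeZero n] (θ η : CharTwice F n) (z : KummerZ1 F n) :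
    cupClass (θ + η) z = cupClass θ z + cupClass η z := by
  unfold cupClass
  rw [← BrGroup.mk_mul]
  congr 1
  apply Subtype.ext
  funext g
  exact zpow_numer_add (NeZero.ne n) (KummerZ1.smul_pow_eq_one z _ _)
    (θ.nsmul_apply g.1) (η.nsmul_apply g.1)

variable (F n) in
/-- The cup product as a biadditive map. -/
def cupBihom [NeZero n] : CharTwice F n →+ KummerZ1 F n →+ BrGroup F :=
  AddMonoidHom.mk' (fun θ => AddMonoidHom.mk' (cupClass θ) (cupClass_add_right θ))
    (fun θ η => AddMonoidHom.ext (cupClass_add_left θ η))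

variable (F n) in
/-- The tensor product over `ℤ` of the `n`-torsion of `2 X(F)` with `Z¹(F, μₙ)`. -/
abbrev CupTensor : Type _ := CharTwice F n ⊗[ℤ] KummerZ1 F n

instance : AddCommGroup (CupTensor F n) := TensorProduct.addCommGroup

variable (F n) in
/-- The cup product map on the tensor product of the `n`-torsion of `2 X(F)` with `Z¹(F, μₙ)`. -/
def cupProduct [NeZero n] : CupTensor F n →+ BrGroup F :=
  TensorProduct.liftAddHom (cupBihom F n) (fun r θ z => by
    rw [map_zsmul, AddMonoidHom.zsmul_apply, map_zsmul])

end Cup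

/-! ### Matched pairs -/

section Matched

variable (F : Type*) [Field F] (n : ℕ)

/-- An isomorphism `ζₙ* : μₙ ≃ (1/n)ℤ/ℤ`, where `μₙ` is the group of `n`-th roots of unity in the
separable closure. -/
abbrev RootsIso : Type _ :=
  Additive (rootsOfUnity n (SeparableClosure F)) ≃+ (nsmulAddMonoidHom n : QmodZ →+ QmodZ).ker

variable {F n}

/-- For `z = t^{1/n}` and `g` dividing both `n` and `|μₙ(F)|`, the character
`(t)_g^* = ζ_g^* ∘ t^{1/g}`, as a function on the Galois group. Here `t^{1/g}` is the cocycle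
`z ^ (n / g)`. -/
def starChar (ζ : RootsIso F n) (z : KummerZ1 F n) (g : ℕ) : GalSep F → QmodZ := fun σ =>
  (ζ (Additive.ofMul ⟨z.val σ ^ (n / g), (pow_right_comm (z.val σ) (n / g) n).trans
    ((congrArg (· ^ (n / g)) (z.prop.2.2 σ)).trans (one_pow _))⟩)).1

/-- `|θ|/g' · θ = (t)_{g'}^*`, where `g' = gcd(|θ|, m')`. -/
def IsNormalized (m' : ℕ) (ζ : RootsIso F n) (θ : CharTwice F n) (z : KummerZ1 F n) : Prop :=
  ((addOrderOf θ / (addOrderOf θ).gcd m') • θ).val = starChar ζ z ((addOrderOf θ).gcd m')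

/-- `m' = m/2` if `m = 2 ^ v₂(q - 1)` and `n` is even, and `m' = m` otherwise, where
`m = gcd(q - 1, n)`. -/
def mPrime (q n : ℕ) : ℕ :=
  if 2 ∣ n ∧ (q - 1).gcd n = 2 ^ padicValNat 2 (q - 1) then (q - 1).gcd n / 2
  else (q - 1).gcd n

/-- A basis `χ₀, …, χ_d` of the `n`-torsion of `2 X(F)`, with `χ₀` of order `n` and the other `χᵢ`
of order `m'`, together with a basis `x₀^{1/n}, …, x_d^{1/n}` of `Z¹(F, μₙ)`, such that
`(χ₀, x₀) = 0` and `|χᵢ|/gᵢ' · χᵢ = (xᵢ)_{gᵢ'}^*` for all `i`, where `gᵢ' = gcd(|χᵢ|, m')`. -/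
structure IsAdaptedBasis [NeZero n] (m' d : ℕ) (ζ : RootsIso F n)
    (χ : Fin (d + 1) → CharTwice F n) (x : Fin (d + 1) → KummerZ1 F n) : Prop where
  basis_char : IsAbelianBasis χ
  order_zero : addOrderOf (χ 0) = n
  order_succ : ∀ i, i ≠ 0 → addOrderOf (χ i) = m'
  basis_cocycle : IsAbelianBasis x
  cup_zero : cupProduct F n (χ 0 ⊗ₜ[ℤ] x 0) = 0
  normalized : ∀ i, IsNormalized m' ζ (χ i) (x i)

/-- `θ` and `z = t^{1/n}` are matched: their coordinates `b`, `c` with respect to an adapted basis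
satisfy the linear dependence relations, and the pair is normalized. -/
def IsMatched [NeZero n] (m' d : ℕ) (ζ : RootsIso F n) (θ : CharTwice F n) (z : KummerZ1 F n) :
    Prop :=
  (∃ (χ : Fin (d + 1) → CharTwice F n) (x : Fin (d + 1) → KummerZ1 F n) (b c : Fin (d + 1) → ℤ),
    IsAdaptedBasis m' d ζ χ x ∧ θ = ∑ i, b i • χ i ∧ z = ∑ i, c i • x i ∧
    (∀ j, j ≠ 0 → b 0 * c j ≡ ((n / m' : ℕ) : ℤ) * c 0 * b j [ZMOD n]) ∧
    (∀ i j, i ≠ 0 → j ≠ 0 → b i * c j ≡ c i * b j [ZMOD m'])) ∧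
  IsNormalized m' ζ θ z

/-- The subgroup `C` of the tensor product generated by the `θ ⊗ t^{1/n}` with `θ` and `t^{1/n}`
matched. -/
def matchedSubgroup [NeZero n] (m' d : ℕ) (ζ : RootsIso F n) :
    AddSubgroup (CupTensor F n) :=
  AddSubgroup.closure {t | ∃ θ z, IsMatched m' d ζ θ z ∧ t = θ ⊗ₜ[ℤ] z}

/-- The wedge product of the `n`-torsion of `2 X(F)` with `Z¹(F, μₙ)`. -/
abbrev WedgeProduct [NeZero n] (m' d : ℕ) (ζ : RootsIso F n) : Type _ :=
  (CupTensor F n) ⧸ matchedSubgroup m' d ζ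

end Matched

end

/-!
The Brauer group of `F` is computed explicitly at the prime `ℓ`, and the cup products of an adapted
basis turn out to be its generators.

*Arithmetic of the separable closure.* The integral closure of a henselian valuation ring in a
Galois extension is a valuation ring (`mem_or_inv_mem_integralClosure_of_henselian`). Hence the
valuation extends to the separable closure, invariantly under the Galois group, and Hensel's lemma
yields an inertia group, a Frobenius element, and the divisibility and independence properties of
elements `πᵢ` of `F` whose values form a basis of the value group. What the prime `ℓ` needs of this
is recorded in `TameFrame` (`exists_tameFrame`). A `KummerFrame` adds compatible roots of unity and
roots of the `πᵢ`, and with them the `ℓ`-adic cyclotomic character and the `ℓ`-adic Kummer cocycles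
`aᵢ` of the `πᵢ`.

*The Brauer group.* The finite quotients of the common kernel of the `aᵢ` on inertia have order
prime to `ℓ`, so every 2-cocycle of `ℓ`-power order splits there. Adding one Kummer cocycle at a
time, a cocycle becomes on inertia cohomologous to a symbol `∏ ζ ^ (Mᵢⱼ aᵢ aⱼ)`
(`exists_splitsOn_div_sym`). A symbol splits on inertia precisely when it is symmetric
(`splitsOn_sym_of_isSymm`, `dvd_sub_of_splitsOn_sym`). Invariance under the Frobenius forces a class
defined over `F` to come from a symbol at the level of the roots of unity of `F`, with strictly
upper triangular `M`. A class which splits on inertia splits on a finite unramified level, and is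
there the class of a cyclic algebra (`SplitsOn.exists_carry`). Altogether a Brauer class of
`ℓ`-power order is a strictly upper triangular symbol plus unramified cyclic algebras with the
elements `πᵢ`, and these summands are independent (`exists_eq_symClass_add`,
`dvd_of_symClass_add_eq_zero`).

*The cup product.* The unramified character `χ₀`, the tamely ramified characters `χᵢ = aᵢ / m'`, an
unramified cocycle `x₀` and the Kummer cocycles `xᵢ` of the `πᵢ` form an adapted basis
(`KummerFrame.isAdaptedBasis`). The cup products of `χᵢ` with `xⱼ` are symbols, those of `χ₀` with
`xⱼ` are the unramified cyclic algebras, and `χ₀` with `x₀` gives `0`. The cup product of a cocycle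
with its own character vanishes (`cupClass_eq_zero_of_val_eq_starChar`); it does so at level `m'`
also for `ℓ = 2`, because the roots of unity of order `2 m'` lie in `F`. Therefore the cup products
of any adapted basis satisfy the relations of an alternating form (`cupClass_relations`), which
kill the matched pairs (`matchedSubgroup_le_ker`). Conversely, modulo matched pairs of the
particular adapted basis above, every tensor is equivalent to a combination of `χ₀ ⊗ xⱼ` and of
`χᵢ ⊗ xⱼ` with `i < j` (`exists_sub_reducedTensor_mem`), and such a combination vanishes if its cup
product does, by independence (`reducedTensor_eq_zero`). This gives the kernel. The image is read
off from the coordinates of the classes in twice the Brauer group (`cupProduct_mem_brTwice`,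
`exists_cupProduct_eq`).
-/

noncomputable section

/-! ### Extensions of henselian valuation rings -/

section HenselianClosure

open Polynomial IsLocalRing

open scoped Pointwise in
/-- Above a henselian local ring, the invariants of a finite group acting on a domain, there is only
one maximal ideal. If `P` were one of several, an element congruent to `1` modulo `P` and to `0`
modulo the others, made invariant under the stabilizer of `P`, would have an orbit polynomial with a
simple root `1` modulo `P`. By Hensel's lemma the element would lie in the base ring, where the
maximal ideals cannot tell `0` and `1` apart. -/
theorem Algebra.IsInvariant.eq_of_isMaximal_of_henselian
    (A B Δ : Type*) [CommRing A] [HenselianLocalRing A] [CommRing B] [IsDomain B]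
    [Algebra A B] [Group Δ] [Finite Δ] [MulSemiringAction Δ B] [SMulCommClass Δ A B]
    [Algebra.IsInvariant A B Δ] (P Q : Ideal B) [hP : P.IsMaximal] [hQ : Q.IsMaximal] :
    P = Q := by
  classical
  cases nonempty_fintype Δ
  have := Algebra.IsInvariant.isIntegral A B Δ
  have hunder : ∀ (R : Ideal B) [R.IsMaximal], R.under A = maximalIdeal A := fun R _ =>
    IsLocalRing.eq_maximalIdeal (Ideal.isMaximal_comap_of_isIntegral_of_isMaximal R)
  by_contra hne
  -- an element congruent to `1` modulo `P` and to `0` modulo all other maximal ideals `g • P`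
  let T : Finset (Ideal B) := (Finset.univ.image (fun g : Δ => g • P)).erase P
  have hmax : ∀ g : Δ, (g • P).IsMaximal := fun g => by
    rw [Ideal.pointwise_smul_eq_comap]
    exact Ideal.comap_isMaximal_of_surjective _ (MulSemiringAction.toRingEquiv Δ B g⁻¹).surjective
  have hTmax : ∀ R ∈ T, R.IsMaximal := fun R hR => by
    obtain ⟨g, -, rfl⟩ := Finset.mem_image.1 (Finset.mem_of_mem_erase hR)
    exact hmax g
  have htop : P ⊔ ⨅ R ∈ T, R = ⊤ := Ideal.sup_iInf_eq_top fun R hR =>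
    hP.coprime_of_ne (hTmax R hR) (Finset.ne_of_mem_erase hR).symm
  obtain ⟨e, he, z, hz, hez⟩ := Submodule.mem_sup.1 ((Ideal.eq_top_iff_one _).1 htop)
  have hzT : ∀ R ∈ T, z ∈ R := fun R hR => by
    have := (Submodule.mem_iInf _).1 hz R
    exact (Submodule.mem_iInf _).1 this hR
  let y : B := ∏ g ∈ Finset.univ.filter (fun g : Δ => g • P = P), g • z
  have hy1 : y - 1 ∈ P := by
    rw [← Ideal.Quotient.mk_eq_mk_iff_sub_mem, map_prod, map_one]
    refine Finset.prod_eq_one fun g hg => ?_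
    rw [Finset.mem_filter] at hg
    rw [← map_one (Ideal.Quotient.mk P), Ideal.Quotient.mk_eq_mk_iff_sub_mem]
    have h1 : g • e ∈ g • P := Ideal.smul_mem_pointwise_smul _ _ _ he
    rw [hg.2] at h1
    have h2 : g • z - 1 = - (g • e) := by
      rw [← sub_eq_zero, sub_neg_eq_add, sub_add_eq_add_sub, add_comm, ← smul_add, hez, smul_one,
        sub_self]
    rw [h2]
    exact neg_mem h1
  have hystab : ∀ g : Δ, g • P = P → g • y = y := by
    intro g hg
    change g • (∏ g' ∈ _, g' • z) = ∏ g' ∈ _, g' • z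
    rw [Finset.smul_prod']
    refine Finset.prod_bij (fun g' _ => g * g') ?_ ?_ ?_ ?_
    · intro g' hg'
      rw [Finset.mem_filter] at hg' ⊢
      exact ⟨Finset.mem_univ _, by rw [mul_smul, hg'.2, hg]⟩
    · intro a _ b _ h
      exact mul_left_cancel h
    · intro b hb
      rw [Finset.mem_filter] at hb
      refine ⟨g⁻¹ * b, Finset.mem_filter.2 ⟨Finset.mem_univ _, ?_⟩, by group⟩
      rw [mul_smul, hb.2, inv_smul_eq_iff, hg]
    · intro a _
      rw [mul_smul]
  have hyT : ∀ R ∈ T, y ∈ R := fun R hR => by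
    have h1 : (1 : Δ) ∈ Finset.univ.filter (fun g : Δ => g • P = P) := by simp
    change (∏ g' ∈ _, g' • z) ∈ R
    rw [← Finset.mul_prod_erase _ _ h1, one_smul]
    exact R.mul_mem_right _ (hzT R hR)
  have hyconj : ∀ g : Δ, g • P ≠ P → g • y ∈ P := by
    intro g hg
    have h1 : g⁻¹ • P ∈ T := by
      refine Finset.mem_erase.2 ⟨fun h => hg ?_, Finset.mem_image.2 ⟨g⁻¹, Finset.mem_univ _, rfl⟩⟩
      rw [inv_smul_eq_iff] at h
      exact h.symm
    have h2 := Ideal.smul_mem_pointwise_smul g _ _ (hyT _ h1)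
    rwa [smul_inv_smul] at h2
  -- the orbit polynomial of `y`; it has coefficients in `A` and `1` as a simple root modulo `P`
  let O : Finset B := Finset.univ.image (fun g : Δ => g • y)
  have hyO : y ∈ O := Finset.mem_image.2 ⟨1, Finset.mem_univ _, one_smul _ _⟩
  let h : B[X] := ∏ w ∈ O, (X - C w)
  have hmon : h.Monic := monic_prod_of_monic _ _ fun _ _ => monic_X_sub_C _
  have hinv : ∀ g : Δ, g • h = h := by
    intro g
    change g • (∏ w ∈ O, (X - C w)) = ∏ w ∈ O, (X - C w)
    rw [Finset.smul_prod']
    refine Finset.prod_bij (fun w _ => g • w) ?_ ?_ ?_ ?_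
    · intro w hw
      obtain ⟨g', -, rfl⟩ := Finset.mem_image.1 hw
      exact Finset.mem_image.2 ⟨g * g', Finset.mem_univ _, mul_smul _ _ _⟩
    · intro a _ b _ hab
      exact smul_left_cancel g hab
    · intro w hw
      obtain ⟨g', -, rfl⟩ := Finset.mem_image.1 hw
      exact ⟨(g⁻¹ * g') • y, Finset.mem_image.2 ⟨_, Finset.mem_univ _, rfl⟩, by
        rw [smul_smul, mul_inv_cancel_left]⟩
    · intro w _
      rw [smul_sub, smul_X, smul_C]
  have hlift : h ∈ Polynomial.lifts (algebraMap A B) :=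
    (lifts_iff_coeff_lifts _).2 fun n => Algebra.IsInvariant.isInvariant (G := Δ) _
      (fun g => by rw [← coeff_smul, hinv g])
  obtain ⟨f, hf, -, hfmon⟩ := lifts_and_natDegree_eq_and_monic hlift hmon
  have hy1' : Ideal.Quotient.mk P y = 1 := by
    rw [← map_one (Ideal.Quotient.mk P), Ideal.Quotient.mk_eq_mk_iff_sub_mem]
    exact hy1
  have hroot : h.eval y = 0 := by
    change (∏ w ∈ O, (X - C w)).eval y = 0
    rw [eval_prod]
    exact Finset.prod_eq_zero hyO (by simp)
  have hder : Ideal.Quotient.mk P (h.derivative.eval y) = 1 := by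
    have h1 : h = (X - C y) * ∏ w ∈ O.erase y, (X - C w) := (Finset.mul_prod_erase _ _ hyO).symm
    rw [h1, derivative_mul, derivative_X_sub_C, one_mul, eval_add, eval_mul, eval_sub, eval_X,
      eval_C, sub_self, zero_mul, add_zero, eval_prod, map_prod]
    refine Finset.prod_eq_one fun w hw => ?_
    obtain ⟨g, -, rfl⟩ := Finset.mem_image.1 (Finset.mem_of_mem_erase hw)
    rw [eval_sub, eval_X, eval_C, map_sub, hy1', Ideal.Quotient.eq_zero_iff_mem.2
      (hyconj g fun hg => Finset.ne_of_mem_erase hw (hystab g hg)), sub_zero]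
  have hmap : ∀ a : A, a ∈ maximalIdeal A ↔ algebraMap A B a ∈ P := fun a => by
    rw [← hunder P]; rfl
  have hquot : ∀ r : A[X], Ideal.Quotient.mk P (algebraMap A B (r.eval 1)) =
      Ideal.Quotient.mk P ((r.map (algebraMap A B)).eval y) := fun r => by
    rw [← eval_map_apply, map_one, eval_map, eval_map, hom_eval₂, hom_eval₂, hy1', map_one]
  obtain ⟨a, ha, ha1⟩ := HenselianLocalRing.is_henselian f hfmon 1
    ((hmap _).2 (by
      rw [← Ideal.Quotient.eq_zero_iff_mem, hquot, hf, hroot, map_zero]))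
    (by
      rw [← IsLocalRing.notMem_maximalIdeal, hmap, ← Ideal.Quotient.eq_zero_iff_mem, hquot,
        ← derivative_map, hf, hder]
      exact one_ne_zero)
  -- the root lies in the orbit of `y`, hence equals `y`
  have hya : algebraMap A B a = y := by
    have h1 : h.eval (algebraMap A B a) = 0 := by
      rw [← hf, eval_map_algebraMap, aeval_algebraMap_apply, coe_aeval_eq_eval, ha.eq_zero,
        map_zero]
    change (∏ w ∈ O, (X - C w)).eval _ = 0 at h1
    rw [eval_prod, Finset.prod_eq_zero_iff] at h1
    obtain ⟨w, hw, hw0⟩ := h1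
    obtain ⟨g, -, rfl⟩ := Finset.mem_image.1 hw
    rw [eval_sub, eval_X, eval_C, sub_eq_zero] at hw0
    have := congrArg (g⁻¹ • ·) hw0
    simpa [smul_algebraMap] using this
  have hQT : Q ∈ T := by
    obtain ⟨g, hg⟩ := Algebra.IsInvariant.exists_smul_of_under_eq A B Δ P Q
      ((hunder P).trans (hunder Q).symm)
    exact Finset.mem_erase.2 ⟨Ne.symm hne, Finset.mem_image.2 ⟨g, Finset.mem_univ _, hg.symm⟩⟩
  have h1 : a ∈ maximalIdeal A := by
    rw [← hunder Q]
    change algebraMap A B a ∈ Q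
    rw [hya]
    exact hyT Q hQT
  have h2 : (1 : A) ∈ maximalIdeal A := by simpa using sub_mem h1 ha1
  exact (Ideal.ne_top_iff_one _).1 (maximalIdeal.isMaximal A).ne_top h2

/-- The integral closure of a henselian local domain in a finite Galois extension is local. -/
theorem isLocalRing_integralClosure_of_henselian
    (A K E : Type*) [CommRing A] [IsDomain A] [HenselianLocalRing A] [IsIntegrallyClosed A]
    [Field K] [Algebra A K] [IsFractionRing A K] [Field E] [Algebra K E] [Algebra A E]
    [IsScalarTower A K E] [FiniteDimensional K E] [IsGalois K E] :
    IsLocalRing (integralClosure A E) := by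
  let B := integralClosure A E
  have : IsFractionRing B E := integralClosure.isFractionRing_of_finite_extension K E
  let _ := IsIntegralClosure.MulSemiringAction A K E B
  have hsm : ∀ (g : Gal(E/K)) (b : B), ((g • b : B) : E) = g (b : E) := fun g b =>
    algebraMap_galRestrictHom_apply A K E B g b
  have : SMulCommClass Gal(E/K) A B := ⟨fun g a b => by
    apply Subtype.ext
    rw [hsm, Algebra.smul_def, Algebra.smul_def]
    change g (algebraMap A E a * b) = algebraMap A E a * ((g • b : B) : E)
    rw [map_mul, hsm, IsScalarTower.algebraMap_apply A K E, AlgEquiv.commutes]⟩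
  have : Algebra.IsInvariant A B Gal(E/K) := Algebra.isInvariant_of_isGalois A K E B
  obtain ⟨P, hP⟩ := Ideal.exists_maximal B
  exact IsLocalRing.of_unique_max_ideal ⟨P, hP, fun Q hQ =>
    Algebra.IsInvariant.eq_of_isMaximal_of_henselian A B Gal(E/K) Q P⟩

/-- The integral closure of a henselian local domain in a Galois extension is local. -/
theorem isLocalRing_integralClosure_of_henselian_of_isGalois
    (A K L : Type*) [CommRing A] [IsDomain A] [HenselianLocalRing A] [IsIntegrallyClosed A]
    [Field K] [Algebra A K] [IsFractionRing A K] [Field L] [Algebra K L] [Algebra A L]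
    [IsScalarTower A K L] [IsGalois K L] :
    IsLocalRing (integralClosure A L) := by
  refine IsLocalRing.of_isUnit_or_isUnit_one_sub_self fun x => ?_
  obtain ⟨E, hE⟩ : ∃ E : FiniteGaloisIntermediateField K L, (x : L) ∈ E.toIntermediateField :=
    ⟨FiniteGaloisIntermediateField.adjoin K {(x : L)},
      FiniteGaloisIntermediateField.subset_adjoin K _ rfl⟩
  have : IsLocalRing (integralClosure A E) := isLocalRing_integralClosure_of_henselian A K E
  have : IsScalarTower A E L := IsScalarTower.of_algebraMap_eq fun a => by
    rw [IsScalarTower.algebraMap_apply A K E, IsScalarTower.algebraMap_apply A K L,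
      ← IsScalarTower.algebraMap_apply K E L]
  have hint : ∀ y : integralClosure A E, IsIntegral A ((y : E) : L) := fun y =>
    IsIntegral.map (IsScalarTower.toAlgHom A E L) y.2
  let f : integralClosure A E →+* integralClosure A L :=
    { toFun := fun y => ⟨((y : E) : L), hint y⟩
      map_one' := rfl
      map_mul' := fun _ _ => rfl
      map_zero' := rfl
      map_add' := fun _ _ => rfl }
  have hx : IsIntegral A (⟨x, hE⟩ : E) :=
    (isIntegral_algebraMap_iff (FaithfulSMul.algebraMap_injective E L)).1 x.2
  rcases IsLocalRing.isUnit_or_isUnit_one_sub_self (⟨⟨x, hE⟩, hx⟩ : integralClosure A E) with h | h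
  · exact Or.inl (h.map f)
  · exact Or.inr (h.map f)

/-- If `x` is a root of a polynomial over a subring `R` with a unit among its coefficients, where
`R` is local and integrally closed in the field `L`, then `x` or `x⁻¹` lies in `R`. -/
theorem Subring.mem_or_inv_mem_of_coeff_isUnit {L : Type*} [Field L] {R : Subring L}
    [IsIntegrallyClosedIn R L] [IsLocalRing R] (f : R[X]) {x : L} (hx : f.aeval x = 0) {j : ℕ}
    (hj : IsUnit (f.coeff j)) : x ∈ R ∨ x⁻¹ ∈ R := by
  rcases eq_or_ne x 0 with rfl | hx0
  · exact Or.inl R.zero_mem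
  -- the truncations `∑ i ≥ k, c i * x ^ (i - k)` of the polynomial
  let y : ℕ → L := fun k => ∑ i ∈ Finset.Ico k (f.natDegree + 1), (f.coeff i : L) * x ^ (i - k)
  have hsum : ∑ i ∈ Finset.range (f.natDegree + 1), (f.coeff i : L) * x ^ i = 0 := by
    rw [aeval_eq_sum_range] at hx
    rw [← hx]
    exact Finset.sum_congr rfl fun i _ => by rw [Subring.smul_def, smul_eq_mul]
  have hrec : ∀ k, y k = f.coeff k + y (k + 1) * x := by
    intro k
    rcases lt_or_ge k (f.natDegree + 1) with hk | hk
    · simp only [y]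
      rw [Finset.sum_eq_sum_Ico_succ_bot hk, Nat.sub_self, pow_zero, mul_one, Finset.sum_mul]
      congr 1
      refine Finset.sum_congr rfl fun i hi => ?_
      rw [mul_assoc, ← pow_succ]
      congr 2
      have := (Finset.mem_Ico.1 hi).1
      omega
    · simp only [y]
      rw [Finset.Ico_eq_empty (by omega), Finset.Ico_eq_empty (by omega),
        coeff_eq_zero_of_natDegree_lt (by omega)]
      simp
  have hlow : ∀ k ≤ f.natDegree + 1,
      y k * x ^ k = - ∑ i ∈ Finset.range k, (f.coeff i : L) * x ^ i := by
    intro k hk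
    rw [eq_neg_iff_add_eq_zero, ← hsum, add_comm, Finset.range_eq_Ico, Finset.range_eq_Ico,
      ← Finset.sum_Ico_consecutive _ (Nat.zero_le k) hk]
    congr 1
    simp only [y]
    rw [Finset.sum_mul]
    refine Finset.sum_congr rfl fun i hi => ?_
    rw [mul_assoc, ← pow_add]
    congr 2
    have := (Finset.mem_Ico.1 hi).1
    omega
  have hdeg : j ≤ f.natDegree := le_natDegree_of_ne_zero hj.ne_zero
  -- the truncations lie in every valuation ring above `R`
  have hmem : ∀ k ≤ f.natDegree + 1, y k ∈ R ∧ (1 ≤ k → y k * x ∈ R) := by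
    intro k hk
    have key : ∀ z : L, (∀ V : ValuationSubring L, R ≤ V.toSubring → z ∈ V.toSubring) → z ∈ R := by
      intro z hz
      rw [Subring.eq_iInf_of_isIntegrallyClosedIn (R := R)]
      exact Subring.mem_iInf.2 fun V => hz V.1 V.2
    have h1 : ∀ V : ValuationSubring L, R ≤ V.toSubring → x ∈ V.toSubring → y k ∈ V.toSubring :=
      fun V hV hxV => Subring.sum_mem _ fun i _ =>
        Subring.mul_mem _ (hV (f.coeff i).2) (Subring.pow_mem _ hxV _)
    have h2 : ∀ V : ValuationSubring L, R ≤ V.toSubring → x⁻¹ ∈ V.toSubring →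
        (1 ≤ k → y k * x ∈ V.toSubring) ∧ y k ∈ V.toSubring := by
      intro V hV hxV
      have h3 : ∀ e ≤ k, k ≤ e + 1 → y k * x ^ (k - e) ∈ V.toSubring := by
        intro e he he'
        have : y k * x ^ (k - e) = - ∑ i ∈ Finset.range k, (f.coeff i : L) * x⁻¹ ^ (e - i) := by
          have h4 : y k * x ^ (k - e) = (y k * x ^ k) * x⁻¹ ^ e := by
            rw [mul_assoc, inv_pow]
            congr 1
            rw [eq_mul_inv_iff_mul_eq₀ (pow_ne_zero _ hx0), ← pow_add]
            congr 1
            omega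
          rw [h4, hlow k hk, neg_mul, Finset.sum_mul]
          congr 1
          refine Finset.sum_congr rfl fun i hi => ?_
          have hi' := Finset.mem_range.1 hi
          rw [mul_assoc]
          congr 1
          rw [inv_pow, inv_pow, mul_inv_eq_iff_eq_mul₀ (pow_ne_zero _ hx0),
            eq_inv_mul_iff_mul_eq₀ (pow_ne_zero _ hx0), ← pow_add]
          congr 1
          omega
        rw [this]
        exact Subring.neg_mem _ (Subring.sum_mem _ fun i _ =>
          Subring.mul_mem _ (hV (f.coeff i).2) (Subring.pow_mem _ hxV _))
      refine ⟨fun hk1 => ?_, ?_⟩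
      · have := h3 (k - 1) (by omega) (by omega)
        rwa [show k - (k - 1) = 1 by omega, pow_one] at this
      · simpa using h3 k le_rfl (by omega)
    refine ⟨key _ fun V hV => ?_, fun hk1 => key _ fun V hV => ?_⟩
    · rcases V.mem_or_inv_mem x with h | h
      · exact h1 V hV h
      · exact (h2 V hV h).2
    · rcases V.mem_or_inv_mem x with h | h
      · exact Subring.mul_mem _ (h1 V hV h) h
      · exact (h2 V hV h).1 hk1
  have h1 := (hmem (j + 1) (by omega)).1
  have h2 := (hmem (j + 1) (by omega)).2 (by omega)
  have h3 := (hmem j (by omega)).1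
  have hyx : y j * x ∈ R := by
    rcases Nat.eq_zero_or_pos j with rfl | hj0
    · have h0 : y 0 = 0 := by simpa using hlow 0 (by omega)
      rw [h0, zero_mul]
      exact R.zero_mem
    · exact (hmem j (by omega)).2 hj0
  have hinv : ∀ u : R, IsUnit u → (u : L)⁻¹ ∈ R := by
    rintro _ ⟨u, rfl⟩
    have : ((u : R) : L) * ((u⁻¹ : Rˣ) : R) = 1 := by exact_mod_cast congrArg Subtype.val u.mul_inv
    rw [inv_eq_of_mul_eq_one_right this]
    exact Subtype.mem _
  have hadd : IsUnit ((⟨y j, h3⟩ : R) + (- ⟨y (j + 1) * x, h2⟩)) := by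
    convert hj using 1
    apply Subtype.ext
    change y j + - (y (j + 1) * x) = _
    rw [hrec j]
    ring
  rcases IsLocalRing.isUnit_or_isUnit_of_isUnit_add hadd with hu | hu
  · left
    have h4 := hinv _ hu
    have h5 : x = (y j * x) * (y j)⁻¹ := by
      have : y j ≠ 0 := fun h => hu.ne_zero (Subtype.ext h)
      field_simp
    rw [h5]
    exact R.mul_mem hyx h4
  · right
    rw [IsUnit.neg_iff] at hu
    have h4 := hinv _ hu
    have h5 : x⁻¹ = y (j + 1) * (y (j + 1) * x)⁻¹ := by
      have : y (j + 1) ≠ 0 := fun h => hu.ne_zero (Subtype.ext (by simp [h]))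
      field_simp
    rw [h5]
    exact R.mul_mem h1 h4

/-- The integral closure of a henselian valuation ring in a Galois extension is a valuation
ring. -/
theorem mem_or_inv_mem_integralClosure_of_henselian
    {K L : Type*} [Field K] [Field L] [Algebra K L] [IsGalois K L] (O : ValuationSubring K)
    [HenselianLocalRing O] (x : L) :
    x ∈ integralClosure O L ∨ x⁻¹ ∈ integralClosure O L := by
  classical
  have := isLocalRing_integralClosure_of_henselian_of_isGalois O K L
  let R : Subring L := (integralClosure O L).toSubring
  have : IsLocalRing R := this
  have : IsIntegrallyClosedIn R L :=
    inferInstanceAs (IsIntegrallyClosedIn (integralClosure O L) L)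
  have hint : IsIntegral K x := Algebra.IsIntegral.isIntegral x
  let f := minpoly K x
  obtain ⟨j, hj, hmax⟩ := Finset.exists_max_image f.support (fun i => O.valuation (f.coeff i))
    (nonempty_support_iff.2 (minpoly.ne_zero hint))
  have hj0 : f.coeff j ≠ 0 := mem_support_iff.1 hj
  have hO : ∀ i, f.coeff i / f.coeff j ∈ O := by
    intro i
    by_cases hi : i ∈ f.support
    · rw [← O.valuation_le_one_iff, map_div₀]
      exact div_le_one_of_le₀ (hmax i hi) zero_le
    · rw [notMem_support_iff.1 hi, zero_div]
      exact O.zero_mem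
  let c : ℕ → R := fun i =>
    ⟨algebraMap K L (f.coeff i / f.coeff j),
      (isIntegral_algebraMap (A := L) (x := (⟨_, hO i⟩ : O)) : IsIntegral O _)⟩
  let g : R[X] := ∑ i ∈ Finset.range (f.natDegree + 1), C (c i) * X ^ i
  have hcoeff : g.coeff j = 1 := by
    have : j < f.natDegree + 1 := Nat.lt_succ_of_le (le_natDegree_of_ne_zero hj0)
    simp only [g, finsetSum_coeff, coeff_C_mul, coeff_X_pow]
    rw [Finset.sum_eq_single j (fun i _ hij => by rw [if_neg hij.symm, mul_zero])
      (fun h => absurd (Finset.mem_range.2 this) h), if_pos rfl, mul_one]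
    apply Subtype.ext
    change algebraMap K L (f.coeff j / f.coeff j) = 1
    rw [div_self hj0, map_one]
  have hg : g.aeval x = 0 := by
    simp only [g, map_sum, map_mul, aeval_C, map_pow, aeval_X]
    have h1 : f.aeval x = 0 := minpoly.aeval K x
    rw [aeval_eq_sum_range] at h1
    have h2 : ∀ i, algebraMap R L (c i) * x ^ i =
        (algebraMap K L (f.coeff j))⁻¹ * (f.coeff i • x ^ i) := by
      intro i
      change algebraMap K L (f.coeff i / f.coeff j) * x ^ i = _
      rw [Algebra.smul_def, map_div₀]
      ring
    simp_rw [h2, ← Finset.mul_sum, h1, mul_zero]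
  exact Subring.mem_or_inv_mem_of_coeff_isUnit g hg (hcoeff ▸ isUnit_one)

end HenselianClosure

/-! ### The extended valuation, roots of unity and Frobenius -/

section ExtendedValuation

open Polynomial IsLocalRing

variable {K L : Type*} [Field K] [Field L] [Algebra K L] [IsGalois K L] (O : ValuationSubring K)
  [HenselianLocalRing O]

/-- The valuation ring of a Galois extension `L` of `K` lying over a henselian valuation ring `O`
of `K`, namely the integral closure of `O`. -/
def henselianExtension (L : Type*) [Field L] [Algebra K L] [IsGalois K L] : ValuationSubring L where
  toSubring := (integralClosure O L).toSubring
  mem_or_inv_mem' := mem_or_inv_mem_integralClosure_of_henselian O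

theorem mem_henselianExtension {x : L} : x ∈ henselianExtension O L ↔ IsIntegral O x := Iff.rfl

theorem map_mem_henselianExtension (g : L ≃ₐ[K] L) {x : L} (hx : x ∈ henselianExtension O L) :
    g x ∈ henselianExtension O L := by
  rw [mem_henselianExtension] at hx ⊢
  exact hx.map (g.toAlgHom.restrictScalars O)

theorem algebraMap_mem_henselianExtension {x : K} :
    algebraMap K L x ∈ henselianExtension O L ↔ x ∈ O := by
  rw [mem_henselianExtension, isIntegral_algebraMap_iff (FaithfulSMul.algebraMap_injective K L)]
  constructor
  · intro h
    obtain ⟨y, hy⟩ := IsIntegrallyClosed.isIntegral_iff.1 h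
    rw [← hy]
    exact y.2
  · intro h
    exact (isIntegral_algebraMap (x := (⟨x, h⟩ : O)) : IsIntegral O (algebraMap O K ⟨x, h⟩))

theorem henselianExtension_valuation_algebraMap_le {x y : K} :
    (henselianExtension O L).valuation (algebraMap K L x) ≤
      (henselianExtension O L).valuation (algebraMap K L y) ↔ O.valuation x ≤ O.valuation y := by
  rcases eq_or_ne y 0 with rfl | hy
  · simp
  · have hy' : (algebraMap K L y) ≠ 0 := by simpa using hy
    have h1 := algebraMap_mem_henselianExtension (L := L) O (x := x / y)
    rw [← ValuationSubring.valuation_le_one_iff, ← ValuationSubring.valuation_le_one_iff, map_div₀,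
      map_div₀, map_div₀] at h1
    rwa [div_le_one₀ (by simpa [zero_lt_iff] using hy), div_le_one₀ (by simpa [zero_lt_iff] using
      hy)] at h1

theorem henselianExtension_valuation_algebraMap_eq {x y : K} :
    (henselianExtension O L).valuation (algebraMap K L x) =
      (henselianExtension O L).valuation (algebraMap K L y) ↔ O.valuation x = O.valuation y := by
  rw [le_antisymm_iff, le_antisymm_iff, henselianExtension_valuation_algebraMap_le,
    henselianExtension_valuation_algebraMap_le]

theorem henselianExtension_valuation_map_le (g : L ≃ₐ[K] L) {x y : L}
    (h : (henselianExtension O L).valuation x ≤ (henselianExtension O L).valuation y) :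
    (henselianExtension O L).valuation (g x) ≤ (henselianExtension O L).valuation (g y) := by
  rcases eq_or_ne y 0 with rfl | hy
  · have : x = 0 := by simpa using h
    simp [this]
  · have h1 : x / y ∈ henselianExtension O L := by
      rw [← ValuationSubring.valuation_le_one_iff, map_div₀]
      exact div_le_one_of_le₀ h zero_le
    have h2 := map_mem_henselianExtension O g h1
    rw [← ValuationSubring.valuation_le_one_iff, map_div₀, map_div₀, div_le_one₀] at h2
    · exact h2
    · simpa [zero_lt_iff] using hy

/-- The extended valuation is invariant under the Galois group. -/
theorem henselianExtension_valuation_map (g : L ≃ₐ[K] L) (x : L) :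
    (henselianExtension O L).valuation (g x) = (henselianExtension O L).valuation x := by
  have key : ∀ (g : L ≃ₐ[K] L) (x : L),
      (henselianExtension O L).valuation (g x) ≤ (henselianExtension O L).valuation x := by
    intro g x
    by_contra! hlt
    have hstep : ∀ j : ℕ, (henselianExtension O L).valuation x <
        (henselianExtension O L).valuation ((g ^ (j + 1)) x) := by
      intro j
      induction j with
      | zero => simpa using hlt
      | succ j ih =>
        refine hlt.trans_le ?_
        rw [pow_succ' g (j + 1)]
        exact henselianExtension_valuation_map_le O g ih.le
    obtain ⟨j, hj0, hj⟩ : ∃ j, 0 < j ∧ (g ^ j) x = x := by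
      have hfin : (MulAction.stabilizer (L ≃ₐ[K] L) x).index ≠ 0 :=
        have := (MulAction.stabilizer (L ≃ₐ[K] L) x).quotient_finite_of_isOpen
          (stabilizer_isOpen_of_isIntegral x)
        (Subgroup.finiteIndex_of_finite_quotient (H := MulAction.stabilizer _ x)).index_ne_zero
      obtain ⟨j, hj, -, hm⟩ := Subgroup.exists_pow_mem_of_index_ne_zero hfin g
      exact ⟨j, hj, hm⟩
    have h1 := hstep (j - 1)
    rw [Nat.sub_add_cancel hj0, hj] at h1
    exact lt_irrefl _ h1
  refine le_antisymm (key g x) ?_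
  simpa using key g⁻¹ (g x)

/-- The value group of the extended valuation is torsion over that of `O`. -/
theorem exists_henselianExtension_valuation_pow_eq {y : L} (hy : y ≠ 0) :
    ∃ j : ℕ, 0 < j ∧ ∃ x : K, x ≠ 0 ∧ (henselianExtension O L).valuation (y ^ j) =
      (henselianExtension O L).valuation (algebraMap K L x) := by
  have hint : IsIntegral K y := Algebra.IsIntegral.isIntegral y
  refine ⟨(minpoly K y).natDegree, minpoly.natDegree_pos hint, (minpoly K y).coeff 0,
    minpoly.coeff_zero_ne_zero hint hy, ?_⟩
  have hs := Normal.splits (F := K) (K := L) inferInstance y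
  have hm : ((minpoly K y).map (algebraMap K L)).Monic := (minpoly.monic hint).map _
  have h1 := hs.coeff_zero_eq_prod_roots_of_monic hm
  rw [coeff_map] at h1
  rw [h1, map_mul, map_pow, map_pow, Valuation.map_neg, map_one, one_pow, one_mul,
    map_multiset_prod]
  have hdeg : Multiset.card ((minpoly K y).map (algebraMap K L)).roots = (minpoly K y).natDegree :=
      by
    rw [← hs.natDegree_eq_card_roots, natDegree_map]
  rw [Multiset.eq_replicate.2 ⟨(Multiset.card_map _ _).trans hdeg, ?_⟩, Multiset.prod_replicate]
  intro r hr
  obtain ⟨z, hz, rfl⟩ := Multiset.mem_map.1 hr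
  have hz' : IsConjRoot K y z := by
    rw [isConjRoot_iff_aeval_eq_zero hint]
    rw [mem_roots hm.ne_zero, IsRoot.def, eval_map_algebraMap] at hz
    exact hz
  obtain ⟨g, hg⟩ := isConjRoot_iff_exists_algEquiv.1 hz'
  rw [← henselianExtension_valuation_map O g z, hg]

theorem henselianExtension_valuation_natCast {M : ℕ} (hM : (M : ResidueField O) ≠ 0) :
    (henselianExtension O L).valuation (M : L) = 1 := by
  have h1 : (henselianExtension O L).valuation (algebraMap K L (M : K)) =
      (henselianExtension O L).valuation (algebraMap K L 1) := by
    rw [henselianExtension_valuation_algebraMap_eq, map_one]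
    have h2 : IsUnit (M : O) := by
      rw [← IsLocalRing.residue_ne_zero_iff_isUnit, map_natCast]
      exact hM
    have h3 := (O.valuation_eq_one_iff (M : O)).1 h2
    simpa using h3
  simpa using h1

/-- Roots of unity of order prime to the residue characteristic are determined by their
reductions. -/
theorem eq_one_of_henselianExtension_valuation_lt {M : ℕ} (hM : (M : ResidueField O) ≠ 0) {x : L}
    (hx : x ^ M = 1) (hlt : (henselianExtension O L).valuation (x - 1) < 1) : x = 1 := by
  by_contra hne
  have h1 : ∑ i ∈ Finset.range M, x ^ i = 0 := by
    have := geom_sum_mul x M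
    rw [hx, sub_self] at this
    exact (mul_eq_zero.1 this).resolve_right (sub_ne_zero.2 hne)
  have hxV : x ∈ henselianExtension O L := by
    have := (henselianExtension O L).add_mem _ _
      ((ValuationSubring.valuation_le_one_iff _ _).1 hlt.le) (henselianExtension O L).one_mem
    simpa using this
  have h2 : ∀ i : ℕ, (henselianExtension O L).valuation (x ^ i - 1) < 1 := by
    intro i
    rw [← mul_geom_sum, map_mul]
    refine mul_lt_one_of_lt_of_le hlt ?_
    rw [ValuationSubring.valuation_le_one_iff]
    exact Subring.sum_mem (henselianExtension O L).toSubring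
      fun j _ => Subring.pow_mem (henselianExtension O L).toSubring hxV j
  have h3 : (henselianExtension O L).valuation (∑ i ∈ Finset.range M, (x ^ i - 1)) < 1 :=
    Valuation.map_sum_lt _ one_ne_zero fun i _ => h2 i
  rw [Finset.sum_sub_distrib, h1, Finset.sum_const, Finset.card_range, nsmul_one, zero_sub,
    Valuation.map_neg, henselianExtension_valuation_natCast O hM] at h3
  exact lt_irrefl _ h3

theorem eq_of_henselianExtension_valuation_sub_lt {M : ℕ} (hM : (M : ResidueField O) ≠ 0) {x y : L}
    (hx : x ^ M = 1) (hy : y ^ M = 1)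
    (hlt : (henselianExtension O L).valuation (x - y) < 1) : x = y := by
  have hM0 : M ≠ 0 := by rintro rfl; simp at hM
  have hy0 : y ≠ 0 := by rintro rfl; simp [hM0] at hy
  have hvy : (henselianExtension O L).valuation y = 1 := by
    have : (henselianExtension O L).valuation y ^ M = 1 := by rw [← map_pow, hy, map_one]
    exact (pow_eq_one_iff.1 this).resolve_right hM0
  rw [← div_eq_one_iff_eq hy0]
  refine eq_one_of_henselianExtension_valuation_lt O hM (by rw [div_pow, hx, hy, div_one]) ?_
  rw [div_sub_one hy0, map_div₀, hvy, div_one]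
  exact hlt

/-- If `x ^ M` is congruent to `1` and `L` contains enough roots of unity, then `x` is congruent
to an `M`-th root of unity. -/
theorem exists_rootOfUnity_valuation_sub_lt {M : ℕ} (hM : 0 < M) {ω : L}
    (hω : IsPrimitiveRoot ω M) {x : L}
    (hlt : (henselianExtension O L).valuation (x ^ M - 1) < 1) :
    ∃ y : L, y ^ M = 1 ∧ (henselianExtension O L).valuation (x - y) < 1 := by
  have h1 : x ^ M - 1 = ∏ y ∈ nthRootsFinset M (1 : L), (x - y) := by
    have := congrArg (Polynomial.eval x) (X_pow_sub_one_eq_prod hM hω)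
    simpa [eval_prod] using this
  by_contra! hcon
  rw [h1, map_prod] at hlt
  refine absurd hlt (not_lt.2 (Finset.one_le_prod' fun y hy => hcon y ?_))
  exact (mem_nthRootsFinset hM _).1 hy

/-- The inclusion of `O` into the valuation ring of `L`. -/
def toHenselianExtension (L : Type*) [Field L] [Algebra K L] [IsGalois K L] :
    O →+* henselianExtension O L where
  toFun x := ⟨algebraMap K L x, (algebraMap_mem_henselianExtension O).2 x.2⟩
  map_one' := Subtype.ext (map_one _)
  map_zero' := Subtype.ext (map_zero _)
  map_mul' _ _ := Subtype.ext (map_mul _ _ _)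
  map_add' _ _ := Subtype.ext (map_add _ _ _)

instance : IsLocalHom (toHenselianExtension O L) where
  map_nonunit x hx := by
    rw [ValuationSubring.valuation_eq_one_iff] at hx ⊢
    have h1 : (henselianExtension O L).valuation (algebraMap K L x) =
      (henselianExtension O L).valuation (algebraMap K L 1) := by rw [map_one, map_one]; exact hx
    rw [henselianExtension_valuation_algebraMap_eq, map_one] at h1
    exact h1

instance : Algebra (ResidueField O) (ResidueField (henselianExtension O L)) :=
  (ResidueField.map (toHenselianExtension O L)).toAlgebra

theorem residue_henselianExtension_isIntegral (x : henselianExtension O L) :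
    IsIntegral (ResidueField O) (residue (henselianExtension O L) x) := by
  obtain ⟨f, hf, hfx⟩ := (mem_henselianExtension O).1 x.2
  refine ⟨f.map (residue O), hf.map _, ?_⟩
  have h1 : f.eval₂ (toHenselianExtension O L) x = 0 := by
    apply Subtype.ext
    rw [← ValuationSubring.subtype_apply, hom_eval₂]
    exact hfx
  rw [eval₂_map]
  have h2 : (algebraMap (ResidueField O) (ResidueField (henselianExtension O L))).comp (residue O) =
      (residue (henselianExtension O L)).comp (toHenselianExtension O L) := RingHom.ext fun y =>
    ResidueField.map_residue _ _
  rw [h2, ← hom_eval₂, h1, map_zero]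

theorem residue_eq_iff_valuation_sub_lt (x y : henselianExtension O L) :
    residue (henselianExtension O L) x = residue (henselianExtension O L) y ↔
      (henselianExtension O L).valuation ((x : L) - y) < 1 := by
  rw [← sub_eq_zero, ← map_sub, residue_eq_zero_iff, ValuationSubring.valuation_lt_one_iff]
  rfl

variable [Finite (ResidueField O)]

/-- Units are congruent to roots of unity of order prime to the residue characteristic. -/
theorem exists_valuation_pow_sub_one_lt {x : L} (hx : (henselianExtension O L).valuation x = 1) :
    ∃ S : ℕ, 0 < S ∧
      (henselianExtension O L).valuation (x ^ (Nat.card (ResidueField O) ^ S - 1) - 1) < 1 := by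
  let y : henselianExtension O L := ⟨x, (ValuationSubring.valuation_le_one_iff _ _).1 hx.le⟩
  have hint := residue_henselianExtension_isIntegral O y
  let k := ResidueField O
  let E := IntermediateField.adjoin k {residue _ y}
  have : FiniteDimensional k E := IntermediateField.adjoin.finiteDimensional hint
  have : Finite E := Module.finite_of_finite k
  have := Fintype.ofFinite E
  let e : E := ⟨residue _ y, IntermediateField.mem_adjoin_simple_self k _⟩
  have he0 : e ≠ 0 := by
    intro h
    have h1 : residue (henselianExtension O L) y = 0 := congrArg Subtype.val h
    rw [residue_eq_zero_iff, ValuationSubring.valuation_lt_one_iff] at h1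
    exact absurd hx h1.ne
  have h1 := FiniteField.pow_card_sub_one_eq_one e he0
  rw [← Nat.card_eq_fintype_card, Module.natCard_eq_pow_finrank (K := k)] at h1
  refine ⟨Module.finrank k E, Module.finrank_pos, ?_⟩
  have h2 := congrArg Subtype.val h1
  change (residue _ y) ^ (Nat.card k ^ Module.finrank k E - 1) = 1 at h2
  rw [← map_pow, ← map_one (residue _), residue_eq_iff_valuation_sub_lt] at h2
  exact h2

/-- The endomorphism of the valuation ring of `L` induced by an automorphism of `L`. -/
def henselianExtensionMap (g : L ≃ₐ[K] L) : henselianExtension O L →+* henselianExtension O L where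
  toFun x := ⟨g x, map_mem_henselianExtension O g x.2⟩
  map_one' := Subtype.ext (map_one _)
  map_zero' := Subtype.ext (map_zero _)
  map_mul' _ _ := Subtype.ext (map_mul _ _ _)
  map_add' _ _ := Subtype.ext (map_add _ _ _)

instance (g : L ≃ₐ[K] L) : IsLocalHom (henselianExtensionMap O g) where
  map_nonunit x hx := by
    rw [ValuationSubring.valuation_eq_one_iff] at hx ⊢
    rw [← hx]
    exact (henselianExtension_valuation_map O g x).symm

/-- The endomorphism of the residue field of `L` induced by an automorphism of `L`. -/
def residueAlgHom (g : L ≃ₐ[K] L) :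
    ResidueField (henselianExtension O L) →ₐ[ResidueField O]
      ResidueField (henselianExtension O L) where
  toRingHom := ResidueField.map (henselianExtensionMap O g)
  commutes' r := by
    obtain ⟨r, rfl⟩ := residue_surjective r
    change ResidueField.map _ (ResidueField.map (toHenselianExtension O L) (residue O r)) =
      ResidueField.map (toHenselianExtension O L) (residue O r)
    rw [ResidueField.map_residue, ResidueField.map_residue]
    congr 1
    exact Subtype.ext (g.commutes _)

/-- Every automorphism acts on a root of unity of order prime to the residue characteristic
through a power of the Frobenius. -/
theorem exists_map_rootOfUnity_eq_pow {S : ℕ} (hS : 0 < S) (g : L ≃ₐ[K] L) {x : L}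
    (hx : x ^ (Nat.card (ResidueField O) ^ S - 1) = 1) :
    ∃ j : ℕ, g x = x ^ Nat.card (ResidueField O) ^ j := by
  set q := Nat.card (ResidueField O) with hq
  have hq1 : 1 < q := Finite.one_lt_card
  have hM : ((q ^ S - 1 : ℕ) : ResidueField O) ≠ 0 := by
    have := Fintype.ofFinite (ResidueField O)
    rw [Nat.cast_sub (Nat.one_le_pow _ _ (by omega)), Nat.cast_pow, hq, Nat.card_eq_fintype_card,
      FiniteField.cast_card_eq_zero, zero_pow hS.ne']
    simp
  have hM0 : q ^ S - 1 ≠ 0 := by intro h; simp [h] at hM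
  have hvx : (henselianExtension O L).valuation x = 1 := by
    have : (henselianExtension O L).valuation x ^ (q ^ S - 1) = 1 := by
      rw [← map_pow, hx, map_one]
    exact (pow_eq_one_iff.1 this).resolve_right hM0
  let y : henselianExtension O L := ⟨x, (ValuationSubring.valuation_le_one_iff _ _).1 hvx.le⟩
  have hint := residue_henselianExtension_isIntegral O y
  let k := ResidueField O
  have := Fintype.ofFinite k
  let E := IntermediateField.adjoin k {residue _ y}
  have : FiniteDimensional k E := IntermediateField.adjoin.finiteDimensional hint
  have : Finite E := Module.finite_of_finite k
  let e : E := ⟨residue _ y, IntermediateField.mem_adjoin_simple_self k _⟩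
  obtain ⟨j, hj⟩ := (FiniteField.bijective_frobeniusAlgHom_pow k E).2
    ((residueAlgHom O g).restrictNormal E)
  refine ⟨j, eq_of_henselianExtension_valuation_sub_lt O hM (by rw [← map_pow, hx, map_one])
    (by rw [← pow_mul, mul_comm, pow_mul, hx, one_pow]) ?_⟩
  have h1 := AlgHom.restrictNormal_commutes (residueAlgHom O g) E e
  rw [← hj] at h1
  simp only [AlgHom.coe_pow, FiniteField.coe_frobeniusAlgHom, pow_iterate] at h1
  have h2 : residue _ y ^ (Fintype.card k ^ (j : ℕ)) = residueAlgHom O g (residue _ y) := h1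
  rw [← Nat.card_eq_fintype_card, ← map_pow] at h2
  have h3 : residueAlgHom O g (residue _ y) = residue _ ⟨g x, map_mem_henselianExtension O g y.2⟩ :=
    ResidueField.map_residue _ _
  rw [h3] at h2
  exact (residue_eq_iff_valuation_sub_lt O _ _).1 h2.symm

/-- A root of unity of order prime to the residue characteristic is conjugate to its image under
the Frobenius. -/
theorem exists_map_rootOfUnity_eq_frobenius {S : ℕ} (hS : 0 < S) {x : L}
    (hx : x ^ (Nat.card (ResidueField O) ^ S - 1) = 1) :
    ∃ g : L ≃ₐ[K] L, g x = x ^ Nat.card (ResidueField O) := by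
  set q := Nat.card (ResidueField O) with hq
  have hq1 : 1 < q := Finite.one_lt_card
  have := Fintype.ofFinite (ResidueField O)
  have hM : ((q ^ S - 1 : ℕ) : ResidueField O) ≠ 0 := by
    rw [Nat.cast_sub (Nat.one_le_pow _ _ (by omega)), Nat.cast_pow, hq, Nat.card_eq_fintype_card,
      FiniteField.cast_card_eq_zero, zero_pow hS.ne']
    simp
  have hM0 : q ^ S - 1 ≠ 0 := by intro h; simp [h] at hM
  have hint : IsIntegral O x := ⟨X ^ (q ^ S - 1) - 1, monic_X_pow_sub_C 1 hM0 , by simp [hx]⟩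
  let y : henselianExtension O L := ⟨x, hint⟩
  have hintK : IsIntegral K x := Algebra.IsIntegral.isIntegral x
  let f := minpoly O x
  have hfK : minpoly K x = f.map (algebraMap O K) :=
    minpoly.isIntegrallyClosed_eq_field_fractions K L hint
  -- the reduction of `f` vanishes at the `q`-th power of the reduction of `x`
  have h1 : f.eval₂ (toHenselianExtension O L) y = 0 := by
    apply Subtype.ext
    rw [← ValuationSubring.subtype_apply, hom_eval₂]
    exact minpoly.aeval O x
  have h2 : (algebraMap (ResidueField O) (ResidueField (henselianExtension O L))).comp (residue O) =
      (residue (henselianExtension O L)).comp (toHenselianExtension O L) := RingHom.ext fun y =>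
    ResidueField.map_residue _ _
  have h3 : residue _ (f.eval₂ (toHenselianExtension O L) (y ^ q)) = 0 := by
    rw [hom_eval₂, ← h2, ← eval₂_map, map_pow, ← aeval_def, ← expand_aeval, hq,
      Nat.card_eq_fintype_card, FiniteField.expand_card, map_pow, aeval_def, eval₂_map, h2,
      ← hom_eval₂, h1, map_zero, zero_pow Fintype.card_ne_zero]
  have h4 : (henselianExtension O L).valuation (aeval (x ^ q) (minpoly K x)) < 1 := by
    rw [← map_zero (residue _), residue_eq_iff_valuation_sub_lt] at h3
    have h5 : ((f.eval₂ (toHenselianExtension O L) (y ^ q) : henselianExtension O L) : L) =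
        aeval (x ^ q) (minpoly K x) := by
      rw [← ValuationSubring.subtype_apply, hom_eval₂, hfK, aeval_map_algebraMap]
      rfl
    rwa [h5, ZeroMemClass.coe_zero, sub_zero] at h3
  have hs := Normal.splits (F := K) (K := L) inferInstance x
  have hm : ((minpoly K x).map (algebraMap K L)).Monic := (minpoly.monic hintK).map _
  rw [← eval_map_algebraMap, hs.eval_eq_prod_roots_of_monic hm, map_multiset_prod,
    Multiset.map_map] at h4
  obtain ⟨z, hz, hlt⟩ : ∃ z ∈ ((minpoly K x).map (algebraMap K L)).roots,
      (henselianExtension O L).valuation (x ^ q - z) < 1 := by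
    by_contra! hcon
    refine absurd h4 (not_lt.2 (Multiset.one_le_prod fun r hr => ?_))
    obtain ⟨z, hz, rfl⟩ := Multiset.mem_map.1 hr
    exact hcon z hz
  have hz' : IsConjRoot K x z := by
    rw [isConjRoot_iff_aeval_eq_zero hintK]
    rw [mem_roots hm.ne_zero, IsRoot.def, eval_map_algebraMap] at hz
    exact hz
  obtain ⟨g, hg⟩ := isConjRoot_iff_exists_algEquiv.1 hz'
  refine ⟨g⁻¹, ?_⟩
  have hgx : g⁻¹ x = z := (congrArg (⇑g⁻¹) hg.symm).trans (g.symm_apply_apply z)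
  rw [hgx]
  refine (eq_of_henselianExtension_valuation_sub_lt O hM ?_ ?_ hlt).symm
  · rw [← pow_mul, mul_comm, pow_mul, hx, one_pow]
  · rw [← hgx, ← map_pow, hx, map_one]

end ExtendedValuation

/-! ### The tame arithmetic of the separable closure -/

section Frame

/-- The arithmetic of the absolute Galois group and the multiplicative group of the separable
closure of a henselian field with residue field of cardinality `q` and value group `ℤ ^ d`, as far
as it concerns a prime `ℓ` not dividing `q`: the inertia group, a Frobenius element, and elements
of the field whose values form a basis of the value group. -/
structure TameFrame (F : Type*) [Field F] (ℓ q d : ℕ) where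
  /-- The inertia group. -/
  inertia : Subgroup (GalSep F)
  /-- A lift of the Frobenius automorphism. -/
  frob : GalSep F
  /-- Elements whose values form a basis of the value group. -/
  unif : Fin d → SepUnits F
  prime : ℓ.Prime
  one_lt : 1 < q
  coprime : q.Coprime ℓ
  /-- Inertia consists of the elements acting trivially on the roots of unity of order prime to `q`,
  that is, of order dividing some `q ^ S - 1`. -/
  mem_inertia : ∀ g, g ∈ inertia ↔ ∀ S, 0 < S → ∀ ω : SepUnits F, ω ^ (q ^ S - 1) = 1 → g • ω = ω
  frob_smul : ∀ S, 0 < S → ∀ ω : SepUnits F, ω ^ (q ^ S - 1) = 1 → frob • ω = ω ^ q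
  /-- Automorphisms act on the roots of unity of order `q ^ S - 1` like powers of Frobenius. -/
  exists_pow : ∀ S, 0 < S → ∀ g : GalSep F,
    ∃ j : ℕ, ∀ ω : SepUnits F, ω ^ (q ^ S - 1) = 1 → g • ω = ω ^ q ^ j
  exists_primitive : ∀ S, 0 < S → ∃ ω : SepUnits F, orderOf ω = q ^ S - 1
  /-- The multiplicative group of the separable closure is divisible by integers prime to `q`. -/
  exists_root : ∀ S, 0 < S → ∀ M, M ∣ q ^ S - 1 → ∀ x : SepUnits F, ∃ y, y ^ M = x
  unif_fixed : ∀ i (g : GalSep F), g • unif i = unif i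
  /-- An element of the field is, modulo `ℓ ^ t`-th powers, the product of a root of unity of order
  dividing `q - 1` and a monomial in the elements `unif i`. -/
  decomposition : ∀ α : SepUnits F, (∀ g : GalSep F, g • α = α) → ∀ t : ℕ,
    ∃ (ω u : SepUnits F) (e : Fin d → ℤ), ω ^ (q - 1) = 1 ∧ (∀ g : GalSep F, g • u = u) ∧
      α = ω * u ^ (ℓ ^ t) * ∏ i, unif i ^ e i
  /-- The values of the elements `unif i` are independent modulo every `M`. -/
  unif_indep : ∀ y : SepUnits F, (∀ g : GalSep F, g • y = y) → ∀ (M : ℕ) (ε : SepUnits F)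
    (K : ℕ), K ≠ 0 → ε ^ K = 1 → ∀ c : Fin d → ℤ, y ^ M = ε * ∏ i, unif i ^ c i →
      ∀ i, (M : ℤ) ∣ c i
  /-- An element of inertia fixing all roots of `ℓ`-power order of the elements `unif i` fixes `y`
  as soon as it moves `y` by a root of unity of `ℓ`-power order. -/
  rigid : ∀ h ∈ inertia,
    (∀ (i : Fin d) (t : ℕ) (ρ : SepUnits F), ρ ^ ℓ ^ t = unif i → h • ρ = ρ) →
    ∀ (y : SepUnits F) (s : ℕ), (h • y / y) ^ ℓ ^ s = 1 → h • y = y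

theorem Nat.pow_sub_one_dvd_pow_sub_one_of_dvd (q : ℕ) {S T : ℕ} (h : S ∣ T) :
    q ^ S - 1 ∣ q ^ T - 1 := by
  obtain ⟨k, rfl⟩ := h
  simpa [pow_mul] using Nat.sub_dvd_pow_sub_pow (q ^ S) 1 k

theorem exists_dvd_pow_sub_one {q M : ℕ} (hM : 0 < M) (h : q.Coprime M) :
    ∃ S, 0 < S ∧ M ∣ q ^ S - 1 := by
  refine ⟨M.totient, Nat.totient_pos.2 hM, ?_⟩
  rcases Nat.eq_zero_or_pos q with rfl | hq
  · have : M = 1 := by simpa using h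
    simp [this]
  · exact (Nat.modEq_iff_dvd' (Nat.one_le_pow _ _ hq)).1 (Nat.ModEq.pow_totient h).symm

end Frame

section SepUnits

variable {F : Type*} [Field F]

/-- The inclusion of the multiplicative group of `F` into that of its separable closure. -/
def SepUnits.ofField (F : Type*) [Field F] : Fˣ →* SepUnits F :=
  (Units.map (algebraMap F (SeparableClosure F)).toMonoidHom : Fˣ →* (SeparableClosure F)ˣ)

theorem SepUnits.val_ofField (x : Fˣ) :
    Units.val (SepUnits.ofField F x) = algebraMap F (SeparableClosure F) x := rfl

theorem SepUnits.exists_of_fixed {y : SepUnits F} (hy : ∀ g : GalSep F, g • y = y) :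
    ∃ x : Fˣ, y = SepUnits.ofField F x := by
  have h1 : (Units.val y : SeparableClosure F) ∈
      (⊥ : IntermediateField F (SeparableClosure F)) := by
    rw [← InfiniteGalois.fixedField_bot, IntermediateField.mem_fixedField_iff]
    intro g _
    exact congrArg Units.val (hy g)
  obtain ⟨x, hx⟩ := IntermediateField.mem_bot.1 h1
  have hx0 : x ≠ 0 := by
    rintro rfl
    rw [map_zero] at hx
    exact Units.ne_zero (show (SeparableClosure F)ˣ from y) hx.symm
  exact ⟨Units.mk0 x hx0, Units.ext hx.symm⟩

theorem SepUnits.smul_ofField (g : GalSep F) (x : Fˣ) :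
    g • SepUnits.ofField F x = SepUnits.ofField F x :=
  Units.ext (g.commutes _)

theorem SepUnits.mem_zpowers {x y : SepUnits F} (hx : 0 < orderOf x) (hy : y ^ orderOf x = 1) :
    y ∈ Subgroup.zpowers x := by
  have h1 : IsPrimitiveRoot (show (SeparableClosure F)ˣ from x) (orderOf x) :=
    IsPrimitiveRoot.orderOf x
  have : NeZero (orderOf x) := ⟨hx.ne'⟩
  have h2 := h1.zpowers_eq
  have h3 : (show (SeparableClosure F)ˣ from y) ∈ rootsOfUnity (orderOf x) (SeparableClosure F) :=
      by
    rw [mem_rootsOfUnity]; exact hy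
  rw [← h2] at h3
  exact h3

end SepUnits

section Construction

open IsLocalRing

variable {F : Type*} [Field F] {Γ₀ : Type*} [LinearOrderedCommGroupWithZero Γ₀]
  (v : Valuation F Γ₀)

/-- A valuation with value group isomorphic to `ℤ ^ d` as a homomorphism to `ℤ ^ d`. -/
theorem exists_valuation_hom {d : ℕ} (hΓ : Nonempty
      (Additive (MonoidWithZeroHom.valueGroup (MonoidWithZeroHom.ofClass v)) ≃+ (Fin d → ℤ))) :
    ∃ ν : Fˣ →* Multiplicative (Fin d → ℤ), Function.Surjective ν ∧
      ∀ x y, ν x = ν y ↔ v x = v y := by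
  obtain ⟨e⟩ := hΓ
  let f : Fˣ →* MonoidWithZeroHom.valueGroup (MonoidWithZeroHom.ofClass v) :=
    (Units.map v.toMonoidWithZeroHom.toMonoidHom).codRestrict _ fun x =>
      MonoidWithZeroHom.mem_valueGroup _ ⟨x, rfl⟩
  have hf : Function.Surjective f := by
    rintro ⟨b, hb⟩
    have h1 : b.1 ∈ Units.val '' (MonoidWithZeroHom.valueGroup (MonoidWithZeroHom.ofClass v) : Set
        Γ₀ˣ) :=
      ⟨b, hb, rfl⟩
    rw [MonoidWithZeroHom.valueGroup_eq_range] at h1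
    obtain ⟨⟨x, hx⟩, h0⟩ := h1
    have hx0 : x ≠ 0 := by
      rintro rfl
      exact h0 (by rw [← hx]; exact map_zero v)
    exact ⟨Units.mk0 x hx0, Subtype.ext (Units.ext hx)⟩
  let e' : MonoidWithZeroHom.valueGroup (MonoidWithZeroHom.ofClass v) ≃* Multiplicative (Fin d → ℤ)
      :=
    AddEquiv.toMultiplicativeRight e
  refine ⟨e'.toMonoidHom.comp f, e'.surjective.comp hf, fun x y => ?_⟩
  change e' (f x) = e' (f y) ↔ _
  rw [e'.injective.eq_iff, Subtype.ext_iff, Units.ext_iff]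
  rfl

variable [HenselianLocalRing v.valuationSubring]

/-- The extension of the valuation `v` to the separable closure. -/
abbrev sepVal : Valuation (SeparableClosure F)
    (henselianExtension v.valuationSubring (SeparableClosure F)).ValueGroup :=
  (henselianExtension v.valuationSubring (SeparableClosure F)).valuation

omit [HenselianLocalRing v.valuationSubring] in
theorem natCast_residue_ne_zero [Finite (ResidueField v.valuationSubring)] {S M : ℕ} (hS : 0 < S)
    (hM : M ∣ Nat.card (ResidueField v.valuationSubring) ^ S - 1) :
    (M : ResidueField v.valuationSubring) ≠ 0 := by
  have := Fintype.ofFinite (ResidueField v.valuationSubring)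
  have hq1 : 1 < Nat.card (ResidueField v.valuationSubring) := Finite.one_lt_card
  have h1 : ((Nat.card (ResidueField v.valuationSubring) ^ S - 1 : ℕ) :
      ResidueField v.valuationSubring) ≠ 0 := by
    rw [Nat.cast_sub (Nat.one_le_pow _ _ (by omega)), Nat.cast_pow, Nat.card_eq_fintype_card,
      FiniteField.cast_card_eq_zero, zero_pow hS.ne']
    simp
  intro h0
  obtain ⟨c, hc⟩ := hM
  rw [hc, Nat.cast_mul, h0, zero_mul] at h1
  exact h1 rfl

theorem natCast_separableClosure_ne_zero {M : ℕ}
    (hM : (M : ResidueField v.valuationSubring) ≠ 0) : (M : SeparableClosure F) ≠ 0 := by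
  intro h0
  have h1 := henselianExtension_valuation_natCast (L := SeparableClosure F) v.valuationSubring hM
  rw [h0, map_zero] at h1
  exact zero_ne_one h1

theorem exists_primitiveRoot_sepUnits {M : ℕ}
    (hM : (M : ResidueField v.valuationSubring) ≠ 0) : ∃ ω : SepUnits F, orderOf ω = M := by
  have : NeZero (M : SeparableClosure F) := ⟨natCast_separableClosure_ne_zero v hM⟩
  obtain ⟨ω, hω⟩ := (HasEnoughRootsOfUnity.exists_primitiveRoot (SeparableClosure F) M)
  have hM0 : M ≠ 0 := by rintro rfl; simp at hM
  have h2 : IsPrimitiveRoot (hω.isUnit hM0).unit M := hω.isUnit_unit hM0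
  exact ⟨(hω.isUnit hM0).unit, h2.eq_orderOf.symm⟩

theorem exists_root_sepUnits {M : ℕ}
    (hM : (M : ResidueField v.valuationSubring) ≠ 0) (x : SepUnits F) :
    ∃ y : SepUnits F, y ^ M = x := by
  have : NeZero (M : SeparableClosure F) := ⟨natCast_separableClosure_ne_zero v hM⟩
  have hM0 : M ≠ 0 := by rintro rfl; simp at hM
  obtain ⟨z, hz⟩ := IsSepClosed.exists_pow_nat_eq (Units.val x : SeparableClosure F) M
  have hz0 : z ≠ 0 := by
    rintro rfl
    rw [zero_pow hM0] at hz
    exact Units.ne_zero (show (SeparableClosure F)ˣ from x) hz.symm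
  exact ⟨Units.mk0 z hz0, Units.ext hz⟩

/-- Units congruent to `1` are `M`-th powers for `M` prime to the residue characteristic. -/
theorem exists_pow_eq_of_valuation_sub_one_lt {M : ℕ}
    (hM : (M : ResidueField v.valuationSubring) ≠ 0) {x : F} (hx : v (x - 1) < 1) :
    ∃ y : F, y ^ M = x := by
  open Polynomial in
  have hM0 : M ≠ 0 := by rintro rfl; simp at hM
  have hxm : x ∈ v.valuationSubring := by
    have h1 : x - 1 ∈ v.valuationSubring := hx.le
    simpa using add_mem h1 (one_mem _)
  let x' : v.valuationSubring := ⟨x, hxm⟩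
  have hmem : x' - 1 ∈ maximalIdeal v.valuationSubring := by
    rw [ValuationSubring.valuation_lt_one_iff]
    rw [← v.isEquiv_valuation_valuationSubring.lt_one_iff_lt_one]
    exact hx
  obtain ⟨a, ha, -⟩ := HenselianLocalRing.is_henselian (X ^ M - C x' : v.valuationSubring[X])
    (monic_X_pow_sub_C x' hM0) 1 (by
      rw [eval_sub, eval_pow, eval_X, eval_C, one_pow, ← neg_sub]
      exact neg_mem hmem) (by
      rw [derivative_sub, derivative_X_pow, derivative_C, sub_zero, eval_mul, eval_pow, eval_X,
        one_pow, mul_one, map_natCast, eval_natCast, ← IsLocalRing.residue_ne_zero_iff_isUnit,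
        map_natCast]
      exact hM)
  refine ⟨a, ?_⟩
  have h1 : a ^ M - x' = 0 := by simpa using ha.eq_zero
  exact congrArg Subtype.val (sub_eq_zero.1 h1)

theorem sepVal_ofField_eq (x y : Fˣ) :
    sepVal v (Units.val (SepUnits.ofField F x)) = sepVal v (Units.val (SepUnits.ofField F y)) ↔
      v x = v y := by
  rw [SepUnits.val_ofField, SepUnits.val_ofField, henselianExtension_valuation_algebraMap_eq]
  exact (v.isEquiv_valuation_valuationSubring.eq_iff).symm

theorem sepVal_rootOfUnity {M : ℕ} (hM : M ≠ 0) {x : SepUnits F} (hx : x ^ M = 1) :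
    sepVal v (Units.val x) = 1 := by
  have h1 : (Units.val x : SeparableClosure F) ^ M = 1 := congrArg Units.val hx
  have : sepVal v (Units.val x) ^ M = 1 := by rw [← map_pow, h1, map_one]
  exact (pow_eq_one_iff.1 this).resolve_right hM

section Finite

variable [Finite (ResidueField v.valuationSubring)]

/-- There is an automorphism acting as the Frobenius on all roots of unity of order prime to the
residue characteristic. -/
theorem exists_frobenius_sepUnits : ∃ σ : GalSep F, ∀ S, 0 < S → ∀ ω : SepUnits F,
    ω ^ (Nat.card (ResidueField v.valuationSubring) ^ S - 1) = 1 →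
      σ • ω = ω ^ Nat.card (ResidueField v.valuationSubring) := by
  set q := Nat.card (ResidueField v.valuationSubring) with hq
  let A : {S : ℕ // 0 < S} → Set (GalSep F) := fun S =>
    {g | ∀ ω : SepUnits F, ω ^ (q ^ S.1 - 1) = 1 → g • ω = ω ^ q}
  have hclosed : ∀ S, IsClosed (A S) := by
    intro S
    have : A S = ⋂ ω : SepUnits F, ⋂ (_ : ω ^ (q ^ S.1 - 1) = 1), {g | g • ω = ω ^ q} := by
      ext g; simp [A]
    rw [this]
    exact isClosed_iInter fun ω => isClosed_iInter fun _ =>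
      (isLocallyConstant_galSep_smul ω).isClosed_fiber _
  have hne : ∀ S, (A S).Nonempty := by
    intro S
    obtain ⟨ω, hω⟩ := exists_primitiveRoot_sepUnits v (natCast_residue_ne_zero v S.2 dvd_rfl)
    obtain ⟨g, hg⟩ := exists_map_rootOfUnity_eq_frobenius (L := SeparableClosure F)
      v.valuationSubring S.2 (x := Units.val ω) (by
        have := pow_orderOf_eq_one ω
        rw [hω] at this
        exact congrArg Units.val this)
    refine ⟨g, fun ω' hω' => ?_⟩
    have hpos : 0 < orderOf ω := by
      rw [hω]
      change 0 < q ^ S.1 - 1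
      have : 1 < q ^ S.1 := Nat.one_lt_pow S.2.ne' Finite.one_lt_card
      omega
    obtain ⟨j, rfl⟩ := SepUnits.mem_zpowers hpos (by rw [hω]; exact hω')
    have hgω : g • ω = ω ^ q := Units.ext hg
    change g • ω ^ j = (ω ^ j) ^ q
    rw [smul_zpow', hgω, ← zpow_natCast, ← zpow_natCast, ← zpow_mul, ← zpow_mul, mul_comm]
  obtain ⟨σ, -, hσ⟩ := (isCompact_univ (X := GalSep F)).inter_iInter_nonempty A hclosed (by
    intro u
    let T : {S : ℕ // 0 < S} := ⟨∏ S ∈ u, S.1, Finset.prod_pos fun S _ => S.2⟩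
    obtain ⟨g, hg⟩ := hne T
    refine ⟨g, Set.mem_univ _, Set.mem_iInter₂.2 fun S hS ω hω => hg ω ?_⟩
    obtain ⟨c, hc⟩ := Nat.pow_sub_one_dvd_pow_sub_one_of_dvd q
      (Finset.dvd_prod_of_mem (fun S : {S : ℕ // 0 < S} => S.1) hS)
    change ω ^ (q ^ (∏ S ∈ u, S.1) - 1) = 1
    rw [hc, pow_mul, hω, one_pow])
  exact ⟨σ, fun S hS => Set.mem_iInter.1 hσ ⟨S, hS⟩⟩

/-- Elements of inertia fix the residues of all units. -/
theorem sepVal_smul_div_sub_one_lt {h : GalSep F}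
    (hh : ∀ S, 0 < S → ∀ ω : SepUnits F,
      ω ^ (Nat.card (ResidueField v.valuationSubring) ^ S - 1) = 1 → h • ω = ω)
    {u : SepUnits F} (hu : sepVal v (Units.val u) = 1) :
    sepVal v (Units.val (h • u / u) - 1) < 1 := by
  obtain ⟨S, hS, hlt⟩ := exists_valuation_pow_sub_one_lt _ hu
  have hM := natCast_residue_ne_zero v hS dvd_rfl
  obtain ⟨ω, hω⟩ := exists_primitiveRoot_sepUnits v hM
  have hpos : 0 < Nat.card (ResidueField v.valuationSubring) ^ S - 1 := by
    have : 1 < Nat.card (ResidueField v.valuationSubring) ^ S :=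
      Nat.one_lt_pow hS.ne' Finite.one_lt_card
    omega
  have hprim : IsPrimitiveRoot (Units.val ω : SeparableClosure F) _ :=
    IsPrimitiveRoot.coe_units_iff.2 (hω ▸ IsPrimitiveRoot.orderOf (show (SeparableClosure F)ˣ from
      ω))
  obtain ⟨y, hy, hylt⟩ := exists_rootOfUnity_valuation_sub_lt _ hpos hprim hlt
  have hy0 : y ≠ 0 := by
    rintro rfl
    rw [zero_pow hpos.ne'] at hy
    exact zero_ne_one hy
  have hhy : h y = y := congrArg Units.val
    (hh S hS (Units.mk0 y hy0 : (SeparableClosure F)ˣ) (Units.ext hy))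
  have h1 : sepVal v (h (Units.val u - y)) < 1 := by
    rw [henselianExtension_valuation_map]
    exact hylt
  rw [map_sub, hhy] at h1
  have h2 : sepVal v (h (Units.val u) - Units.val u) < 1 := by
    have := Valuation.map_sub_lt _ h1 hylt
    rwa [sub_sub_sub_cancel_right] at this
  have h3 : (Units.val (h • u / u) : SeparableClosure F) = h (Units.val u) / Units.val u :=
    Units.val_div_eq_div_val _ _
  rw [h3, div_sub_one (Units.ne_zero (show (SeparableClosure F)ˣ from u)), map_div₀, hu, div_one]
  exact h2

open Classical in
/-- A henselian field with finite residue field and value group `ℤ ^ d` has a tame frame. -/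
theorem exists_tameFrame {d : ℕ} (hΓ : Nonempty
      (Additive (MonoidWithZeroHom.valueGroup (MonoidWithZeroHom.ofClass v)) ≃+ (Fin d → ℤ)))
    (p : ℕ) [CharP (ResidueField v.valuationSubring) p] {ℓ : ℕ} (hℓ : ℓ.Prime) (hℓp : ℓ ≠ p) :
    Nonempty (TameFrame F ℓ (Nat.card (ResidueField v.valuationSubring)) d) := by
  set q := Nat.card (ResidueField v.valuationSubring) with hq
  have := Fintype.ofFinite (ResidueField v.valuationSubring)
  have hq1 : 1 < q := Finite.one_lt_card
  have hcop : q.Coprime ℓ := by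
    obtain ⟨n, hp, hn⟩ := FiniteField.card (ResidueField v.valuationSubring) p
    rw [hq, Nat.card_eq_fintype_card, hn]
    exact Nat.Coprime.pow_left _ ((Nat.coprime_primes hp hℓ).2 hℓp.symm)
  have hℓ0 : ∀ s : ℕ, ((ℓ ^ s : ℕ) : ResidueField v.valuationSubring) ≠ 0 := by
    intro s
    obtain ⟨S, hS, hdvd⟩ := exists_dvd_pow_sub_one (pow_pos hℓ.pos s) (hcop.pow_right s)
    exact natCast_residue_ne_zero v hS hdvd
  obtain ⟨ν, hν, hνv⟩ := exists_valuation_hom v hΓ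
  choose π hπ using fun i : Fin d => hν (Multiplicative.ofAdd (Pi.single i 1))
  have hprod : ∀ e : Fin d → ℤ, ν (∏ i, π i ^ e i) = Multiplicative.ofAdd e := by
    intro e
    rw [map_prod]
    simp_rw [map_zpow, hπ]
    apply Multiplicative.toAdd.injective
    rw [toAdd_prod]
    simp_rw [toAdd_zpow, toAdd_ofAdd]
    ext j
    simp [Finset.sum_apply, Pi.single_apply]
  have hval : ∀ x : Fˣ, v x = v ((∏ i, π i ^ (Multiplicative.toAdd (ν x)) i : Fˣ) : F) :=
    fun x => (hνv _ _).1 (hprod _).symm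
  have hmapprod : ∀ e : Fin d → ℤ,
      ∏ i, SepUnits.ofField F (π i) ^ e i = SepUnits.ofField F (∏ i, π i ^ e i) := by
    intro e
    rw [map_prod]
    simp_rw [map_zpow]
  obtain ⟨σ, hσ⟩ := exists_frobenius_sepUnits v
  refine ⟨{
    inertia := ⨅ (S : {S : ℕ // 0 < S}) (ω : {ω : SepUnits F // ω ^ (q ^ S.1 - 1) = 1}),
      MulAction.stabilizer (GalSep F) ω.1
    frob := σ
    unif := fun i => SepUnits.ofField F (π i)
    prime := hℓ
    one_lt := hq1
    coprime := hcop
    mem_inertia := fun g => by simp [Subgroup.mem_iInf]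
    frob_smul := hσ
    exists_pow := ?_
    exists_primitive := fun S hS => exists_primitiveRoot_sepUnits v
      (natCast_residue_ne_zero v hS dvd_rfl)
    exists_root := fun S hS M hM => exists_root_sepUnits v (natCast_residue_ne_zero v hS hM)
    unif_fixed := fun i g => SepUnits.smul_ofField g _
    decomposition := ?_
    unif_indep := ?_
    rigid := ?_ }⟩
  -- all roots of unity of order dividing `q ^ S - 1` are powers of a primitive one
  · intro S hS g
    obtain ⟨ω, hω⟩ := exists_primitiveRoot_sepUnits v (natCast_residue_ne_zero v hS dvd_rfl)
    have hω1 : ω ^ (q ^ S - 1) = 1 := by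
      have := pow_orderOf_eq_one ω
      rwa [hω] at this
    obtain ⟨j, hj⟩ := exists_map_rootOfUnity_eq_pow (L := SeparableClosure F)
      v.valuationSubring hS g (x := Units.val ω) (congrArg Units.val hω1)
    refine ⟨j, fun ω' hω' => ?_⟩
    have hpos : 0 < orderOf ω := by
      rw [hω]
      change 0 < q ^ S - 1
      have : 1 < q ^ S := Nat.one_lt_pow hS.ne' hq1
      omega
    obtain ⟨i, rfl⟩ := SepUnits.mem_zpowers hpos (by rw [hω]; exact hω')
    have hgω : g • ω = ω ^ q ^ j := Units.ext hj
    change g • ω ^ i = (ω ^ i) ^ q ^ j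
    rw [smul_zpow', hgω, ← zpow_natCast, ← zpow_natCast, ← zpow_mul, ← zpow_mul, mul_comm]
  -- for a unit `u` of the valuation ring, `u ^ (q - 1)` is congruent to `1`, hence it is a power
  -- with exponent `(q - 1) * ℓ ^ t`
  · intro α hα t
    obtain ⟨x, rfl⟩ := SepUnits.exists_of_fixed hα
    set e := Multiplicative.toAdd (ν x) with he
    set u : Fˣ := x / ∏ i, π i ^ e i with hu
    have hvu : v (u : F) = 1 := by
      rw [hu, Units.val_div_eq_div_val, map_div₀, hval x, div_self]
      exact (Valuation.ne_zero_iff _).2 (Units.ne_zero _)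
    have hM : (((q - 1) * ℓ ^ t : ℕ) : ResidueField v.valuationSubring) ≠ 0 := by
      rw [Nat.cast_mul]
      refine mul_ne_zero (natCast_residue_ne_zero v one_pos (by rw [pow_one])) (hℓ0 t)
    obtain ⟨y, hy⟩ := exists_pow_eq_of_valuation_sub_one_lt v hM (x := (u : F) ^ (q - 1)) (by
      let u' : v.valuationSubring := ⟨u, hvu.le⟩
      have hu' : residue _ u' ≠ 0 := by
        rw [residue_ne_zero_iff_isUnit, ValuationSubring.valuation_eq_one_iff]
        exact (v.isEquiv_valuation_valuationSubring.eq_one_iff_eq_one).1 hvu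
      have h1 := FiniteField.pow_card_sub_one_eq_one _ hu'
      rw [← Nat.card_eq_fintype_card, ← map_pow, ← sub_eq_zero, ← map_one (residue _), ← map_sub,
        residue_eq_zero_iff, ValuationSubring.valuation_lt_one_iff,
        ← v.isEquiv_valuation_valuationSubring.lt_one_iff_lt_one] at h1
      exact h1)
    have hy0 : y ≠ 0 := by
      rintro rfl
      rw [zero_pow (mul_ne_zero (by omega) (pow_pos hℓ.pos t).ne')] at hy
      exact pow_ne_zero _ (Units.ne_zero u) hy.symm
    have hy' : (Units.mk0 y hy0) ^ ((q - 1) * ℓ ^ t) = u ^ (q - 1) := Units.ext (by simpa using hy)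
    refine ⟨SepUnits.ofField F (u / (Units.mk0 y hy0) ^ ℓ ^ t), SepUnits.ofField F (Units.mk0 y
        hy0),
      e, ?_, fun g => SepUnits.smul_ofField g _, ?_⟩
    · rw [← map_pow, div_pow, ← pow_mul, mul_comm, hy', div_self', map_one]
    · rw [hmapprod, ← map_pow, ← map_mul, ← map_mul, div_mul_cancel, hu, div_mul_cancel]
  · intro y hy M ε K hK hε c hyc i
    obtain ⟨x, rfl⟩ := SepUnits.exists_of_fixed hy
    rw [hmapprod] at hyc
    have h1 : sepVal v (Units.val (SepUnits.ofField F (x ^ M))) =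
        sepVal v (Units.val (SepUnits.ofField F (∏ i, π i ^ c i))) := by
      rw [map_pow, hyc]
      change sepVal v (Units.val ε * Units.val (SepUnits.ofField F (∏ i, π i ^ c i))) = _
      rw [map_mul, sepVal_rootOfUnity v hK hε, one_mul]
    rw [sepVal_ofField_eq, ← hνv, hprod, map_pow] at h1
    have h2 := congrFun (congrArg Multiplicative.toAdd h1) i
    rw [toAdd_pow, toAdd_ofAdd, Pi.smul_apply, nsmul_eq_mul] at h2
    exact ⟨_, h2.symm⟩
  -- for some `j'` prime to `ℓ`, `y ^ j'` is a unit times a product of the fixed roots; `h` moves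
  -- the unit by a factor congruent to `1`, and a root of unity of `ℓ`-power order congruent to `1`
  -- is `1`
  · intro h hh hρ y s hs
    have hh' : ∀ S, 0 < S → ∀ ω : SepUnits F, ω ^ (q ^ S - 1) = 1 → h • ω = ω := by
      simpa [Subgroup.mem_iInf] using hh
    obtain ⟨j, hj, x, hx0, hx⟩ := exists_henselianExtension_valuation_pow_eq
      v.valuationSubring (y := (Units.val y : SeparableClosure F))
      (Units.ne_zero (show (SeparableClosure F)ˣ from y))
    obtain ⟨t, j', hj', rfl⟩ := Nat.exists_eq_pow_mul_and_not_dvd hj.ne' ℓ hℓ.ne_one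
    choose ρ hρ1 using fun i : Fin d => exists_root_sepUnits v (hℓ0 t) (SepUnits.ofField F (π i))
    set e := Multiplicative.toAdd (ν (Units.mk0 x hx0)) with he
    set e0 : SepUnits F := ∏ i, ρ i ^ e i with he0
    have he0t : e0 ^ ℓ ^ t = SepUnits.ofField F (∏ i, π i ^ e i) := by
      rw [he0, ← Finset.prod_pow, ← hmapprod]
      refine Finset.prod_congr rfl fun i _ => ?_
      rw [← hρ1 i, ← zpow_natCast, ← zpow_natCast, ← zpow_mul, ← zpow_mul, mul_comm]
    have hve : sepVal v (Units.val (y ^ j')) = sepVal v (Units.val e0) := by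
      have h1 : sepVal v (Units.val (e0 ^ ℓ ^ t)) = sepVal v (Units.val (y ^ (ℓ ^ t * j'))) := by
        rw [he0t, ← (sepVal_ofField_eq v (Units.mk0 x hx0) _).2 (hval _)]
        exact hx.symm
      have h2 : sepVal v (Units.val (y ^ j')) ^ ℓ ^ t = sepVal v (Units.val e0) ^ ℓ ^ t := by
        rw [← map_pow, ← map_pow]
        refine Eq.trans (congrArg _ ?_) h1.symm
        rw [mul_comm, pow_mul]
        rfl
      exact (pow_left_inj₀ zero_le zero_le (pow_pos hℓ.pos t).ne').1 h2
    have hu1 : sepVal v (Units.val (y ^ j' / e0)) = 1 := by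
      have h3 : (Units.val (y ^ j' / e0) : SeparableClosure F) =
          Units.val (y ^ j') / Units.val e0 := Units.val_div_eq_div_val _ _
      rw [h3, map_div₀, hve, div_self]
      exact (Valuation.ne_zero_iff _).2 (Units.ne_zero (show (SeparableClosure F)ˣ from e0))
    have hlt := sepVal_smul_div_sub_one_lt v hh' hu1
    have he0h : h • e0 = e0 := by
      rw [he0, Finset.smul_prod']
      exact Finset.prod_congr rfl fun i _ => by rw [smul_zpow', hρ i t _ (hρ1 i)]
    have h4 : h • (y ^ j' / e0) / (y ^ j' / e0) = (h • y / y) ^ j' := by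
      rw [smul_div', he0h, smul_pow', div_div_div_cancel_right, div_pow]
    rw [h4] at hlt
    have h5 : (h • y / y) ^ j' = 1 := by
      have := eq_one_of_henselianExtension_valuation_lt (L := SeparableClosure F)
        v.valuationSubring (hℓ0 s) (x := Units.val ((h • y / y) ^ j')) (by
          have : ((h • y / y) ^ j') ^ ℓ ^ s = 1 := by rw [← pow_mul, mul_comm, pow_mul, hs, one_pow]
          exact congrArg Units.val this) hlt
      exact Units.ext this
    have h6 := pow_gcd_eq_one.2 ⟨h5, hs⟩
    rw [Nat.Coprime.gcd_eq_one (Nat.Coprime.pow_right _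
      ((Nat.Prime.coprime_iff_not_dvd hℓ).2 hj').symm), pow_one, div_eq_one] at h6
    exact h6

end Finite

end Construction

/-! ### Inertia, Frobenius and the finite unramified levels -/

namespace TameFrame

variable {F : Type*} [Field F] {ℓ q d : ℕ} (T : TameFrame F ℓ q d)

/-- The elements acting trivially on the roots of unity of order dividing `q ^ S - 1`. -/
def level (_T : TameFrame F ℓ q d) (S : ℕ) : Subgroup (GalSep F) :=
  ⨅ ω : {ω : SepUnits F // ω ^ (q ^ S - 1) = 1}, MulAction.stabilizer (GalSep F) ω.1

theorem mem_level {S : ℕ} {g : GalSep F} :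
    g ∈ T.level S ↔ ∀ ω : SepUnits F, ω ^ (q ^ S - 1) = 1 → g • ω = ω := by
  simp [level, Subgroup.mem_iInf]

theorem isClosed_level (S : ℕ) : IsClosed (T.level S : Set (GalSep F)) := by
  have : (T.level S : Set (GalSep F)) =
      ⋂ ω : {ω : SepUnits F // ω ^ (q ^ S - 1) = 1}, {g | g • ω.1 = ω.1} := by
    ext g; simp [T.mem_level]
  rw [this]
  exact isClosed_iInter fun ω => (isLocallyConstant_galSep_smul ω.1).isClosed_fiber _

theorem level_anti {S S' : ℕ} (h : S ∣ S') : T.level S' ≤ T.level S := by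
  intro g hg
  rw [mem_level] at hg ⊢
  intro ω hω
  obtain ⟨c, hc⟩ := Nat.pow_sub_one_dvd_pow_sub_one_of_dvd q h
  exact hg ω (by rw [hc, pow_mul, hω, one_pow])

theorem iInter_level : ⋂ S : {S : ℕ // 0 < S}, (T.level S.1 : Set (GalSep F)) = T.inertia := by
  ext g
  simp only [Set.mem_iInter, SetLike.mem_coe, mem_level, Subtype.forall, T.mem_inertia]

theorem isClosed_inertia : IsClosed (T.inertia : Set (GalSep F)) := by
  rw [← T.iInter_level]
  exact isClosed_iInter fun S => T.isClosed_level S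

theorem directed_level : Directed (· ⊇ ·)
    (fun S : {S : ℕ // 0 < S} => (T.level S.1 : Set (GalSep F))) := fun S S' =>
  ⟨⟨S.1 * S'.1, Nat.mul_pos S.2 S'.2⟩, T.level_anti (dvd_mul_right _ _),
    T.level_anti (dvd_mul_left _ _)⟩

instance : T.inertia.Normal := ⟨fun n hn g => by
  rw [T.mem_inertia] at hn ⊢
  intro S hS ω hω
  rw [mul_smul, mul_smul, hn S hS (g⁻¹ • ω) (by rw [← smul_pow', hω, smul_one]), smul_inv_smul]⟩

/-- Inertia and a Frobenius element generate the Galois group topologically. -/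
theorem eq_top_of_isOpen {U : Subgroup (GalSep F)} (hU : IsOpen (U : Set (GalSep F)))
    (h1 : T.inertia ≤ U) (h2 : T.frob ∈ U) : U = ⊤ := by
  have : Nonempty {S : ℕ // 0 < S} := ⟨⟨1, one_pos⟩⟩
  obtain ⟨⟨S, hS⟩, hSU⟩ := exists_subset_nhds_of_isCompact' T.directed_level
    (fun S => (T.isClosed_level S.1).isCompact) (fun S => T.isClosed_level S.1) (U := (U : Set
      (GalSep F)))
    (fun x hx => hU.mem_nhds (h1 (by rwa [T.iInter_level] at hx)))
  rw [eq_top_iff]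
  intro g _
  obtain ⟨j, hj⟩ := T.exists_pow S hS g
  have hfrob : ∀ i : ℕ, ∀ ω : SepUnits F, ω ^ (q ^ S - 1) = 1 → T.frob ^ i • ω = ω ^ q ^ i := by
    intro i
    induction i with
    | zero => intro ω _; simp
    | succ i ih =>
      intro ω hω
      rw [pow_succ, mul_smul, T.frob_smul S hS ω hω, smul_pow', ih ω hω, ← pow_mul, pow_succ]
  have h3 : (T.frob ^ j)⁻¹ * g ∈ T.level S := by
    rw [mem_level]
    intro ω hω
    rw [mul_smul, hj ω hω, inv_smul_eq_iff, hfrob j ω hω]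
  have h4 := U.mul_mem (U.pow_mem h2 j) (hSU h3)
  simpa using h4

include T in
theorem one_le_pow_sub_one {S : ℕ} (hS : 0 < S) : 0 < q ^ S - 1 := by
  have : 1 < q ^ S := Nat.one_lt_pow hS.ne' T.one_lt
  omega

/-- Roots of unity of order prime to `q` are acted upon through their Frobenius power. -/
theorem exists_dvd_level {M : ℕ} (hM : 0 < M) (h : q.Coprime M) {ω : SepUnits F} (hω : ω ^ M = 1) :
    ∃ S, 0 < S ∧ ω ^ (q ^ S - 1) = 1 := by
  obtain ⟨S, hS, c, hc⟩ := exists_dvd_pow_sub_one hM h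
  exact ⟨S, hS, by rw [hc, pow_mul, hω, one_pow]⟩

theorem inertia_smul_eq {M : ℕ} (hM : 0 < M) (h : q.Coprime M) {ω : SepUnits F} (hω : ω ^ M = 1)
    {g : GalSep F} (hg : g ∈ T.inertia) : g • ω = ω := by
  obtain ⟨S, hS, hS'⟩ := exists_dvd_level hM h hω
  exact (T.mem_inertia g).1 hg S hS ω hS'

theorem frob_smul_eq {M : ℕ} (hM : 0 < M) (h : q.Coprime M) {ω : SepUnits F} (hω : ω ^ M = 1) :
    T.frob • ω = ω ^ q := by
  obtain ⟨S, hS, hS'⟩ := exists_dvd_level hM h hω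
  exact T.frob_smul S hS ω hS'

include T in
theorem coprime_sub_one : q.Coprime (q - 1) := by
  have := T.one_lt
  rw [Nat.coprime_comm, Nat.coprime_self_sub_left (by omega)]
  exact Nat.coprime_one_left _

/-- An element fixed by inertia and by Frobenius is fixed by the whole Galois group. -/
theorem smul_eq_of_inertia_of_frob {y : SepUnits F} (h1 : ∀ g ∈ T.inertia, g • y = y)
    (h2 : T.frob • y = y) (g : GalSep F) : g • y = y := by
  have hopen : IsOpen (MulAction.stabilizer (GalSep F) y : Set (GalSep F)) :=
    (isLocallyConstant_galSep_smul y).isOpen_fiber y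
  have := T.eq_top_of_isOpen hopen (fun g hg => h1 g hg) h2
  have hg : g ∈ MulAction.stabilizer (GalSep F) y := by rw [this]; trivial
  exact hg

/-- The values of the chosen elements remain independent modulo `ℓ ^ s` over the maximal
unramified extension: an element of it can be twisted by a root of unity into `F`. -/
theorem dvd_of_inertia_fixed {y : SepUnits F} (hy : ∀ g ∈ T.inertia, g • y = y) {s : ℕ}
    {c : Fin d → ℤ} (hc : y ^ ℓ ^ s = ∏ i, T.unif i ^ c i) (i : Fin d) :
    ((ℓ ^ s : ℕ) : ℤ) ∣ c i := by
  have hcop : q.Coprime ((q - 1) * ℓ ^ s) :=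
    Nat.Coprime.mul_right T.coprime_sub_one (T.coprime.pow_right s)
  have hpos : 0 < (q - 1) * ℓ ^ s :=
    Nat.mul_pos (by have := T.one_lt; omega) (pow_pos T.prime.pos s)
  obtain ⟨ω, hω⟩ := T.exists_root 1 one_pos (q - 1) (by rw [pow_one]) (T.frob • y / y)⁻¹
  have h1 : T.frob • (y ^ ℓ ^ s) = y ^ ℓ ^ s := by
    rw [hc, Finset.smul_prod']
    exact Finset.prod_congr rfl fun i _ => by rw [smul_zpow', T.unif_fixed]
  have hω1 : ω ^ ((q - 1) * ℓ ^ s) = 1 := by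
    rw [pow_mul, hω, inv_pow, div_pow, ← smul_pow', h1, div_self', inv_one]
  have hfix := T.smul_eq_of_inertia_of_frob (y := y * ω)
    (fun g hg => by rw [smul_mul', hy g hg, T.inertia_smul_eq hpos hcop hω1 hg]) (by
      have h2 : ω ^ q = ω ^ (q - 1) * ω := by
        rw [← pow_succ, Nat.sub_add_cancel T.one_lt.le]
      rw [smul_mul', T.frob_smul_eq hpos hcop hω1, h2, hω, inv_div, ← mul_assoc, mul_div_cancel])
  refine T.unif_indep _ hfix (ℓ ^ s) (ω ^ ℓ ^ s) (q - 1) (by have := T.one_lt; omega) ?_ c ?_ i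
  · rw [← pow_mul, mul_comm, hω1]
  · rw [mul_pow, hc, mul_comm]

/-- The exponent modulo `S` of the power of Frobenius through which an element of the Galois group
acts on the roots of unity of order dividing `q ^ S - 1`. -/
def deg (S : ℕ) [NeZero S] (g : GalSep F) : ZMod S :=
  ((T.exists_pow S (NeZero.pos S) g).choose : ℕ)

include T in
theorem pow_q_pow_eq {S : ℕ} {ω : SepUnits F} (hω : ω ^ (q ^ S - 1) = 1) (j k : ℕ) :
    ω ^ q ^ (j + S * k) = ω ^ q ^ j := by
  have h1 : ω ^ q ^ S = ω := by
    have h := Nat.pow_pos (n := S) (by have := T.one_lt; omega : 0 < q)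
    have := pow_succ ω (q ^ S - 1)
    rwa [Nat.sub_add_cancel h, hω, one_mul] at this
  induction k with
  | zero => simp
  | succ k ih =>
    rw [mul_add, mul_one, ← add_assoc, pow_add q, pow_mul, ih, ← pow_mul, mul_comm, pow_mul, h1]

theorem smul_eq_pow_of_deg_eq {S : ℕ} [NeZero S] {g : GalSep F} {j : ℕ} (hj : T.deg S g = j)
    {ω : SepUnits F} (hω : ω ^ (q ^ S - 1) = 1) : g • ω = ω ^ q ^ j := by
  have h1 := (T.exists_pow S (NeZero.pos S) g).choose_spec ω hω
  rw [h1]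
  rw [deg, ZMod.natCast_eq_natCast_iff] at hj
  set i := (T.exists_pow S (NeZero.pos S) g).choose
  rcases le_total i j with h | h
  · obtain ⟨k, hk⟩ := (Nat.modEq_iff_dvd' h).1 hj
    rw [show j = i + S * k by omega, T.pow_q_pow_eq hω]
  · obtain ⟨k, hk⟩ := (Nat.modEq_iff_dvd' h).1 hj.symm
    rw [show i = j + S * k by omega, T.pow_q_pow_eq hω]

theorem deg_eq_of_smul {S : ℕ} [NeZero S] {g : GalSep F} {j : ℕ}
    (hj : ∀ ω : SepUnits F, ω ^ (q ^ S - 1) = 1 → g • ω = ω ^ q ^ j) : T.deg S g = j := by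
  have hS : 0 < S := NeZero.pos S
  have key : ∀ i j : ℕ, (∀ ω : SepUnits F, ω ^ (q ^ S - 1) = 1 → ω ^ q ^ i = ω ^ q ^ j) →
      i ≤ j → (i : ZMod S) = j := by
    intro i j hij hle
    obtain ⟨ω, hω⟩ := T.exists_primitive S hS
    have hω1 : ω ^ (q ^ S - 1) = 1 := by
      have := pow_orderOf_eq_one ω; rwa [hω] at this
    -- reduce the exponent difference modulo `S`
    set r := (j - i) % S with hr
    have hrS : r < S := Nat.mod_lt _ hS
    have h1 : ω ^ q ^ i = ω ^ q ^ (i + r) := by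
      rw [hij ω hω1, ← T.pow_q_pow_eq hω1 (i + r) ((j - i) / S)]
      congr 2
      have := Nat.mod_add_div (j - i) S
      omega
    rw [pow_inj_mod, hω] at h1
    have h2 : q ^ i ≡ q ^ i * q ^ r [MOD q ^ S - 1] := by rw [← pow_add]; exact h1
    have hcop : (q ^ S - 1).gcd (q ^ i) = 1 := by
      refine Nat.Coprime.pow_right i (Nat.Coprime.coprime_dvd_right (dvd_pow_self q hS.ne') ?_)
      rw [Nat.coprime_self_sub_left (Nat.one_le_pow _ _ (by have := T.one_lt; omega))]
      exact Nat.coprime_one_left _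
    have h3 : 1 ≡ q ^ r [MOD q ^ S - 1] :=
      Nat.ModEq.cancel_left_of_coprime hcop (by rw [mul_one]; exact h2)
    have hqr : 1 ≤ q ^ r := Nat.one_le_pow _ _ (by have := T.one_lt; omega)
    have h4 := (Nat.modEq_iff_dvd' hqr).1 h3
    have hlt : q ^ r < q ^ S := Nat.pow_lt_pow_right T.one_lt hrS
    have h5 : q ^ r - 1 = 0 := Nat.eq_zero_of_dvd_of_lt h4 (by omega)
    have h6 : r = 0 := by
      by_contra h0
      have := Nat.one_lt_pow h0 T.one_lt
      omega
    rw [ZMod.natCast_eq_natCast_iff, Nat.modEq_iff_dvd' hle]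
    exact Nat.dvd_of_mod_eq_zero h6
  have hs := (T.exists_pow S hS g).choose_spec
  rw [deg]
  rcases le_total (T.exists_pow S hS g).choose j with h | h
  · exact key _ _ (fun ω hω => by rw [← hs ω hω, hj ω hω]) h
  · exact (key _ _ (fun ω hω => by rw [← hs ω hω, hj ω hω]) h).symm

theorem smul_eq_pow_deg {S : ℕ} [NeZero S] (g : GalSep F) {ω : SepUnits F}
    (hω : ω ^ (q ^ S - 1) = 1) : g • ω = ω ^ q ^ (T.deg S g).val :=
  T.smul_eq_pow_of_deg_eq (by simp) hω

theorem deg_mul (S : ℕ) [NeZero S] (g h : GalSep F) :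
    T.deg S (g * h) = T.deg S g + T.deg S h := by
  have := T.deg_eq_of_smul (S := S) (g := g * h) (j := (T.deg S g).val + (T.deg S h).val)
    (fun ω hω => by
      rw [mul_smul, T.smul_eq_pow_deg h hω, smul_pow', T.smul_eq_pow_deg g hω, ← pow_mul, pow_add])
  rw [this]
  simp

theorem deg_frob (S : ℕ) [NeZero S] : T.deg S T.frob = 1 := by
  have := T.deg_eq_of_smul (S := S) (g := T.frob) (j := 1) (fun ω hω => by
    rw [T.frob_smul S (NeZero.pos S) ω hω, pow_one])
  simpa using this

theorem deg_eq_zero_iff {S : ℕ} [NeZero S] {g : GalSep F} : T.deg S g = 0 ↔ g ∈ T.level S := by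
  rw [mem_level]
  constructor
  · intro h ω hω
    have := T.smul_eq_pow_of_deg_eq (j := 0) (by simpa using h) hω
    simpa using this
  · intro h
    have := T.deg_eq_of_smul (S := S) (g := g) (j := 0) (fun ω hω => by simpa using h ω hω)
    simpa using this

theorem inertia_le_level {S : ℕ} (hS : 0 < S) : T.inertia ≤ T.level S := fun g hg => by
  rw [mem_level]
  exact (T.mem_inertia g).1 hg S hS

theorem deg_inertia (S : ℕ) [NeZero S] {g : GalSep F} (hg : g ∈ T.inertia) : T.deg S g = 0 :=
  T.deg_eq_zero_iff.2 (T.inertia_le_level (NeZero.pos S) hg)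

theorem cast_deg {S S' : ℕ} [NeZero S] [NeZero S'] (h : S ∣ S') (g : GalSep F) :
    ZMod.castHom h (ZMod S) (T.deg S' g) = T.deg S g := by
  obtain ⟨c, hc⟩ := Nat.pow_sub_one_dvd_pow_sub_one_of_dvd q h
  have := T.deg_eq_of_smul (S := S) (g := g) (j := (T.deg S' g).val) (fun ω hω =>
    T.smul_eq_pow_deg g (by rw [hc, pow_mul, hω, one_pow]))
  rw [this, ← map_natCast (ZMod.castHom h (ZMod S)), ZMod.natCast_val, ZMod.cast_id]

theorem isLocallyConstant_deg (S : ℕ) [NeZero S] : IsLocallyConstant (T.deg S) := by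
  obtain ⟨ω, hω⟩ := T.exists_primitive S (NeZero.pos S)
  have hω1 : ω ^ (q ^ S - 1) = 1 := by
    have := pow_orderOf_eq_one ω; rwa [hω] at this
  have hpos : 0 < orderOf ω := by rw [hω]; exact T.one_le_pow_sub_one (NeZero.pos S)
  rw [IsLocallyConstant.iff_eventually_eq]
  intro g
  filter_upwards [(IsLocallyConstant.iff_eventually_eq _).1 (isLocallyConstant_galSep_smul ω) g]
    with h hh
  refine T.deg_eq_of_smul (fun ω' hω' => ?_) |>.trans (ZMod.natCast_zmod_val (T.deg S g))
  obtain ⟨i, rfl⟩ := SepUnits.mem_zpowers hpos (by rw [hω]; exact hω')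
  change h • ω ^ i = (ω ^ i) ^ _
  rw [smul_zpow', hh, T.smul_eq_pow_deg g hω1, ← zpow_natCast, ← zpow_natCast, ← zpow_mul,
    ← zpow_mul, mul_comm]

end TameFrame

/-! ### Roots of unity with `ℓ`-adic exponents -/

section Padic

variable {ℓ : ℕ} [Fact ℓ.Prime]

theorem PadicInt.toZModPow_eq_iff {s : ℕ} {z w : ℤ_[ℓ]} :
    PadicInt.toZModPow s z = PadicInt.toZModPow s w ↔ (ℓ : ℤ_[ℓ]) ^ s ∣ z - w := by
  rw [← sub_eq_zero, ← map_sub, ← RingHom.mem_ker, PadicInt.ker_toZModPow,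
    Ideal.mem_span_singleton]

theorem PadicInt.isLocallyConstant_toZModPow (s : ℕ) :
    IsLocallyConstant (PadicInt.toZModPow s : ℤ_[ℓ] → ZMod (ℓ ^ s)) := by
  rw [IsLocallyConstant.iff_eventually_eq]
  intro z
  have hpos : 0 < (ℓ : ℝ) ^ (-(s : ℤ)) :=
    zpow_pos (by exact_mod_cast (Fact.out : ℓ.Prime).pos) _
  filter_upwards [Metric.ball_mem_nhds z hpos] with w hw
  rw [PadicInt.toZModPow_eq_iff, ← Ideal.mem_span_singleton, ←
    PadicInt.norm_le_pow_iff_mem_span_pow]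
  rw [Metric.mem_ball, dist_eq_norm] at hw
  exact hw.le

theorem PadicInt.continuous_of_isLocallyConstant_toZModPow {X : Type*} [TopologicalSpace X]
    {f : X → ℤ_[ℓ]} (h : ∀ s, IsLocallyConstant fun x => PadicInt.toZModPow s (f x)) :
    Continuous f := by
  rw [continuous_iff_continuousAt]
  intro x
  rw [ContinuousAt, Metric.tendsto_nhds]
  intro ε hε
  obtain ⟨s, hs⟩ := PadicInt.exists_pow_neg_lt ℓ hε
  filter_upwards [(IsLocallyConstant.iff_eventually_eq _).1 (h s) x] with y hy
  rw [PadicInt.toZModPow_eq_iff, ← Ideal.mem_span_singleton,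
    ← PadicInt.norm_le_pow_iff_mem_span_pow, ← dist_eq_norm] at hy
  exact hy.trans_lt hs

end Padic

/-! ### Kummer frames -/

/-- A tame frame with compatible systems of `ℓ`-power roots of unity and of `ℓ`-power roots of the
elements whose values form a basis of the value group. -/
structure KummerFrame (F : Type*) [Field F] (ℓ q d : ℕ) extends TameFrame F ℓ q d where
  /-- The primitive roots of unity of order `ℓ ^ s`. -/
  zeta : ℕ → SepUnits F
  zeta_pow : ∀ s, zeta (s + 1) ^ ℓ = zeta s
  orderOf_zeta : ∀ s, orderOf (zeta s) = ℓ ^ s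
  /-- The roots of order `ℓ ^ s` of the elements `unif i`. -/
  root : Fin d → ℕ → SepUnits F
  root_zero : ∀ i, root i 0 = unif i
  root_pow : ∀ i s, root i (s + 1) ^ ℓ = root i s

variable {F : Type*} [Field F] {ℓ q d : ℕ}

theorem TameFrame.exists_root_prime (T : TameFrame F ℓ q d) (x : SepUnits F) : ∃ y, y ^ ℓ = x := by
  obtain ⟨S, hS, h⟩ := exists_dvd_pow_sub_one T.prime.pos T.coprime
  exact T.exists_root S hS ℓ h x

theorem TameFrame.exists_orderOf_eq_prime (T : TameFrame F ℓ q d) :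
    ∃ w : SepUnits F, orderOf w = ℓ := by
  obtain ⟨S, hS, c, hc⟩ := exists_dvd_pow_sub_one T.prime.pos T.coprime
  obtain ⟨ω, hω⟩ := T.exists_primitive S hS
  have h0 := T.one_le_pow_sub_one hS
  have hc0 : c ≠ 0 := by rintro rfl; omega
  refine ⟨ω ^ c, ?_⟩
  rw [orderOf_pow_of_dvd hc0 (by rw [hω, hc]; exact dvd_mul_left _ _), hω, hc,
    Nat.mul_div_cancel _ (Nat.pos_of_ne_zero hc0)]

/-- Every tame frame extends to a Kummer frame, with a prescribed primitive root of unity of order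
`ℓ ^ r`. -/
theorem TameFrame.exists_kummerFrame (T : TameFrame F ℓ q d) (r : ℕ) (w : SepUnits F)
    (hw : orderOf w = ℓ ^ r) : ∃ K : KummerFrame F ℓ q d, K.zeta r = w := by
  have hℓ : Fact ℓ.Prime := ⟨T.prime⟩
  choose φ hφ using T.exists_root_prime
  have main : ∀ (r : ℕ) (w : SepUnits F), orderOf w = ℓ ^ (r + 1) →
      ∃ K : KummerFrame F ℓ q d, K.zeta (r + 1) = w := by
    intro r w hw
    have hu : ∀ k, orderOf (φ^[k] w) = ℓ ^ (r + k + 1) := by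
      intro k
      induction k with
      | zero => simpa using hw
      | succ k ih =>
        rw [Function.iterate_succ_apply']
        refine orderOf_eq_prime_pow ?_ ?_
        · rw [show r + (k + 1) = r + k + 1 by ring, pow_succ', pow_mul, hφ, ←
          orderOf_dvd_iff_pow_eq_one,
            ih, Nat.pow_dvd_pow_iff_le_right T.prime.one_lt]
          omega
        · rw [pow_succ', pow_mul, hφ, ← orderOf_dvd_iff_pow_eq_one, ih]
          exact dvd_of_eq (by ring)
    refine ⟨{ T with
      zeta := fun s => (φ^[s] w) ^ ℓ ^ (r + 1)
      zeta_pow := fun s => by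
        rw [Function.iterate_succ_apply', ← pow_mul, mul_comm, pow_mul, hφ]
      orderOf_zeta := fun s => by
        rw [orderOf_pow_of_dvd (pow_ne_zero _ T.prime.ne_zero)
          (by rw [hu]; exact pow_dvd_pow _ (by omega)), hu, Nat.pow_div (by omega) T.prime.pos]
        congr 1
        omega
      root := fun i s => φ^[s] (T.unif i)
      root_zero := fun i => rfl
      root_pow := fun i s => by rw [Function.iterate_succ_apply', hφ] }, ?_⟩
    have : ∀ k, (φ^[k] w) ^ ℓ ^ k = w := by
      intro k
      induction k with
      | zero => simp
      | succ k ih => rw [Function.iterate_succ_apply', pow_succ', pow_mul, hφ, ih]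
    exact this (r + 1)
  cases r with
  | succ r => exact main r w hw
  | zero =>
    obtain ⟨w', hw'⟩ := T.exists_orderOf_eq_prime
    obtain ⟨K, -⟩ := main 0 w' (by simpa using hw')
    refine ⟨K, ?_⟩
    have h1 := K.orderOf_zeta 0
    rw [pow_zero, orderOf_eq_one_iff] at h1 hw
    rw [h1, hw]

namespace KummerFrame

variable (T : KummerFrame F ℓ q d)

theorem zeta_pow_pow (s t : ℕ) : T.zeta (s + t) ^ ℓ ^ t = T.zeta s := by
  induction t with
  | zero => simp
  | succ t ih => rw [← add_assoc, pow_succ', pow_mul, T.zeta_pow, ih]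

theorem root_pow_pow (i : Fin d) (s t : ℕ) : T.root i (s + t) ^ ℓ ^ t = T.root i s := by
  induction t with
  | zero => simp
  | succ t ih => rw [← add_assoc, pow_succ', pow_mul, T.root_pow, ih]

theorem root_pow_eq_unif (i : Fin d) (s : ℕ) : T.root i s ^ ℓ ^ s = T.unif i := by
  have := T.root_pow_pow i 0 s
  rwa [zero_add, T.root_zero] at this

theorem zeta_pow_eq_one (s : ℕ) : T.zeta s ^ ℓ ^ s = 1 := by
  have := pow_orderOf_eq_one (T.zeta s)
  rwa [T.orderOf_zeta] at this

variable {T} in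
theorem exists_zpow_eq {s : ℕ} {w : SepUnits F} (hw : w ^ ℓ ^ s = 1) :
    ∃ k : ℤ, w = T.zeta s ^ k := by
  have h : 0 < orderOf (T.zeta s) := by rw [T.orderOf_zeta]; exact pow_pos T.prime.pos s
  obtain ⟨k, hk⟩ := SepUnits.mem_zpowers h (by rw [T.orderOf_zeta]; exact hw)
  exact ⟨k, hk.symm⟩

variable [Fact ℓ.Prime]

/-- The power of `zeta s` with an `ℓ`-adic exponent. -/
def ex (s : ℕ) (z : ℤ_[ℓ]) : SepUnits F := T.zeta s ^ (PadicInt.toZModPow s z).val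

variable {T}

theorem ex_eq_zpow_of_toZModPow {s : ℕ} {z : ℤ_[ℓ]} {k : ℤ} (h : PadicInt.toZModPow s z = k) :
    T.ex s z = T.zeta s ^ k := by
  rw [ex, ← zpow_natCast, zpow_eq_zpow_iff_modEq, T.orderOf_zeta, ← ZMod.intCast_eq_intCast_iff]
  simp [h]

theorem ex_intCast (s : ℕ) (k : ℤ) : T.ex s (k : ℤ_[ℓ]) = T.zeta s ^ k :=
  ex_eq_zpow_of_toZModPow (by simp)

theorem exists_int_approx (s : ℕ) (z : ℤ_[ℓ]) : ∃ k : ℤ, PadicInt.toZModPow s z = k :=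
  ⟨(PadicInt.toZModPow s z).val, by simp⟩

theorem ex_eq_iff {s : ℕ} {z w : ℤ_[ℓ]} :
    T.ex s z = T.ex s w ↔ PadicInt.toZModPow s z = PadicInt.toZModPow s w := by
  obtain ⟨k, hk⟩ := exists_int_approx s z
  obtain ⟨l, hl⟩ := exists_int_approx s w
  rw [ex_eq_zpow_of_toZModPow hk, ex_eq_zpow_of_toZModPow hl, zpow_eq_zpow_iff_modEq,
    T.orderOf_zeta, hk, hl, ZMod.intCast_eq_intCast_iff]

@[simp] theorem ex_zero (s : ℕ) : T.ex s 0 = 1 := by simp [ex]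

theorem ex_one (s : ℕ) : T.ex s 1 = T.zeta s := by
  have := ex_intCast (T := T) s 1
  simpa using this

theorem ex_eq_one_iff_dvd {s : ℕ} {z : ℤ_[ℓ]} : T.ex s z = 1 ↔ (ℓ : ℤ_[ℓ]) ^ s ∣ z := by
  rw [← ex_zero (T := T) s, ex_eq_iff, PadicInt.toZModPow_eq_iff, sub_zero]

theorem ex_add (s : ℕ) (z w : ℤ_[ℓ]) : T.ex s (z + w) = T.ex s z * T.ex s w := by
  obtain ⟨k, hk⟩ := exists_int_approx s z
  obtain ⟨l, hl⟩ := exists_int_approx s w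
  rw [ex_eq_zpow_of_toZModPow hk, ex_eq_zpow_of_toZModPow hl, ← zpow_add]
  exact ex_eq_zpow_of_toZModPow (by rw [map_add, hk, hl]; push_cast; rfl)

variable (T) in
/-- `ex s` as a homomorphism. -/
def exHom (s : ℕ) : Multiplicative ℤ_[ℓ] →* SepUnits F where
  toFun z := T.ex s z.toAdd
  map_one' := ex_zero s
  map_mul' _ _ := ex_add s _ _

theorem ex_sub (s : ℕ) (z w : ℤ_[ℓ]) : T.ex s (z - w) = T.ex s z / T.ex s w :=
  map_div (T.exHom s) (Multiplicative.ofAdd z) (Multiplicative.ofAdd w)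

theorem ex_intCast_mul (s : ℕ) (k : ℤ) (z : ℤ_[ℓ]) : T.ex s (k * z) = T.ex s z ^ k := by
  rw [← zsmul_eq_mul]
  exact map_zpow (T.exHom s) (Multiplicative.ofAdd z) k

theorem ex_natCast_mul (s k : ℕ) (z : ℤ_[ℓ]) : T.ex s (k * z) = T.ex s z ^ k := by
  have := ex_intCast_mul (T := T) s k z
  simpa using this

theorem ex_sum {ι : Type*} (S : Finset ι) (s : ℕ) (f : ι → ℤ_[ℓ]) :
    T.ex s (∑ i ∈ S, f i) = ∏ i ∈ S, T.ex s (f i) :=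
  map_prod (T.exHom s) (fun i => Multiplicative.ofAdd (f i)) S

theorem ex_pow_mul (s t : ℕ) (z : ℤ_[ℓ]) : T.ex (s + t) ((ℓ : ℤ_[ℓ]) ^ t * z) = T.ex s z := by
  obtain ⟨k, hk⟩ := exists_int_approx (s + t) z
  rw [← Nat.cast_pow, ex_natCast_mul, ex_eq_zpow_of_toZModPow hk]
  have hk' : PadicInt.toZModPow s z = k := by
    rw [← map_intCast (PadicInt.toZModPow (p := ℓ) (s + t)), PadicInt.toZModPow_eq_iff] at hk
    rw [← map_intCast (PadicInt.toZModPow (p := ℓ) s), PadicInt.toZModPow_eq_iff]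
    exact (pow_dvd_pow _ (Nat.le_add_right s t)).trans hk
  rw [ex_eq_zpow_of_toZModPow hk', ← zpow_natCast, ← zpow_mul, mul_comm, zpow_mul, zpow_natCast,
    T.zeta_pow_pow]

theorem ex_pow_eq_one (s : ℕ) (z : ℤ_[ℓ]) : T.ex s z ^ ℓ ^ s = 1 := by
  rw [ex, ← pow_mul, mul_comm, pow_mul]
  have := pow_orderOf_eq_one (T.zeta s)
  rw [T.orderOf_zeta] at this
  rw [this, one_pow]

variable (T) in
/-- A compatible system of roots of unity of `ℓ`-power order has an `ℓ`-adic exponent. -/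
theorem exists_padic_exponent (y : ℕ → SepUnits F) (h1 : ∀ s, y s ^ ℓ ^ s = 1)
    (h2 : ∀ s, y (s + 1) ^ ℓ = y s) : ∃ z : ℤ_[ℓ], ∀ s, y s = T.ex s z := by
  choose k hk using fun s => exists_zpow_eq (T := T) (h1 s)
  have hi : ∀ i, (ℓ : ℤ) ^ i ∣ k (i + 1) - k i := by
    intro i
    have h3 := h2 i
    rw [hk (i + 1), hk i, ← zpow_natCast, ← zpow_mul, mul_comm, zpow_mul, zpow_natCast,
      T.zeta_pow, zpow_eq_zpow_iff_modEq, T.orderOf_zeta] at h3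
    have := h3.symm.dvd
    push_cast at this
    exact this
  refine ⟨PadicInt.ofIntSeq _ (PadicInt.isCauSeq_padicNorm_of_pow_dvd_sub k ℓ hi), fun s => ?_⟩
  rw [ex_eq_zpow_of_toZModPow (PadicInt.toZModPow_ofIntSeq_of_pow_dvd_sub k ℓ hi s), hk s]

theorem eq_of_ex_eq {z w : ℤ_[ℓ]} (h : ∀ s, T.ex s z = T.ex s w) : z = w :=
  PadicInt.ext_of_toZModPow.1 fun s => ex_eq_iff.1 (h s)

theorem isLocallyConstant_ex {X : Type*} [TopologicalSpace X] {f : X → ℤ_[ℓ]} (hf : Continuous f)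
    (s : ℕ) : IsLocallyConstant fun x => T.ex s (f x) :=
  ((PadicInt.isLocallyConstant_toZModPow s).comp_continuous hf).comp
    (fun a => T.zeta s ^ a.val)

theorem continuous_of_isLocallyConstant_ex {X : Type*} [TopologicalSpace X] {f : X → ℤ_[ℓ]}
    (h : ∀ s, IsLocallyConstant fun x => T.ex s (f x)) : Continuous f := by
  refine PadicInt.continuous_of_isLocallyConstant_toZModPow fun s => ?_
  rw [IsLocallyConstant.iff_eventually_eq]
  intro x
  filter_upwards [(IsLocallyConstant.iff_eventually_eq _).1 (h s) x] with y hy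
  exact ex_eq_iff.1 hy

/-! ### The cyclotomic character and the Kummer cocycles -/

variable (T)

theorem exists_cyc (g : GalSep F) : ∃ z : ℤ_[ℓ], ∀ s, g • T.zeta s = T.ex s z :=
  T.exists_padic_exponent (fun s => g • T.zeta s)
    (fun s => by rw [← smul_pow', T.zeta_pow_eq_one, smul_one])
    (fun s => by rw [← smul_pow', T.zeta_pow])

/-- The `ℓ`-adic cyclotomic character. -/
def cyc (g : GalSep F) : ℤ_[ℓ] := (T.exists_cyc g).choose

theorem smul_zeta (g : GalSep F) (s : ℕ) : g • T.zeta s = T.ex s (T.cyc g) :=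
  (T.exists_cyc g).choose_spec s

theorem exists_kum (i : Fin d) (g : GalSep F) :
    ∃ z : ℤ_[ℓ], ∀ s, g • T.root i s / T.root i s = T.ex s z :=
  T.exists_padic_exponent (fun s => g • T.root i s / T.root i s)
    (fun s => by rw [div_pow, ← smul_pow', T.root_pow_eq_unif, T.unif_fixed, div_self'])
    (fun s => by rw [div_pow, ← smul_pow', T.root_pow])

/-- The `ℓ`-adic Kummer cocycle of `unif i`. -/
def kum (i : Fin d) (g : GalSep F) : ℤ_[ℓ] := (T.exists_kum i g).choose

theorem smul_root (i : Fin d) (g : GalSep F) (s : ℕ) :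
    g • T.root i s = T.ex s (T.kum i g) * T.root i s :=
  div_eq_iff_eq_mul.1 ((T.exists_kum i g).choose_spec s)

theorem smul_ex (g : GalSep F) (s : ℕ) (z : ℤ_[ℓ]) : g • T.ex s z = T.ex s (T.cyc g * z) := by
  obtain ⟨k, hk⟩ := exists_int_approx s z
  rw [ex_eq_zpow_of_toZModPow hk, smul_zpow', smul_zeta, ← ex_intCast_mul, ex_eq_iff, map_mul,
    map_mul, hk, map_intCast, mul_comm]

theorem kum_mul (i : Fin d) (g h : GalSep F) :
    T.kum i (g * h) = T.kum i g + T.cyc g * T.kum i h := by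
  refine eq_of_ex_eq (T := T) fun s => ?_
  have h1 := T.smul_root i (g * h) s
  rw [mul_smul, T.smul_root i h, smul_mul', T.smul_ex, T.smul_root i g, ← mul_assoc,
    mul_right_cancel_iff, ← ex_add] at h1
  rw [← h1, add_comm]

omit [Fact ℓ.Prime] in
theorem inertia_smul_zeta {g : GalSep F} (hg : g ∈ T.inertia) (s : ℕ) : g • T.zeta s = T.zeta s :=
  T.inertia_smul_eq (pow_pos T.prime.pos s) (T.coprime.pow_right s) (T.zeta_pow_eq_one s) hg

theorem cyc_inertia {g : GalSep F} (hg : g ∈ T.inertia) : T.cyc g = 1 :=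
  eq_of_ex_eq (T := T) fun s => by
    rw [← smul_zeta, T.inertia_smul_zeta hg, ex_one]

theorem cyc_frob : T.cyc T.frob = q :=
  eq_of_ex_eq (T := T) fun s => by
    rw [← smul_zeta, T.frob_smul_eq (pow_pos T.prime.pos s) (T.coprime.pow_right s)
      (T.zeta_pow_eq_one s)]
    have := ex_intCast (T := T) s q
    simpa using this.symm

theorem kum_mul_of_mem {i : Fin d} {g : GalSep F} (hg : g ∈ T.inertia) (h : GalSep F) :
    T.kum i (g * h) = T.kum i g + T.kum i h := by
  rw [kum_mul, T.cyc_inertia hg, one_mul]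

theorem kum_one (i : Fin d) : T.kum i 1 = 0 := by
  have := T.kum_mul_of_mem (i := i) T.inertia.one_mem 1
  rw [mul_one] at this
  simpa using this

theorem kum_conj_frob (i : Fin d) {x : GalSep F} (hx : x ∈ T.inertia) :
    T.kum i (T.frob * x * T.frob⁻¹) = q * T.kum i x := by
  have h2 : T.frob * x * T.frob⁻¹ ∈ T.inertia :=
    Subgroup.Normal.conj_mem inferInstance x hx T.frob
  have h1 := T.kum_mul_of_mem (i := i) h2 T.frob
  rw [inv_mul_cancel_right, kum_mul, T.cyc_frob] at h1
  linear_combination -h1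

theorem continuous_kum (i : Fin d) : Continuous (T.kum i) :=
  continuous_of_isLocallyConstant_ex (T := T) fun s => by
    have : (fun g => T.ex s (T.kum i g)) = fun g => g • T.root i s / T.root i s := by
      funext g
      rw [smul_root, mul_div_cancel_right]
    rw [this]
    exact (isLocallyConstant_galSep_smul _).comp (· / T.root i s)

/-- Elements of the inertia group on which all Kummer cocycles vanish act trivially as soon as they
act through roots of unity of `ℓ`-power order. -/
theorem smul_eq_of_kum_eq_zero {h : GalSep F} (hh : h ∈ T.inertia) (h0 : ∀ i, T.kum i h = 0)
    {y : SepUnits F} {s : ℕ} (hy : (h • y / y) ^ ℓ ^ s = 1) : h • y = y := by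
  refine T.rigid h hh (fun i t ρ hρ => ?_) y s hy
  have h1 : (ρ / T.root i t) ^ ℓ ^ t = 1 := by
    rw [div_pow, hρ, T.root_pow_eq_unif, div_self']
  have h2 := T.inertia_smul_eq (pow_pos T.prime.pos t) (T.coprime.pow_right t) h1 hh
  rw [smul_div', T.smul_root, h0, ex_zero, one_mul, div_left_inj] at h2
  exact h2

end KummerFrame

/-! ### Elements of inertia dual to the Kummer cocycles -/

namespace KummerFrame

variable {F : Type*} [Field F] {ℓ q d : ℕ} (T : KummerFrame F ℓ q d) [Fact ℓ.Prime]

/-- The Kummer cocycles modulo `ℓ ^ s` on the inertia group, as a homomorphism. -/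
def kumHom (s : ℕ) : T.inertia →* Multiplicative (Fin d → ZMod (ℓ ^ s)) where
  toFun g := Multiplicative.ofAdd fun i => PadicInt.toZModPow s (T.kum i g)
  map_one' := by
    rw [← ofAdd_zero]
    congr 1
    funext i
    simp [T.kum_one]
  map_mul' g h := by
    rw [← ofAdd_add]
    congr 1
    funext i
    simp [T.kum_mul_of_mem g.2]

omit [Fact ℓ.Prime] in
include T in
/-- The duality of finite abelian groups, with characters valued in the roots of unity of the
separable closure. -/
theorem exists_char_ne_one {Q : Type*} [CommGroup Q] [Finite Q] {s : ℕ}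
    (hQ : ∀ x : Q, x ^ ℓ ^ s = 1) {a : Q} (ha : a ≠ 1) : ∃ φ : Q →* SepUnits F, φ a ≠ 1 := by
  obtain ⟨k, -, hk⟩ := (Nat.dvd_prime_pow T.prime).1
    (Monoid.exponent_dvd_of_forall_pow_eq_one hQ)
  have hne : NeZero (Monoid.exponent Q) := ⟨by rw [hk]; exact pow_ne_zero _ T.prime.ne_zero⟩
  have : HasEnoughRootsOfUnity (SeparableClosure F) (Monoid.exponent Q) := by
    refine ⟨⟨((show (SeparableClosure F)ˣ from T.zeta k) : SeparableClosure F), ?_⟩, inferInstance⟩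
    rw [hk, ← T.orderOf_zeta k]
    exact (IsPrimitiveRoot.orderOf (show (SeparableClosure F)ˣ from T.zeta k)).map_of_injective
      (f := Units.coeHom _) Units.val_injective
  exact CommGroup.exists_apply_ne_one_of_hasEnoughRootsOfUnity Q (SeparableClosure F) ha

theorem kumHom_surjective (s : ℕ) : Function.Surjective (T.kumHom s) := by
  have hne : NeZero (ℓ ^ s) := ⟨pow_ne_zero _ T.prime.ne_zero⟩
  rw [← MonoidHom.range_eq_top, eq_top_iff]
  intro a _
  by_contra ha
  have htors : ∀ x : Multiplicative (Fin d → ZMod (ℓ ^ s)) ⧸ (T.kumHom s).range,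
      x ^ ℓ ^ s = 1 := by
    intro x
    induction x using QuotientGroup.induction_on with
    | H x =>
      rw [← QuotientGroup.mk_pow, ← QuotientGroup.mk_one]
      congr 1
      change Multiplicative.ofAdd ((ℓ ^ s) • x.toAdd) = _
      rw [← ofAdd_zero]
      congr 1
      funext i
      simp
  have hfin : Finite (Multiplicative (Fin d → ZMod (ℓ ^ s))) :=
    inferInstanceAs (Finite (Fin d → ZMod (ℓ ^ s)))
  obtain ⟨φ, hφ⟩ := T.exists_char_ne_one (s := s) htors
    (a := QuotientGroup.mk a) (by rwa [Ne, QuotientGroup.eq_one_iff])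
  set χ : Multiplicative (Fin d → ZMod (ℓ ^ s)) →* SepUnits F := φ.comp (QuotientGroup.mk' _)
  have hχ1 : ∀ g, χ (T.kumHom s g) = 1 := fun g => by
    change φ (QuotientGroup.mk (T.kumHom s g)) = 1
    have h : (QuotientGroup.mk (T.kumHom s g) :
        Multiplicative (Fin d → ZMod (ℓ ^ s)) ⧸ (T.kumHom s).range) = 1 :=
      (QuotientGroup.eq_one_iff _).2 ⟨g, rfl⟩
    rw [h, map_one]
  set e : Fin d → Multiplicative (Fin d → ZMod (ℓ ^ s)) :=
    fun i => Multiplicative.ofAdd (Pi.single i 1)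
  have hexp : ∀ b : Fin d → ZMod (ℓ ^ s), Multiplicative.ofAdd b = ∏ i, e i ^ (b i).val := by
    intro b
    have : b = ∑ i, (b i).val • (Pi.single i 1 : Fin d → ZMod (ℓ ^ s)) := by
      conv_lhs => rw [← Finset.univ_sum_single b]
      refine Finset.sum_congr rfl fun i _ => ?_
      rw [← Pi.single_smul]
      simp
    conv_lhs => rw [this]
    rfl
  choose c hc using fun i => exists_zpow_eq (T := T) (s := s) (w := χ (e i)) (by
    change φ (QuotientGroup.mk _) ^ _ = 1
    rw [← map_pow, htors, map_one])
  have hy : ∀ g ∈ T.inertia, g • (∏ i, T.root i s ^ c i) = ∏ i, T.root i s ^ c i := by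
    intro g hg
    have h1 := hχ1 ⟨g, hg⟩
    have h2 : T.kumHom s ⟨g, hg⟩ = ∏ i, e i ^ (PadicInt.toZModPow s (T.kum i g)).val := hexp _
    rw [h2, map_prod] at h1
    have h3 : ∀ i, g • T.root i s ^ c i =
        χ (e i ^ (PadicInt.toZModPow s (T.kum i g)).val) * T.root i s ^ c i := by
      intro i
      rw [smul_zpow', T.smul_root, mul_zpow, map_pow, hc i, ex, ← zpow_natCast, ← zpow_natCast,
        ← zpow_mul, ← zpow_mul, mul_comm (c i)]
    rw [Finset.smul_prod', Finset.prod_congr rfl fun i _ => h3 i, Finset.prod_mul_distrib, h1,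
      one_mul]
  have hdvd := T.dvd_of_inertia_fixed hy (s := s) (c := c) (by
    rw [← Finset.prod_pow]
    refine Finset.prod_congr rfl fun i _ => ?_
    rw [← zpow_natCast, ← zpow_mul, mul_comm, zpow_mul, zpow_natCast, T.root_pow_eq_unif])
  refine hφ ?_
  change χ a = 1
  rw [show a = ∏ i, e i ^ (a.toAdd i).val from hexp _, map_prod]
  refine Finset.prod_eq_one fun i _ => ?_
  obtain ⟨k, hk⟩ := hdvd i
  rw [map_pow, hc i, hk, zpow_mul, zpow_natCast, T.zeta_pow_eq_one, one_zpow, one_pow]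

/-- There are elements of the inertia group dual to the Kummer cocycles. -/
theorem exists_tau (i : Fin d) : ∃ g ∈ T.inertia, ∀ l, T.kum l g = if l = i then 1 else 0 := by
  set X : ℕ → Set (GalSep F) := fun s => T.inertia ∩ ⋂ l, {g | PadicInt.toZModPow s (T.kum l g) =
    PadicInt.toZModPow s (if l = i then 1 else 0)}
  have hclosed : ∀ s, IsClosed (X s) := fun s =>
    T.isClosed_inertia.inter (isClosed_iInter fun l =>
      ((PadicInt.isLocallyConstant_toZModPow s).comp_continuous (T.continuous_kum l)).isClosed_fiber
        _)
  have hanti : Antitone X := by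
    intro s t hst g hg
    refine ⟨hg.1, Set.mem_iInter.2 fun l => ?_⟩
    have := Set.mem_iInter.1 hg.2 l
    rw [Set.mem_ofPred_eq, PadicInt.toZModPow_eq_iff] at this ⊢
    exact (pow_dvd_pow _ hst).trans this
  obtain ⟨g, hg⟩ := IsCompact.nonempty_iInter_of_directed_nonempty_isCompact_isClosed X
    hanti.directed_ge (fun s => by
      obtain ⟨g, hg⟩ := T.kumHom_surjective s
        (Multiplicative.ofAdd fun l => PadicInt.toZModPow s (if l = i then 1 else 0))
      exact ⟨g, g.2, Set.mem_iInter.2 fun l => congrFun (congrArg Multiplicative.toAdd hg) l⟩)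
    (fun s => (hclosed s).isCompact) hclosed
  refine ⟨g, (Set.mem_iInter.1 hg 0).1, fun l => PadicInt.ext_of_toZModPow.1 fun s => ?_⟩
  exact Set.mem_iInter.1 (Set.mem_iInter.1 hg s).2 l

/-- An element of the inertia group on which the `i`-th Kummer cocycle is `1` and the others
vanish. -/
def tau (i : Fin d) : GalSep F := (T.exists_tau i).choose

theorem tau_mem (i : Fin d) : T.tau i ∈ T.inertia := (T.exists_tau i).choose_spec.1

theorem kum_tau (l i : Fin d) : T.kum l (T.tau i) = if l = i then 1 else 0 :=
  (T.exists_tau i).choose_spec.2 l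

end KummerFrame

/-! ### Locally constant functions on the Galois group -/

section Topology

variable {F : Type*} [Field F]

theorem IsLocallyConstant.galSep_smul {X : Type*} [TopologicalSpace X] {a : X → GalSep F}
    {b : X → SepUnits F} (ha : Continuous a) (hb : IsLocallyConstant b) :
    IsLocallyConstant fun x => a x • b x := by
  rw [IsLocallyConstant.iff_eventually_eq]
  intro x
  have h1 := ha.continuousAt.eventually ((IsLocallyConstant.iff_eventually_eq _).1
    (isLocallyConstant_galSep_smul (b x)) (a x))
  filter_upwards [h1, (IsLocallyConstant.iff_eventually_eq _).1 hb x] with y h1 h2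
  rw [h2, h1]

/-- Locally constant functions on the Galois group are uniformly locally constant. -/
theorem IsLocallyConstant.exists_openNormalSubgroup {X : Type*} {z : GalSep F → X}
    (hz : IsLocallyConstant z) : ∃ U : Subgroup (GalSep F), U.Normal ∧ IsOpen (U : Set (GalSep F)) ∧
      ∀ g, ∀ u ∈ U, z (g * u) = z g := by
  have h := (isCompact_univ (X := GalSep F)).eventually_forall_of_forall_eventually
    (x₀ := (1 : GalSep F)) (P := fun u g => z (g * u) = z g) (fun g _ => by
      have h1 : IsLocallyConstant fun p : GalSep F × GalSep F => z (p.2 * p.1) :=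
        hz.comp_continuous (continuous_snd.mul continuous_fst)
      have h2 : IsLocallyConstant fun p : GalSep F × GalSep F => z p.2 :=
        hz.comp_continuous continuous_snd
      filter_upwards [(IsLocallyConstant.iff_eventually_eq _).1 h1 (1, g),
        (IsLocallyConstant.iff_eventually_eq _).1 h2 (1, g)] with p hp hp'
      rw [hp, hp', mul_one])
  obtain ⟨W, hW, hWo, h1⟩ := eventually_nhds_iff.1 h
  obtain ⟨U, hU⟩ := ProfiniteGrp.exist_openNormalSubgroup_sub_open_nhds_of_one hWo h1
  exact ⟨U.toSubgroup, inferInstance, U.isOpen', fun g u hu => hW u (hU hu) g trivial⟩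

theorem IsLocallyConstant.exists_openNormalSubgroup₂ {X : Type*} {c : GalSep F × GalSep F → X}
    (hc : IsLocallyConstant c) : ∃ U : Subgroup (GalSep F), U.Normal ∧
      IsOpen (U : Set (GalSep F)) ∧ ∀ g h, ∀ u ∈ U, ∀ u' ∈ U, c (g * u, h * u') = c (g, h) := by
  have h := (isCompact_univ (X := GalSep F × GalSep F)).eventually_forall_of_forall_eventually
    (x₀ := (1 : GalSep F × GalSep F)) (P := fun u g => c (g * u) = c g) (fun g _ => by
      have h1 : IsLocallyConstant fun p : (GalSep F × GalSep F) × (GalSep F × GalSep F) =>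
        c (p.2 * p.1) := hc.comp_continuous (continuous_snd.mul continuous_fst)
      have h2 : IsLocallyConstant fun p : (GalSep F × GalSep F) × (GalSep F × GalSep F) => c p.2 :=
        hc.comp_continuous continuous_snd
      filter_upwards [(IsLocallyConstant.iff_eventually_eq _).1 h1 (1, g),
        (IsLocallyConstant.iff_eventually_eq _).1 h2 (1, g)] with p hp hp'
      rw [hp, hp', mul_one])
  rw [Prod.one_eq_mk, nhds_prod_eq] at h
  obtain ⟨pa, ha, pb, hb, hab⟩ := Filter.eventually_prod_iff.1 h
  obtain ⟨W, hW, hWo, h1⟩ := eventually_nhds_iff.1 (ha.and hb)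
  obtain ⟨U, hU⟩ := ProfiniteGrp.exist_openNormalSubgroup_sub_open_nhds_of_one hWo h1
  exact ⟨U.toSubgroup, inferInstance, U.isOpen', fun g h u hu u' hu' =>
    hab (hW u (hU hu)).1 (hW u' (hU hu')).2 (g, h) trivial⟩

end Topology

/-! ### Hilbert's Theorem 90 and the splitting of cocycles on subgroups -/

section Cohomology

variable {F : Type*} [Field F]

/-- Hilbert's Theorem 90 for a locally constant function which is a cocycle on a subgroup. -/
theorem exists_smul_div_eq_of_cocycle (K : Subgroup (GalSep F)) {z : GalSep F → SepUnits F}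
    (hz : IsLocallyConstant z) (hc : ∀ g ∈ K, ∀ h ∈ K, z (g * h) = g • z h * z g) :
    ∃ y : SepUnits F, ∀ g ∈ K, z g = g • y / y := by
  classical
  obtain ⟨U, hUn, hUo, hU⟩ := hz.exists_openNormalSubgroup
  set E := IntermediateField.fixedField U
  have hE : E.fixingSubgroup = U :=
    InfiniteGalois.fixingSubgroup_fixedField ⟨U, Subgroup.isClosed_of_isOpen U hUo⟩
  set V := U.subgroupOf K
  have hfin : Finite (GalSep F ⧸ U) := Subgroup.quotient_finite_of_isOpen U hUo
  have hinj : Function.Injective (Quotient.map' (s₁ := QuotientGroup.leftRel V)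
      (s₂ := QuotientGroup.leftRel U) (fun k : K => (k : GalSep F)) (by
        intro a b hab
        rw [QuotientGroup.leftRel_apply] at hab ⊢
        exact hab)) := by
    intro a b
    induction a using Quotient.inductionOn'
    induction b using Quotient.inductionOn'
    intro hab
    rw [Quotient.map'_mk'', Quotient.map'_mk'', Quotient.eq''] at hab
    rw [Quotient.eq'']
    rw [QuotientGroup.leftRel_apply] at hab ⊢
    exact hab
  have hfin' : Finite (K ⧸ V) := Finite.of_injective _ hinj
  have := Fintype.ofFinite (K ⧸ V)
  -- the distinct embeddings of the fixed field of `U` given by the cosets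
  set emb : K ⧸ V → (E →* SeparableClosure F) := fun a =>
    ((a.out : GalSep F) : SeparableClosure F →* SeparableClosure F).comp ((algebraMap E
      (SeparableClosure F)) : E →* SeparableClosure F)
  have hemb : Function.Injective emb := by
    intro a b hab
    rw [← QuotientGroup.out_eq' a, ← QuotientGroup.out_eq' b, QuotientGroup.eq]
    change (a.out⁻¹ * b.out : GalSep F) ∈ U
    rw [← hE, IntermediateField.mem_fixingSubgroup_iff]
    intro x hx
    have h1 : (a.out : GalSep F) x = (b.out : GalSep F) x := DFunLike.congr_fun hab ⟨x, hx⟩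
    change (a.out : GalSep F)⁻¹ ((b.out : GalSep F) x) = x
    rw [← h1]
    exact (a.out : GalSep F).symm_apply_apply x
  have hli := (linearIndependent_monoidHom E (SeparableClosure F)).comp emb hemb
  rw [Fintype.linearIndependent_iff] at hli
  have hone : z 1 = 1 := by
    have := hc 1 K.one_mem 1 K.one_mem
    simpa using this
  obtain ⟨x, hx⟩ : ∃ x : E, ∑ a : K ⧸ V, Units.val (z a.out) * (a.out : GalSep F) (x :
      SeparableClosure F) ≠ 0 := by
    by_contra! hcon
    have := hli (fun a => Units.val (z a.out)) (by
      funext x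
      have := hcon x
      simpa [emb] using this) (QuotientGroup.mk 1)
    exact Units.ne_zero _ this
  have hwd : ∀ k k' : K, (QuotientGroup.mk k : K ⧸ V) = QuotientGroup.mk k' →
      Units.val (z k) * (k : GalSep F) (x : SeparableClosure F) =
        Units.val (z k') * (k' : GalSep F) (x : SeparableClosure F) := by
    intro k k' h
    rw [QuotientGroup.eq] at h
    have h' : (k : GalSep F)⁻¹ * k' ∈ U := h
    have h1 : (k' : GalSep F) = k * ((k : GalSep F)⁻¹ * k') := by group
    have h2 : ((k : GalSep F)⁻¹ * k') (x : SeparableClosure F) = x := by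
      rw [← hE, IntermediateField.mem_fixingSubgroup_iff] at h'
      exact h' x x.2
    rw [h1, hU _ _ h', AlgEquiv.mul_apply, h2]
  set y₀ : SepUnits F := Units.mk0 _ hx
  have hy₀ : ∀ k : K, (k : GalSep F) • y₀ = y₀ / z k := by
    intro k
    rw [eq_div_iff_mul_eq']
    refine Units.ext ?_
    change (k : GalSep F) (∑ a : K ⧸ V, Units.val (z a.out) * (a.out : GalSep F)
      (x : SeparableClosure F)) * Units.val (z k) = ∑ a : K ⧸ V, Units.val (z a.out) *
      (a.out : GalSep F) (x : SeparableClosure F)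
    rw [mul_comm, map_sum, Finset.mul_sum]
    conv_rhs => rw [← Equiv.sum_comp (MulAction.toPerm k : Equiv.Perm (K ⧸ V))]
    refine Finset.sum_congr rfl fun a _ => ?_
    rw [hwd (MulAction.toPerm k a : K ⧸ V).out (k * a.out) (by
      rw [QuotientGroup.out_eq']
      conv_lhs => rw [← QuotientGroup.out_eq' a]
      rfl)]
    rw [Subgroup.coe_mul, hc _ k.2 _ a.out.2, map_mul, AlgEquiv.mul_apply]
    change _ = (k : GalSep F) (Units.val (z a.out)) * Units.val (z k) * _
    ring
  refine ⟨y₀⁻¹, fun g hg => ?_⟩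
  have := hy₀ ⟨g, hg⟩
  rw [smul_inv', this, inv_div, div_inv_eq_mul, div_mul_cancel]

end Cohomology

/-! ### Cocycles of cyclic extensions of groups -/

/-- The carry in the addition of two residues modulo `N`. -/
def carry {N : ℕ} (a b : ZMod N) : ℕ := (a.val + b.val) / N

theorem val_add_add_carry {N : ℕ} [NeZero N] (a b : ZMod N) :
    (a + b).val + N * carry a b = a.val + b.val := by
  rw [ZMod.val_add, carry, Nat.mod_add_div]

section CocycleExt

variable {Γ A : Type*} [Group Γ] [CommGroup A] [MulDistribMulAction Γ A]

/-- The group extension of `Γ` by the `Γ`-module `A` given by a normalized 2-cocycle. -/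
def CocycleExt (_c : {c : Γ × Γ → A // groupCohomology.IsMulCocycle₂ c ∧ c (1, 1) = 1}) : Type _ :=
  A × Γ

namespace CocycleExt

variable {c : {c : Γ × Γ → A // groupCohomology.IsMulCocycle₂ c ∧ c (1, 1) = 1}}

instance : Mul (CocycleExt c) := ⟨fun x y => (x.1 * x.2 • y.1 * c.1 (x.2, y.2), x.2 * y.2)⟩

instance : One (CocycleExt c) := ⟨(1, 1)⟩

instance : Inv (CocycleExt c) := ⟨fun x => ((x.2⁻¹ • x.1 * c.1 (x.2⁻¹, x.2))⁻¹, x.2⁻¹)⟩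

theorem map_one_left (g : Γ) : c.1 (1, g) = 1 := by
  rw [groupCohomology.map_one_fst_of_isMulCocycle₂ c.2.1, c.2.2]

theorem map_one_right (g : Γ) : c.1 (g, 1) = 1 := by
  rw [groupCohomology.map_one_snd_of_isMulCocycle₂ c.2.1, c.2.2, smul_one]

instance : Group (CocycleExt c) := Group.ofLeftAxioms
  (fun x y z => by
    have h := c.2.1 x.2 y.2 z.2
    refine Prod.ext ?_ (mul_assoc _ _ _)
    change x.1 * x.2 • y.1 * c.1 (x.2, y.2) * (x.2 * y.2) • z.1 * c.1 (x.2 * y.2, z.2) =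
      x.1 * x.2 • (y.1 * y.2 • z.1 * c.1 (y.2, z.2)) * c.1 (x.2, y.2 * z.2)
    simp only [smul_mul', mul_smul]
    calc _ = x.1 * x.2 • y.1 * x.2 • y.2 • z.1 * (c.1 (x.2 * y.2, z.2) * c.1 (x.2, y.2)) := by
          ac_rfl
      _ = _ := by
          rw [h]
          ac_rfl)
  (fun x => by
    change (1 * (1 : Γ) • x.1 * c.1 (1, x.2), 1 * x.2) = x
    rw [map_one_left, one_smul, mul_one, one_mul, one_mul]
    rfl)
  (fun x => by
    change ((x.2⁻¹ • x.1 * c.1 (x.2⁻¹, x.2))⁻¹ * x.2⁻¹ • x.1 * c.1 (x.2⁻¹, x.2), x.2⁻¹ * x.2) =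
      ((1, 1) : A × Γ)
    rw [mul_assoc, inv_mul_cancel, inv_mul_cancel])

variable (c) in
/-- The projection of the extension onto `Γ`. -/
def snd : CocycleExt c →* Γ where
  toFun x := x.2
  map_one' := rfl
  map_mul' _ _ := rfl

end CocycleExt

open CocycleExt in
/-- Let `c` be a normalized cocycle which is trivial on the kernel of `χ : Γ → ℤ/N`, and let
`(b, σ)` be a lift to the extension of an element `σ` with `χ σ = 1`, normalizing the lift of the
kernel. Then `c` is cohomologous to the cocycle of a cyclic algebra. -/
theorem exists_carry_of_normalizing {N : ℕ} [NeZero N]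
    (c : {c : Γ × Γ → A // groupCohomology.IsMulCocycle₂ c ∧ c (1, 1) = 1}) (χ : Γ → ZMod N)
    (hχ : ∀ g h, χ (g * h) = χ g + χ h) (h1 : ∀ n m, χ n = 0 → χ m = 0 → c.1 (n, m) = 1)
    (σ : Γ) (hσ : χ σ = 1) (b : A)
    (hb : ∀ n, χ n = 0 → b * c.1 (σ, n) = (σ * n * σ⁻¹) • b * c.1 (σ * n * σ⁻¹, σ)) :
    ∃ (α : A) (Y : ℕ → A), (∀ g : Γ, g • α = α) ∧ ∀ g h : Γ,
      c.1 (g, h) * (((g * (σ ^ (χ g).val)⁻¹) • Y (χ g).val *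
          c.1 (g * (σ ^ (χ g).val)⁻¹, σ ^ (χ g).val)) *
        g • ((h * (σ ^ (χ h).val)⁻¹) • Y (χ h).val *
          c.1 (h * (σ ^ (χ h).val)⁻¹, σ ^ (χ h).val))) =
      α ^ carry (χ g) (χ h) * ((g * h * (σ ^ (χ (g * h)).val)⁻¹) • Y (χ (g * h)).val *
          c.1 (g * h * (σ ^ (χ (g * h)).val)⁻¹, σ ^ (χ (g * h)).val)) := by
  have hχ1 : χ 1 = 0 := by simpa using hχ 1 1
  have hχinv : ∀ g, χ g⁻¹ = -χ g := fun g => by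
    have := hχ g⁻¹ g
    rw [inv_mul_cancel, hχ1] at this
    exact eq_neg_of_add_eq_zero_left this.symm
  have hχpow : ∀ i : ℕ, χ (σ ^ i) = i := by
    intro i
    induction i with
    | zero => simpa using hχ1
    | succ i ih => rw [pow_succ, hχ, ih, hσ]; simp
  let S : CocycleExt c := (b, σ)
  let ι : Γ → CocycleExt c := fun n => ((1, n) : A × Γ)
  let κ : A → CocycleExt c := fun a => ((a, 1) : A × Γ)
  have hι : ∀ n m, χ n = 0 → χ m = 0 → ι n * ι m = ι (n * m) := by
    intro n m hn hm
    change ((1 * n • 1 * c.1 (n, m), n * m) : A × Γ) = (1, n * m)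
    rw [h1 n m hn hm, smul_one, one_mul, one_mul]
  have hSι : ∀ n, χ n = 0 → S * ι n = ι (σ * n * σ⁻¹) * S := by
    intro n hn
    change ((b * σ • 1 * c.1 (σ, n), σ * n) : A × Γ) =
      (1 * (σ * n * σ⁻¹) • b * c.1 (σ * n * σ⁻¹, σ), σ * n * σ⁻¹ * σ)
    rw [smul_one, mul_one, hb n hn, one_mul, inv_mul_cancel_right]
  have hconj : ∀ (i : ℕ) n, χ n = 0 → χ (σ ^ i * n * (σ ^ i)⁻¹) = 0 := by
    intro i n hn
    rw [hχ, hχ, hχinv, hn]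
    abel
  have hSι' : ∀ (i : ℕ) n, χ n = 0 → S ^ i * ι n = ι (σ ^ i * n * (σ ^ i)⁻¹) * S ^ i := by
    intro i
    induction i with
    | zero => intro n _; simp
    | succ i ih =>
      intro n hn
      rw [pow_succ', mul_assoc, ih n hn, ← mul_assoc, hSι _ (hconj i n hn), mul_assoc]
      congr 2
      group
  have hS2 : ∀ i : ℕ, (S ^ i).2 = σ ^ i := fun i => map_pow (CocycleExt.snd c) S i
  -- the section of the extension adapted to the cosets of the kernel
  let s : Γ → CocycleExt c := fun g => ι (g * (σ ^ (χ g).val)⁻¹) * S ^ (χ g).val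
  have hker : ∀ g, χ (g * (σ ^ (χ g).val)⁻¹) = 0 := fun g => by
    rw [hχ, hχinv, hχpow]
    simp
  have hs : ∀ g, s g = ((((g * (σ ^ (χ g).val)⁻¹) • (S ^ (χ g).val).1 *
      c.1 (g * (σ ^ (χ g).val)⁻¹, σ ^ (χ g).val)), g) : A × Γ) := by
    intro g
    change ((1 * (g * (σ ^ (χ g).val)⁻¹) • (S ^ (χ g).val).1 *
      c.1 (g * (σ ^ (χ g).val)⁻¹, (S ^ (χ g).val).2), g * (σ ^ (χ g).val)⁻¹ * (S ^ (χ g).val).2) :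
      A × Γ) = _
    rw [hS2, one_mul, inv_mul_cancel_right]
  have hσN : χ (σ ^ N) = 0 := by rw [hχpow]; simp
  have hcommN : S ^ N * ι (σ ^ N) = ι (σ ^ N) * S ^ N := by
    rw [hSι' N _ hσN, mul_inv_cancel_right]
  set z : CocycleExt c := S ^ N * (ι (σ ^ N))⁻¹
  have hz2 : z.2 = 1 := by
    change CocycleExt.snd c (S ^ N * (ι (σ ^ N))⁻¹) = 1
    rw [map_mul, map_inv]
    change (S ^ N).2 * (σ ^ N)⁻¹ = 1
    rw [hS2, mul_inv_cancel]
  have hzκ : z = κ z.1 := Prod.ext rfl hz2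
  have hι_inv : ∀ n, χ n = 0 → (ι n)⁻¹ = ι n⁻¹ := by
    intro n hn
    rw [inv_eq_iff_mul_eq_one, hι n n⁻¹ hn (by rw [hχinv, hn, neg_zero]), mul_inv_cancel]
    rfl
  have hzS : z * S = S * z := by
    have h2 : S * ι (σ ^ N) = ι (σ ^ N) * S := by
      have h3 := hSι _ hσN
      rwa [show σ * σ ^ N * σ⁻¹ = σ ^ N by group] at h3
    have h3 : S * (ι (σ ^ N))⁻¹ = (ι (σ ^ N))⁻¹ * S := (Commute.inv_right h2)
    change S ^ N * (ι (σ ^ N))⁻¹ * S = S * (S ^ N * (ι (σ ^ N))⁻¹)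
    rw [mul_assoc, ← h3, ← mul_assoc, ← mul_assoc, ← pow_succ, ← pow_succ']
  have hzι : ∀ n, χ n = 0 → z * ι n = ι n * z := by
    intro n hn
    have h2 : S ^ N * (ι (σ ^ N))⁻¹ = (ι (σ ^ N))⁻¹ * S ^ N := Commute.inv_right hcommN
    have hσN' : χ (σ ^ N)⁻¹ = 0 := by rw [hχinv, hσN, neg_zero]
    change S ^ N * (ι (σ ^ N))⁻¹ * ι n = ι n * (S ^ N * (ι (σ ^ N))⁻¹)
    rw [h2, hι_inv _ hσN, mul_assoc, hSι' N n hn, ← mul_assoc, ← mul_assoc,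
      hι _ _ hσN' (hconj N n hn), hι _ _ hn hσN']
    congr 2
    group
  have hzs : ∀ g, z * s g = s g * z := fun g =>
    (Commute.mul_right (hzι _ (hker g)) (Commute.pow_right hzS _) : Commute z (s g))
  have hfix : ∀ g : Γ, g • z.1 = z.1 := by
    intro g
    have h2 := congrArg Prod.fst (hzs g)
    change z.1 * z.2 • (s g).1 * c.1 (z.2, (s g).2) = (s g).1 * (s g).2 • z.1 * c.1 ((s g).2, z.2)
      at h2
    have h3 : (s g).2 = g := by rw [hs]
    rw [hz2, h3, map_one_left, map_one_right, one_smul, mul_one, mul_one, mul_comm] at h2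
    exact (mul_left_cancel h2).symm
  have hzpow : ∀ t : ℕ, z ^ t = κ (z.1 ^ t) := by
    intro t
    induction t with
    | zero => simp only [pow_zero]; rfl
    | succ t ih =>
      rw [pow_succ, ih]
      conv_lhs => rw [hzκ]
      change ((z.1 ^ t * (1 : Γ) • z.1 * c.1 (1, 1), 1 * 1) : A × Γ) = (z.1 ^ (t + 1), 1)
      rw [map_one_left, one_smul, mul_one, mul_one, pow_succ]
  refine ⟨z.1, fun i => (S ^ i).1, hfix, fun g h => ?_⟩
  have hmain : s g * s h = z ^ carry (χ g) (χ h) * s (g * h) := by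
    set i := (χ g).val
    set j := (χ h).val
    set k := (χ (g * h)).val
    set t := carry (χ g) (χ h)
    have hk : k + N * t = i + j := by
      have := val_add_add_carry (χ g) (χ h)
      rwa [← hχ] at this
    have hSN : ∀ t : ℕ, S ^ (N * t) = z ^ t * ι (σ ^ (N * t)) := by
      intro t
      induction t with
      | zero => simp only [mul_zero, pow_zero, one_mul]; rfl
      | succ t ih =>
        have h2 : S ^ N = z * ι (σ ^ N) := (inv_mul_cancel_right _ _).symm
        have h3 : χ (σ ^ (N * t)) = 0 := by rw [hχpow]; simp
        rw [mul_add, mul_one, pow_add, ih, h2, mul_assoc, ← mul_assoc (ι _) z, ← hzι _ h3,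
          mul_assoc z, hι _ _ h3 hσN, ← mul_assoc, ← pow_succ, ← pow_add]
    have hm : χ (h * (σ ^ j)⁻¹) = 0 := hker h
    have hn : χ (g * (σ ^ i)⁻¹) = 0 := hker g
    have h3 : χ (σ ^ (N * t)) = 0 := by rw [hχpow]; simp
    have h4 : χ (g * (σ ^ i)⁻¹ * (σ ^ i * (h * (σ ^ j)⁻¹) * (σ ^ i)⁻¹)) = 0 := by
      rw [hχ, hn, hconj i _ hm, add_zero]
    calc s g * s h = ι (g * (σ ^ i)⁻¹) * (S ^ i * ι (h * (σ ^ j)⁻¹)) * S ^ j := by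
          simp only [s, mul_assoc]
          rfl
      _ = ι (g * (σ ^ i)⁻¹ * (σ ^ i * (h * (σ ^ j)⁻¹) * (σ ^ i)⁻¹)) * S ^ (i + j) := by
          rw [hSι' i _ hm, ← mul_assoc, hι _ _ hn (hconj i _ hm), mul_assoc, ← pow_add]
      _ = z ^ t * ι (g * (σ ^ i)⁻¹ * (σ ^ i * (h * (σ ^ j)⁻¹) * (σ ^ i)⁻¹) * σ ^ (N * t)) *
            S ^ k := by
          rw [← hk, add_comm k, pow_add, hSN, ← mul_assoc, ← mul_assoc]
          congr 1
          have h5 : Commute (z ^ t) (ι (g * (σ ^ i)⁻¹ * (σ ^ i * (h * (σ ^ j)⁻¹) * (σ ^ i)⁻¹))) :=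
            Commute.pow_left (hzι _ h4) t
          rw [← h5.eq, mul_assoc, hι _ _ h4 h3]
      _ = z ^ t * s (g * h) := by
          rw [mul_assoc]
          have h6 : g * (σ ^ i)⁻¹ * (σ ^ i * (h * (σ ^ j)⁻¹) * (σ ^ i)⁻¹) * σ ^ (N * t) =
              g * h * (σ ^ k)⁻¹ := by
            have h7 : σ ^ (N * t) = σ ^ i * σ ^ j * (σ ^ k)⁻¹ :=
              eq_mul_inv_of_mul_eq (by rw [← pow_add, ← pow_add, ← hk, add_comm])
            rw [h7]
            group
          rw [h6]
  have h2 := congrArg Prod.fst hmain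
  rw [hzpow, hs g, hs h, hs (g * h)] at h2
  change _ * g • _ * c.1 (g, h) = _ * (1 : Γ) • _ * c.1 (1, g * h) at h2
  rw [map_one_left, one_smul, mul_one] at h2
  rw [mul_comm, h2]

end CocycleExt

/-! ### Coboundaries and the splitting of cocycles on subgroups -/

section Splitting

variable {F : Type*} [Field F]

/-- The coboundary of a 1-cochain of the Galois group. -/
def coboundary (f : GalSep F → SepUnits F) : GalSep F × GalSep F → SepUnits F :=
  fun p => p.1 • f p.2 / f (p.1 * p.2) * f p.1

/-- A 2-cochain is a coboundary on the subgroup `K`. The cochains are defined on the whole Galois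
group, but only their values on `K` matter. -/
def SplitsOn (K : Subgroup (GalSep F)) (c : GalSep F × GalSep F → SepUnits F) : Prop :=
  ∃ f : GalSep F → SepUnits F, IsLocallyConstant f ∧
    ∀ g ∈ K, ∀ h ∈ K, c (g, h) = coboundary f (g, h)

/-- A 2-cochain satisfies the cocycle identity on the subgroup `K`. -/
def CocycleOn (K : Subgroup (GalSep F)) (c : GalSep F × GalSep F → SepUnits F) : Prop :=
  ∀ g ∈ K, ∀ h ∈ K, ∀ j ∈ K, c (g * h, j) * c (g, h) = g • c (h, j) * c (g, h * j)

theorem coboundary_mul (f f' : GalSep F → SepUnits F) :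
    coboundary (f * f') = coboundary f * coboundary f' := by
  funext p
  simp only [coboundary, Pi.mul_apply, smul_mul', div_eq_mul_inv, mul_inv]
  ac_rfl

theorem coboundary_inv (f : GalSep F → SepUnits F) : coboundary f⁻¹ = (coboundary f)⁻¹ := by
  funext p
  simp only [coboundary, Pi.inv_apply, smul_inv', div_eq_mul_inv, mul_inv]

theorem coboundary_pow (f : GalSep F → SepUnits F) (n : ℕ) :
    coboundary (f ^ n) = coboundary f ^ n := by
  funext p
  simp only [coboundary, Pi.pow_apply, smul_pow', mul_pow, div_pow]

theorem IsLocallyConstant.coboundary {f : GalSep F → SepUnits F} (hf : IsLocallyConstant f) :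
    IsLocallyConstant (coboundary f) :=
  ((IsLocallyConstant.galSep_smul continuous_fst (hf.comp_continuous continuous_snd)).div
    (hf.comp_continuous (continuous_fst.mul continuous_snd))).mul
      (hf.comp_continuous continuous_fst)

theorem cocycleOn_coboundary (K : Subgroup (GalSep F)) (f : GalSep F → SepUnits F) :
    CocycleOn K (coboundary f) := by
  intro g _ h _ j _
  simp only [_root_.coboundary, smul_mul', smul_div', mul_smul, mul_assoc]
  simp only [div_eq_mul_inv]
  have h1 : (f (g * h))⁻¹ * f (g * h) = 1 := inv_mul_cancel _
  have h2 : (g • f (h * j))⁻¹ * g • f (h * j) = 1 := inv_mul_cancel _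
  calc _ = g • h • f j * (f (g * (h * j)))⁻¹ * g • f h * f g * ((f (g * h))⁻¹ * f (g * h)) := by
        ac_rfl
    _ = g • h • f j * (f (g * (h * j)))⁻¹ * g • f h * f g *
        ((g • f (h * j))⁻¹ * g • f (h * j)) := by rw [h1, h2]
    _ = _ := by ac_rfl

namespace CocycleOn

variable {K : Subgroup (GalSep F)} {c c' : GalSep F × GalSep F → SepUnits F}

theorem mul (h : CocycleOn K c) (h' : CocycleOn K c') : CocycleOn K (c * c') := by
  intro x hx y hy z hz
  simp only [Pi.mul_apply, smul_mul']
  rw [mul_mul_mul_comm, h x hx y hy z hz, h' x hx y hy z hz, mul_mul_mul_comm]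

theorem inv (h : CocycleOn K c) : CocycleOn K c⁻¹ := by
  intro x hx y hy z hz
  simp only [Pi.inv_apply, smul_inv', ← mul_inv]
  rw [h x hx y hy z hz]

theorem div (h : CocycleOn K c) (h' : CocycleOn K c') : CocycleOn K (c / c') := by
  rw [div_eq_mul_inv]
  exact h.mul h'.inv

theorem mono (h : CocycleOn K c) {K' : Subgroup (GalSep F)} (hK : K' ≤ K) : CocycleOn K' c :=
  fun x hx y hy z hz => h x (hK hx) y (hK hy) z (hK hz)

end CocycleOn

namespace SplitsOn

variable {K : Subgroup (GalSep F)} {c c' : GalSep F × GalSep F → SepUnits F}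

theorem mul (h : SplitsOn K c) (h' : SplitsOn K c') : SplitsOn K (c * c') := by
  obtain ⟨f, hf, h⟩ := h
  obtain ⟨f', hf', h'⟩ := h'
  exact ⟨f * f', hf.mul hf', fun x hx y hy => by
    rw [coboundary_mul, Pi.mul_apply, Pi.mul_apply, h x hx y hy, h' x hx y hy]⟩

theorem inv (h : SplitsOn K c) : SplitsOn K c⁻¹ := by
  obtain ⟨f, hf, h⟩ := h
  exact ⟨f⁻¹, hf.inv, fun x hx y hy => by
    rw [coboundary_inv, Pi.inv_apply, Pi.inv_apply, h x hx y hy]⟩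

theorem div (h : SplitsOn K c) (h' : SplitsOn K c') : SplitsOn K (c / c') := by
  rw [div_eq_mul_inv]
  exact h.mul h'.inv

theorem pow (h : SplitsOn K c) (n : ℕ) : SplitsOn K (c ^ n) := by
  obtain ⟨f, hf, h⟩ := h
  exact ⟨f ^ n, hf.comp (· ^ n), fun x hx y hy => by
    rw [coboundary_pow, Pi.pow_apply, Pi.pow_apply, h x hx y hy]⟩

theorem one : SplitsOn K 1 := ⟨1, IsLocallyConstant.const 1, fun x _ y _ => by simp [coboundary]⟩

theorem zpow (h : SplitsOn K c) (n : ℤ) : SplitsOn K (c ^ n) := by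
  obtain ⟨m, rfl | rfl⟩ := n.eq_nat_or_neg
  · rw [zpow_natCast]
    exact h.pow m
  · rw [zpow_neg, zpow_natCast]
    exact (h.pow m).inv

theorem mono (h : SplitsOn K c) {K' : Subgroup (GalSep F)} (hK : K' ≤ K) : SplitsOn K' c := by
  obtain ⟨f, hf, h⟩ := h
  exact ⟨f, hf, fun x hx y hy => h x (hK hx) y (hK hy)⟩

theorem congr (h : SplitsOn K c) (hc : ∀ g ∈ K, ∀ h ∈ K, c' (g, h) = c (g, h)) :
    SplitsOn K c' := by
  obtain ⟨f, hf, h⟩ := h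
  exact ⟨f, hf, fun x hx y hy => by rw [hc x hx y hy, h x hx y hy]⟩

theorem of_div_right (h : SplitsOn K (c / c')) (h' : SplitsOn K c') : SplitsOn K c := by
  have := h.mul h'
  rwa [div_mul_cancel] at this

theorem trans_div {c'' : GalSep F × GalSep F → SepUnits F} (h : SplitsOn K (c / c'))
    (h' : SplitsOn K (c' / c'')) : SplitsOn K (c / c'') := by
  have := h.mul h'
  rwa [div_mul_div_cancel] at this

/-- A cocycle which splits on an intersection of closed subgroups splits on one of them. -/
theorem exists_of_directed {ι : Type*} [Nonempty ι] {V : ι → Subgroup (GalSep F)}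
    (hV : Directed (· ⊇ ·) fun i => (V i : Set (GalSep F)))
    (hcl : ∀ i, IsClosed (V i : Set (GalSep F))) (hK : ∀ g, (∀ i, g ∈ V i) → g ∈ K)
    (hc : IsLocallyConstant c) (hs : SplitsOn K c) : ∃ i, SplitsOn (V i) c := by
  obtain ⟨f, hf, hs⟩ := hs
  have hd : IsLocallyConstant fun p => (c p, coboundary f p) := hc.prodMk hf.coboundary
  obtain ⟨i, hi⟩ := exists_subset_nhds_of_isCompact'
    (V := fun i => (V i : Set (GalSep F)) ×ˢ (V i : Set (GalSep F)))
    (fun i j => by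
      obtain ⟨k, hki, hkj⟩ := hV i j
      exact ⟨k, Set.prod_mono hki hki, Set.prod_mono hkj hkj⟩)
    (fun i => (hcl i).isCompact.prod (hcl i).isCompact) (fun i => (hcl i).prod (hcl i))
    (U := {p | c p = coboundary f p}) (fun p hp => by
      have h1 := Set.mem_iInter.1 hp
      refine IsOpen.mem_nhds (hd {x | x.1 = x.2}) ?_
      exact hs p.1 (hK _ fun i => (h1 i).1) p.2 (hK _ fun i => (h1 i).2))
  exact ⟨i, f, hf, fun g hg h hh => hi ⟨hg, hh⟩⟩

end SplitsOn

/-- A cocycle on `K` which splits on the kernel of a homomorphism `χ : K → ℤ/N` in whose image `1`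
lies is cohomologous to the cocycle of a cyclic algebra. -/
theorem SplitsOn.exists_carry {N : ℕ} [NeZero N] {K K' : Subgroup (GalSep F)}
    {c : GalSep F × GalSep F → SepUnits F} (hc : IsLocallyConstant c) (hcoc : CocycleOn K c)
    {χ : GalSep F → ZMod N} (hχ : IsLocallyConstant χ)
    (hχm : ∀ g ∈ K, ∀ h ∈ K, χ (g * h) = χ g + χ h) (hK' : ∀ g, g ∈ K' ↔ g ∈ K ∧ χ g = 0)
    {σ : GalSep F} (hσK : σ ∈ K) (hσ : χ σ = 1) (hs : SplitsOn K' c) :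
    ∃ α : SepUnits F, (∀ g ∈ K, g • α = α) ∧
      SplitsOn K (c / fun p => α ^ carry (χ p.1) (χ p.2)) := by
  obtain ⟨f₀, hf₀, hs⟩ := hs
  -- make the cocycle trivial on the kernel
  set c₁ := c / coboundary f₀ with hc₁def
  have hc₁ : IsLocallyConstant c₁ := hc.div hf₀.coboundary
  have hcoc₁ : CocycleOn K c₁ := hcoc.div (cocycleOn_coboundary K f₀)
  have hone : ∀ n ∈ K', ∀ m ∈ K', c₁ (n, m) = 1 := fun n hn m hm => by
    rw [hc₁def, Pi.div_apply, hs n hn m hm, div_self']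
  have hK'K : K' ≤ K := fun g hg => ((hK' g).1 hg).1
  have hχinv : ∀ g ∈ K, χ g⁻¹ = -χ g := by
    intro g hg
    have h1 : χ 1 = 0 := by simpa using hχm 1 K.one_mem 1 K.one_mem
    have := hχm g⁻¹ (K.inv_mem hg) g hg
    rw [inv_mul_cancel, h1] at this
    exact eq_neg_of_add_eq_zero_left this.symm
  have hconj : ∀ n ∈ K', σ * n * σ⁻¹ ∈ K' := by
    intro n hn
    obtain ⟨hnK, hn0⟩ := (hK' n).1 hn
    refine (hK' _).2 ⟨K.mul_mem (K.mul_mem hσK hnK) (K.inv_mem hσK), ?_⟩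
    rw [hχm _ (K.mul_mem hσK hnK) _ (K.inv_mem hσK), hχm _ hσK _ hnK, hn0, hχinv _ hσK]
    abel
  have hconj' : ∀ n ∈ K', σ⁻¹ * n * σ ∈ K' := by
    intro n hn
    obtain ⟨hnK, hn0⟩ := (hK' n).1 hn
    refine (hK' _).2 ⟨K.mul_mem (K.mul_mem (K.inv_mem hσK) hnK) hσK, ?_⟩
    rw [hχm _ (K.mul_mem (K.inv_mem hσK) hnK) _ hσK, hχm _ (K.inv_mem hσK) _ hnK, hn0,
      hχinv _ hσK]
    abel
  -- the difference between the two lifts of conjugation by `σ` is a 1-cocycle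
  obtain ⟨b, hb⟩ := exists_smul_div_eq_of_cocycle K'
    (z := fun n => c₁ (σ, σ⁻¹ * n * σ) / c₁ (n, σ))
    ((hc₁.comp_continuous (by fun_prop)).div (hc₁.comp_continuous (by fun_prop))) (by
      intro n' hn' m' hm'
      set n := σ⁻¹ * n' * σ with hn
      set m := σ⁻¹ * m' * σ with hm
      have hnK : n ∈ K' := hconj' _ hn'
      have hmK : m ∈ K' := hconj' _ hm'
      have e1 : n' * σ = σ * n := by rw [hn]; group
      have e2 : m' * σ = σ * m := by rw [hm]; group
      have e3 : σ⁻¹ * (n' * m') * σ = n * m := by rw [hn, hm]; group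
      have i1 := hcoc₁ σ hσK n (hK'K hnK) m (hK'K hmK)
      have i2 := hcoc₁ n' (hK'K hn') σ hσK m (hK'K hmK)
      have i3 := hcoc₁ n' (hK'K hn') m' (hK'K hm') σ hσK
      rw [hone n hnK m hmK, smul_one, one_mul] at i1
      rw [hone n' hn' m' hm', mul_one, e2] at i3
      rw [e1] at i2
      simp only [e3]
      rw [smul_div', i3, ← i1, div_mul_div_comm, div_eq_div_iff_mul_eq_mul]
      calc c₁ (σ * n, m) * c₁ (σ, n) * (n' • c₁ (m', σ) * c₁ (n', σ))
          = (c₁ (σ * n, m) * c₁ (n', σ)) * (c₁ (σ, n) * n' • c₁ (m', σ)) := by ac_rfl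
        _ = _ := by
          rw [i2]
          ac_rfl)
  have hcK : groupCohomology.IsMulCocycle₂ (fun p : K × K => c₁ (p.1, p.2)) :=
    fun g h j => hcoc₁ g g.2 h h.2 j j.2
  obtain ⟨α, Y, hα, hY⟩ := exists_carry_of_normalizing
    ⟨fun p : K × K => c₁ (p.1, p.2), hcK, hone 1 K'.one_mem 1 K'.one_mem⟩ (fun k : K => χ k)
    (fun g h => hχm g g.2 h h.2) (fun n m hn hm => hone n ((hK' n).2 ⟨n.2, hn⟩) m
      ((hK' m).2 ⟨m.2, hm⟩)) ⟨σ, hσK⟩ hσ b (by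
      intro n hn
      have hnK : (n : GalSep F) ∈ K' := (hK' n).2 ⟨n.2, hn⟩
      have h1 := hb _ (hconj _ hnK)
      rw [show σ⁻¹ * (σ * n * σ⁻¹) * σ = (n : GalSep F) by group, div_eq_div_iff_mul_eq_mul] at h1
      rw [mul_comm]
      exact h1)
  -- the total cochain given by the formula of the abstract statement
  set f : GalSep F → SepUnits F := fun g => (g * (σ ^ (χ g).val)⁻¹) • Y (χ g).val *
      c₁ (g * (σ ^ (χ g).val)⁻¹, σ ^ (χ g).val) with hf
  have hσχ : Continuous fun g => σ ^ (χ g).val := (hχ.comp fun i => σ ^ i.val).continuous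
  have hfc : IsLocallyConstant f :=
    (IsLocallyConstant.galSep_smul (continuous_id.mul hσχ.inv) (hχ.comp fun i => Y i.val)).mul
      (hc₁.comp_continuous ((continuous_id.mul hσχ.inv).prodMk hσχ))
  refine ⟨α, fun g hg => hα ⟨g, hg⟩, f₀ * f⁻¹, hf₀.mul hfc.inv, fun g hg h hh => ?_⟩
  have h1 := hY ⟨g, hg⟩ ⟨h, hh⟩
  change c₁ (g, h) * (f g * g • f h) = α ^ carry (χ g) (χ h) * f (g * h) at h1
  have h2 : c (g, h) = c₁ (g, h) * coboundary f₀ (g, h) := by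
    rw [hc₁def, Pi.div_apply, div_mul_cancel]
  rw [coboundary_mul, coboundary_inv, Pi.div_apply, Pi.mul_apply, Pi.inv_apply, h2,
    mul_comm (coboundary f₀ _), mul_div_right_comm]
  congr 1
  simp only [coboundary]
  rw [div_eq_iff_eq_mul, eq_mul_inv_of_mul_eq h1]
  simp only [div_eq_mul_inv, mul_inv, inv_inv]
  ac_rfl

/-- A cochain of exponent `N` which splits on `K` is the coboundary of a cochain of exponent `N`. -/
theorem SplitsOn.exists_pow_eq_one {K : Subgroup (GalSep F)}
    {c : GalSep F × GalSep F → SepUnits F} (hs : SplitsOn K c) {N : ℕ}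
    (hN : ∀ x : SepUnits F, ∃ y, y ^ N = x) (hcN : ∀ g ∈ K, ∀ h ∈ K, c (g, h) ^ N = 1) :
    ∃ f : GalSep F → SepUnits F, IsLocallyConstant f ∧ (∀ g ∈ K, f g ^ N = 1) ∧
      ∀ g ∈ K, ∀ h ∈ K, c (g, h) = coboundary f (g, h) := by
  obtain ⟨f, hf, hs⟩ := hs
  obtain ⟨y, hy⟩ := exists_smul_div_eq_of_cocycle K (z := fun g => f g ^ N) (hf.comp (· ^ N))
    (fun g hg h hh => by
      have h1 := hcN g hg h hh
      rw [hs g hg h hh, coboundary, mul_pow, div_pow, div_mul_eq_mul_div, div_eq_one,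
        ← smul_pow'] at h1
      exact h1.symm)
  obtain ⟨x, rfl⟩ := hN y
  refine ⟨fun g => f g / (g • x / x), hf.div ((isLocallyConstant_galSep_smul x).comp (· / x)),
    fun g hg => ?_, fun g hg h hh => ?_⟩
  · rw [div_pow, hy g hg, div_pow, smul_pow', div_self']
  · rw [hs g hg h hh]
    simp only [coboundary, smul_div', mul_smul]
    simp only [div_eq_mul_inv, mul_inv, inv_inv]
    have h2 : (g • h • x)⁻¹ * g • h • x = 1 := inv_mul_cancel _
    have h3 : (g • x)⁻¹ * g • x = 1 := inv_mul_cancel _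
    have h4 : x⁻¹ * x = 1 := inv_mul_cancel _
    calc g • f h * (f (g * h))⁻¹ * f g = g • f h * (f (g * h))⁻¹ * f g *
          ((g • h • x)⁻¹ * g • h • x) * ((g • x)⁻¹ * g • x) * (x⁻¹ * x) := by
          rw [h2, h3, h4, mul_one, mul_one, mul_one]
      _ = _ := by ac_rfl

/-- The cup product of a character `χ` modulo `N` with the Kummer cocycle of an `N`-th root `y` of
an element of the base is the inverse of the cocycle of a cyclic algebra. -/
theorem cup_smul_div_mul_coboundary {N : ℕ} [NeZero N] {χ : GalSep F → ZMod N}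
    {y : SepUnits F} {g h : GalSep F} (hχ : χ (g * h) = χ g + χ h)
    (hy : (g * h) • y ^ N = y ^ N) :
    (g • (h • y / y)) ^ (χ g).val * coboundary (fun g => (g • y) ^ (χ g).val) (g, h) =
      (y ^ N) ^ carry (χ g) (χ h) := by
  have h1 := val_add_add_carry (χ g) (χ h)
  rw [← hχ] at h1
  rw [smul_pow'] at hy
  simp only [coboundary, smul_pow', smul_div', ← mul_smul]
  rw [← hy, ← pow_mul, div_pow, div_mul_eq_mul_div, div_mul_eq_mul_div, mul_div_assoc',
    div_div, div_eq_iff_eq_mul]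
  calc ((g * h) • y) ^ (χ g).val * (((g * h) • y) ^ (χ h).val * (g • y) ^ (χ g).val)
      = ((g * h) • y) ^ ((χ g).val + (χ h).val) * (g • y) ^ (χ g).val := by
        rw [pow_add]; ac_rfl
    _ = _ := by
        rw [← h1, pow_add]
        ac_rfl

end Splitting

/-! ### The subgroups of inertia cut out by Kummer cocycles -/

namespace KummerFrame

variable {F : Type*} [Field F] {ℓ q d : ℕ} (T : KummerFrame F ℓ q d) [Fact ℓ.Prime]

omit [Fact ℓ.Prime] in
theorem smul_eq_of_pow_eq_one {g : GalSep F} (hg : g ∈ T.inertia) {s : ℕ} {w : SepUnits F}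
    (hw : w ^ ℓ ^ s = 1) : g • w = w :=
  T.inertia_smul_eq (pow_pos T.prime.pos s) (T.coprime.pow_right s) hw hg

/-- The subgroup of the inertia group where the Kummer cocycles with index outside `s` vanish. -/
def kumKer (s : Finset (Fin d)) : Subgroup (GalSep F) where
  carrier := {g | g ∈ T.inertia ∧ ∀ i ∉ s, T.kum i g = 0}
  one_mem' := ⟨T.inertia.one_mem, fun i _ => T.kum_one i⟩
  mul_mem' := fun ha hb => ⟨T.inertia.mul_mem ha.1 hb.1, fun i hi => by
    rw [T.kum_mul_of_mem ha.1, ha.2 i hi, hb.2 i hi, add_zero]⟩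
  inv_mem' := fun {x} ha => ⟨T.inertia.inv_mem ha.1, fun i hi => by
    have h1 := T.kum_mul_of_mem (i := i) ha.1 x⁻¹
    rw [mul_inv_cancel, kum_one, ha.2 i hi, zero_add] at h1
    exact h1.symm⟩

variable {T}

theorem mem_kumKer {s : Finset (Fin d)} {g : GalSep F} :
    g ∈ T.kumKer s ↔ g ∈ T.inertia ∧ ∀ i ∉ s, T.kum i g = 0 := Iff.rfl

theorem kumKer_univ : T.kumKer Finset.univ = T.inertia := by
  ext g
  simp [mem_kumKer]

theorem kumKer_le_inertia (s : Finset (Fin d)) : T.kumKer s ≤ T.inertia := fun _ hg => hg.1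

theorem kumKer_empty_le (s : Finset (Fin d)) : T.kumKer ∅ ≤ T.kumKer s := fun _ hg =>
  ⟨hg.1, fun i _ => hg.2 i (Finset.notMem_empty i)⟩

theorem tau_mem_kumKer {s : Finset (Fin d)} {i : Fin d} (hi : i ∈ s) : T.tau i ∈ T.kumKer s :=
  ⟨T.tau_mem i, fun l hl => by
    rw [kum_tau, if_neg]
    rintro rfl
    exact hl hi⟩

theorem isClosed_kumKer (s : Finset (Fin d)) : IsClosed (T.kumKer s : Set (GalSep F)) := by
  have : (T.kumKer s : Set (GalSep F)) =
      (T.inertia : Set (GalSep F)) ∩ ⋂ i, ⋂ _ : i ∉ s, {g | T.kum i g = 0} := by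
    ext g
    simp [mem_kumKer]
  rw [this]
  exact T.isClosed_inertia.inter (isClosed_iInter fun i => isClosed_iInter fun _ =>
    isClosed_eq (T.continuous_kum i) continuous_const)

/-- Homomorphisms of `ℓ`-power order vanish where all Kummer cocycles vanish. -/
theorem eq_one_of_hom {K : Subgroup (GalSep F)} (hK : K ≤ T.kumKer ∅) {κ : GalSep F → SepUnits F}
    (hκ : IsLocallyConstant κ) (hm : ∀ g ∈ K, ∀ h ∈ K, κ (g * h) = κ g * κ h) {s : ℕ}
    (hs : ∀ g ∈ K, κ g ^ ℓ ^ s = 1) {g : GalSep F} (hg : g ∈ K) : κ g = 1 := by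
  obtain ⟨y, hy⟩ := exists_smul_div_eq_of_cocycle K hκ (fun g hg h hh => by
    rw [T.smul_eq_of_pow_eq_one (hK hg).1 (hs h hh), hm g hg h hh, mul_comm])
  have h1 := T.smul_eq_of_kum_eq_zero (hK hg).1 (fun i => (hK hg).2 i (Finset.notMem_empty i))
    (y := y) (s := s) (by rw [← hy g hg, hs g hg])
  rw [hy g hg, h1, div_self']

/-- Homomorphisms of `ℓ`-power order on `kumKer s` are combinations of Kummer cocycles. -/
theorem exists_eq_ex_sum {s : Finset (Fin d)} {κ : GalSep F → SepUnits F}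
    (hκ : IsLocallyConstant κ) (hm : ∀ g ∈ T.kumKer s, ∀ h ∈ T.kumKer s, κ (g * h) = κ g * κ h)
    {t : ℕ} (ht : ∀ g ∈ T.kumKer s, κ g ^ ℓ ^ t = 1) :
    ∃ e : Fin d → ℤ, ∀ g ∈ T.kumKer s, κ g = T.ex t (∑ i, (e i : ℤ_[ℓ]) * T.kum i g) := by
  have hex : ∀ i, ∃ e : ℤ, i ∈ s → κ (T.tau i) = T.zeta t ^ e := by
    intro i
    by_cases hi : i ∈ s
    · obtain ⟨k, hk⟩ := exists_zpow_eq (T := T) (ht _ (tau_mem_kumKer hi))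
      exact ⟨k, fun _ => hk⟩
    · exact ⟨0, fun h => absurd h hi⟩
  choose e he using hex
  refine ⟨e, ?_⟩
  set ε : GalSep F → SepUnits F := fun g => T.ex t (∑ i, (e i : ℤ_[ℓ]) * T.kum i g) with hε
  have hεm : ∀ g ∈ T.inertia, ∀ h, ε (g * h) = ε g * ε h := by
    intro g hg h
    simp only [hε, ← ex_add, ← Finset.sum_add_distrib, ← mul_add, T.kum_mul_of_mem hg]
  have hεc : IsLocallyConstant ε := isLocallyConstant_ex
    (continuous_finsetSum _ fun i _ => continuous_const.mul (T.continuous_kum i)) t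
  set κ' : GalSep F → SepUnits F := fun g => κ g / ε g with hκ'
  have hκ'c : IsLocallyConstant κ' := hκ.div hεc
  have hκ'm : ∀ g ∈ T.kumKer s, ∀ h ∈ T.kumKer s, κ' (g * h) = κ' g * κ' h := by
    intro g hg h hh
    simp only [hκ', hm g hg h hh, hεm g hg.1 h, mul_div_mul_comm]
  have hκ't : ∀ g ∈ T.kumKer s, κ' g ^ ℓ ^ t = 1 := by
    intro g hg
    simp only [hκ', hε, div_pow, ht g hg, ex_pow_eq_one, div_one]
  have hκ'1 : κ' 1 = 1 := by simpa using hκ'm 1 (one_mem _) 1 (one_mem _)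
  have hκ'τ : ∀ i ∈ s, κ' (T.tau i) = 1 := by
    intro i hi
    simp only [hκ', hε, he i hi, kum_tau, div_eq_one]
    rw [Finset.sum_eq_single i (fun l _ hl => by rw [if_neg hl, mul_zero]) (by simp), if_pos rfl,
      mul_one, ex_intCast]
  -- `κ'` is trivial on the elements whose Kummer cocycles are sufficiently divisible
  obtain ⟨N, hN⟩ := exists_subset_nhds_of_isCompact'
    (V := fun N : ℕ => (T.kumKer s : Set (GalSep F)) ∩
      ⋂ i, {g | PadicInt.toZModPow N (T.kum i g) = 0})
    (Antitone.directed_ge fun M N hMN g hg => ⟨hg.1, Set.mem_iInter.2 fun i => by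
      have := Set.mem_iInter.1 hg.2 i
      rw [Set.mem_ofPred_eq, ← map_zero (PadicInt.toZModPow _), PadicInt.toZModPow_eq_iff] at this ⊢
      exact (pow_dvd_pow _ hMN).trans this⟩)
    (fun N => ((isClosed_kumKer s).inter (isClosed_iInter fun i =>
      ((PadicInt.isLocallyConstant_toZModPow N).comp_continuous
        (T.continuous_kum i)).isClosed_fiber 0)).isCompact)
    (fun N => ((isClosed_kumKer s).inter (isClosed_iInter fun i =>
      ((PadicInt.isLocallyConstant_toZModPow N).comp_continuous
        (T.continuous_kum i)).isClosed_fiber 0)))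
    (U := {g | κ' g = 1}) (fun g hg => by
      have hg0 : g ∈ T.kumKer ∅ := by
        refine ⟨(Set.mem_iInter.1 hg 0).1.1, fun i _ => PadicInt.ext_of_toZModPow.1 fun N => ?_⟩
        rw [map_zero]
        exact Set.mem_iInter.1 (Set.mem_iInter.1 hg N).2 i
      refine (hκ'c.isOpen_fiber 1).mem_nhds ?_
      exact eq_one_of_hom le_rfl hκ'c (fun g hg h hh => hκ'm g (kumKer_empty_le s hg) h
        (kumKer_empty_le s hh)) (fun g hg => hκ't g (kumKer_empty_le s hg)) hg0)
  intro g hg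
  -- approximate `g` by a product of powers of the `tau i`
  set k : Fin d → ℕ := fun i => (PadicInt.toZModPow N (T.kum i g)).val with hk
  have hpow : ∀ i ∈ s, ∀ n : ℕ, κ' (T.tau i ^ n) = 1 ∧
      ∀ l, T.kum l (T.tau i ^ n) = if l = i then (n : ℤ_[ℓ]) else 0 := by
    intro i hi n
    induction n with
    | zero => simp [hκ'1, kum_one]
    | succ n ih =>
      refine ⟨?_, fun l => ?_⟩
      · rw [pow_succ, hκ'm _ (pow_mem (tau_mem_kumKer hi) n) _ (tau_mem_kumKer hi), ih.1,
          hκ'τ i hi, one_mul]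
      · rw [pow_succ, T.kum_mul_of_mem (pow_mem (T.tau_mem i) n), ih.2, kum_tau]
        split_ifs <;> simp
  have hprod : ∀ S : Finset (Fin d), S ⊆ s → ∃ p ∈ T.kumKer s, κ' p = 1 ∧
      ∀ l, T.kum l p = if l ∈ S then (k l : ℤ_[ℓ]) else 0 := by
    intro S
    induction S using Finset.induction_on with
    | empty => exact fun _ => ⟨1, one_mem _, hκ'1, fun l => by simp [kum_one]⟩
    | insert a S ha ih =>
      intro hS
      obtain ⟨p, hp, hp1, hpk⟩ := ih fun i hi => hS (Finset.mem_insert_of_mem hi)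
      have has : a ∈ s := hS (Finset.mem_insert_self a S)
      have hτ : T.tau a ^ k a ∈ T.kumKer s := pow_mem (tau_mem_kumKer has) _
      refine ⟨T.tau a ^ k a * p, mul_mem hτ hp, ?_, fun l => ?_⟩
      · rw [hκ'm _ hτ _ hp, (hpow a has _).1, hp1, one_mul]
      · rw [T.kum_mul_of_mem hτ.1, (hpow a has _).2, hpk]
        by_cases hla : l = a
        · subst hla
          simp [ha]
        · simp [hla]
  obtain ⟨p, hp, hp1, hpk⟩ := hprod s subset_rfl
  have hgp : g * p⁻¹ ∈ T.kumKer s := mul_mem hg (inv_mem hp)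
  have h1 : κ' (g * p⁻¹) = 1 := by
    refine hN ⟨hgp, Set.mem_iInter.2 fun i => ?_⟩
    have h2 := T.kum_mul_of_mem (i := i) hgp.1 p
    rw [inv_mul_cancel_right, hpk] at h2
    rw [Set.mem_ofPred_eq]
    by_cases hi : i ∈ s
    · rw [if_pos hi] at h2
      rw [eq_sub_of_add_eq h2.symm, map_sub, map_natCast, hk, ZMod.natCast_zmod_val, sub_self]
    · rw [hgp.2 i hi, map_zero]
  have h2 : κ' g = 1 := by
    rw [← inv_mul_cancel_right g p, hκ'm _ hgp _ hp, h1, hp1, one_mul]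
  exact div_eq_one.1 h2

/-! ### Cocycles of `ℓ`-power order on the kernel of all Kummer cocycles -/

/-- Every finite quotient of the kernel of all Kummer cocycles has order prime to `ℓ`. -/
theorem not_dvd_card_map (U : Subgroup (GalSep F)) [U.Normal] (hU : IsOpen (U : Set (GalSep F))) :
    ¬ ℓ ∣ Nat.card ((T.kumKer ∅).map (QuotientGroup.mk' U)) := by
  classical
  intro hdvd
  have hfin : Finite (GalSep F ⧸ U) := Subgroup.quotient_finite_of_isOpen U hU
  obtain ⟨⟨x, hx⟩, hord⟩ := exists_prime_orderOf_dvd_card' ℓ hdvd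
  rw [Subgroup.orderOf_mk] at hord
  obtain ⟨h, hh, rfl⟩ := hx
  set π := QuotientGroup.mk' U
  set w : GalSep F ⧸ U → SepUnits F := fun x =>
    if hx : ∃ k : ℤ, (π h) ^ k = x then T.zeta 1 ^ hx.choose else 1 with hw
  have hwk : ∀ k : ℤ, w (π h ^ k) = T.zeta 1 ^ k := by
    intro k
    have hx : ∃ k' : ℤ, (π h) ^ k' = π h ^ k := ⟨k, rfl⟩
    simp only [hw]
    rw [dif_pos hx, zpow_eq_zpow_iff_modEq, T.orderOf_zeta, pow_one, ← hord,
      ← zpow_eq_zpow_iff_modEq]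
    exact hx.choose_spec
  have hdisc : DiscreteTopology (GalSep F ⧸ U) := QuotientGroup.discreteTopology hU
  have hπ : IsLocallyConstant π := (IsLocallyConstant.iff_continuous _).2 continuous_quotient_mk'
  have hmem : ∀ g ∈ T.kumKer ∅ ⊓ (Subgroup.zpowers (π h)).comap π, ∃ k : ℤ, π h ^ k = π g :=
    fun g hg => hg.2
  have h1 := eq_one_of_hom (T := T) (K := T.kumKer ∅ ⊓ (Subgroup.zpowers (π h)).comap π)
    inf_le_left (hπ.comp w) (fun g hg g' hg' => by
      obtain ⟨k, hk⟩ := hmem g hg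
      obtain ⟨k', hk'⟩ := hmem g' hg'
      simp only [Function.comp_apply, map_mul, ← hk, ← hk', ← zpow_add, hwk]) (s := 1)
    (fun g hg => by
      obtain ⟨k, hk⟩ := hmem g hg
      rw [Function.comp_apply, ← hk, hwk, ← zpow_natCast, ← zpow_mul, mul_comm, zpow_mul,
        zpow_natCast, T.zeta_pow_eq_one, one_zpow])
    (g := h) ⟨hh, Subgroup.mem_zpowers _⟩
  have h2 := hwk 1
  rw [zpow_one, zpow_one] at h2
  rw [Function.comp_apply, h2] at h1
  have h3 := T.orderOf_zeta 1
  rw [h1, orderOf_one, pow_one] at h3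
  exact T.prime.one_lt.ne h3

/-- Cocycles of `ℓ`-power order split on the kernel of all Kummer cocycles. -/
theorem splitsOn_kumKer_empty {c : GalSep F × GalSep F → SepUnits F} (hc : IsLocallyConstant c)
    (hcoc : CocycleOn (T.kumKer ∅) c) {s : ℕ} (hs : ∀ p, c p ^ ℓ ^ s = 1) :
    SplitsOn (T.kumKer ∅) c := by
  obtain ⟨U, hUn, hUo, hU⟩ := hc.exists_openNormalSubgroup₂
  have hfin : Finite (GalSep F ⧸ U) := Subgroup.quotient_finite_of_isOpen U hUo
  set P := (T.kumKer ∅).map (QuotientGroup.mk' U)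
  have := Fintype.ofFinite P
  have hcop : IsCoprime ((Nat.card P : ℕ) : ℤ) ((ℓ ^ s : ℕ) : ℤ) := by
    rw [Nat.isCoprime_iff_coprime]
    exact Nat.Coprime.pow_right s
      ((Nat.Prime.coprime_iff_not_dvd T.prime).2 (not_dvd_card_map U hUo)).symm
  choose rep hrep hrepπ using fun x : P => x.2
  -- averaging over the finite quotient
  set f : GalSep F → SepUnits F := fun g => ∏ x : P, c (g, rep x) with hf
  have hfc : IsLocallyConstant f := by
    have : IsLocallyConstant (∏ x : P, fun g => c (g, rep x)) :=
      Finset.prod_induction (fun (x : P) g => c (g, rep x)) IsLocallyConstant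
        (fun _ _ h h' => h.mul h') (IsLocallyConstant.const 1)
        (fun x _ => hc.comp_continuous (by fun_prop))
    convert this using 1
    funext g
    simp [hf]
  have hft : ∀ g, f g ^ ℓ ^ s = 1 := fun g => by
    simp only [hf]
    rw [← Finset.prod_pow]
    exact Finset.prod_eq_one fun x _ => hs _
  have hm : SplitsOn (T.kumKer ∅) (c ^ Nat.card P) := by
    refine ⟨f, hfc, fun g hg h hh => ?_⟩
    have h1 : ∏ x : P, c (g, h * rep x) = f g := by
      simp only [hf]
      have hπh : QuotientGroup.mk' U h ∈ P := ⟨h, hh, rfl⟩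
      rw [← Equiv.prod_comp (Equiv.mulLeft (⟨QuotientGroup.mk' U h, hπh⟩ : P))
        (fun x => c (g, rep x))]
      refine Finset.prod_congr rfl fun x _ => ?_
      set x' := Equiv.mulLeft (⟨QuotientGroup.mk' U h, hπh⟩ : P) x
      have h2 : (QuotientGroup.mk' U) (rep x') = QuotientGroup.mk' U (h * rep x) := by
        rw [hrepπ, map_mul, hrepπ]
        rfl
      have h3 : (rep x')⁻¹ * (h * rep x) ∈ U := QuotientGroup.eq.1 h2
      have h4 := hU g (rep x') 1 U.one_mem _ h3
      rw [mul_one, mul_inv_cancel_left] at h4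
      exact h4
    have h2 : f (g * h) * c (g, h) ^ Nat.card P = f h * f g := by
      have h3 : c (g, h) ^ Nat.card P = ∏ _x : P, c (g, h) := by
        rw [Finset.prod_const, Finset.card_univ, Nat.card_eq_fintype_card]
      rw [h3, ← h1, hf, ← Finset.prod_mul_distrib, ← Finset.prod_mul_distrib]
      refine Finset.prod_congr rfl fun x _ => ?_
      rw [hcoc g hg h hh _ (hrep x), T.smul_eq_of_pow_eq_one hg.1 (hs _)]
    rw [Pi.pow_apply, coboundary, T.smul_eq_of_pow_eq_one hg.1 (hft h), div_mul_eq_mul_div, ← h2,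
      mul_div_cancel_left]
  obtain ⟨a, b, hab⟩ := hcop
  refine (hm.zpow a).congr fun g _ h _ => ?_
  change _ = (c (g, h) ^ Nat.card P) ^ a
  rw [← zpow_natCast, ← zpow_mul]
  conv_lhs => rw [← zpow_one (c (g, h)), ← hab, zpow_add, zpow_mul' _ b, zpow_natCast, hs, one_zpow,
    mul_one, mul_comm a]

end KummerFrame

/-- The exponent of the prime `ℓ` in `2`. -/
def twoExp (ℓ : ℕ) : ℕ := if ℓ = 2 then 1 else 0

namespace KummerFrame

open Matrix

variable {F : Type*} [Field F] {ℓ q d : ℕ} (T : KummerFrame F ℓ q d) [Fact ℓ.Prime]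

/-! ### The symbol cocycles -/

/-- The vector of all Kummer cocycles. -/
def kumVec (g : GalSep F) : Fin d → ℤ_[ℓ] := fun i => T.kum i g

/-- The 2-cochain `∏ᵢₗ ζ ^ (Mᵢₗ aᵢ(g) aₗ(h))`, where `ζ` is a primitive root of unity of order
`ℓ ^ s` and the `aᵢ` are the Kummer cocycles. -/
def sym (s : ℕ) (M : Matrix (Fin d) (Fin d) ℤ_[ℓ]) : GalSep F × GalSep F → SepUnits F :=
  fun p => T.ex s (T.kumVec p.1 ⬝ᵥ M *ᵥ T.kumVec p.2)

variable {T}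

theorem kumVec_mul (g h : GalSep F) :
    T.kumVec (g * h) = T.kumVec g + T.cyc g • T.kumVec h := by
  funext i
  exact T.kum_mul i g h

theorem kumVec_mul_of_mem {g : GalSep F} (hg : g ∈ T.inertia) (h : GalSep F) :
    T.kumVec (g * h) = T.kumVec g + T.kumVec h := by
  rw [kumVec_mul, T.cyc_inertia hg, one_smul]

theorem kumVec_tau (i : Fin d) : T.kumVec (T.tau i) = Pi.single i 1 := by
  funext l
  rw [kumVec, kum_tau, Pi.single_apply]

theorem continuous_kumVec : Continuous T.kumVec := continuous_pi T.continuous_kum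

theorem isLocallyConstant_sym (s : ℕ) (M : Matrix (Fin d) (Fin d) ℤ_[ℓ]) :
    IsLocallyConstant (T.sym s M) :=
  isLocallyConstant_ex ((continuous_kumVec.comp continuous_fst).dotProduct
    (continuous_const.matrix_mulVec (continuous_kumVec.comp continuous_snd))) s

theorem sym_add (s : ℕ) (M N : Matrix (Fin d) (Fin d) ℤ_[ℓ]) :
    T.sym s (M + N) = T.sym s M * T.sym s N := by
  funext p
  simp only [sym, add_mulVec, dotProduct_add, ex_add, Pi.mul_apply]

theorem sym_sub (s : ℕ) (M N : Matrix (Fin d) (Fin d) ℤ_[ℓ]) :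
    T.sym s (M - N) = T.sym s M / T.sym s N := by
  funext p
  simp only [sym, sub_mulVec, dotProduct_sub, ex_sub, Pi.div_apply]

theorem sym_pow_smul (s t : ℕ) (M : Matrix (Fin d) (Fin d) ℤ_[ℓ]) :
    T.sym (s + t) ((ℓ : ℤ_[ℓ]) ^ t • M) = T.sym s M := by
  funext p
  simp only [sym, smul_mulVec, dotProduct_smul, smul_eq_mul, ex_pow_mul]

theorem sym_pow_eq_one (s : ℕ) (M : Matrix (Fin d) (Fin d) ℤ_[ℓ]) (p : GalSep F × GalSep F) :
    T.sym s M p ^ ℓ ^ s = 1 := ex_pow_eq_one s _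

theorem cocycleOn_sym (s : ℕ) (M : Matrix (Fin d) (Fin d) ℤ_[ℓ]) :
    CocycleOn T.inertia (T.sym s M) := by
  intro g hg h hh j _
  rw [T.smul_eq_of_pow_eq_one hg (sym_pow_eq_one s M _)]
  simp only [sym, ← ex_add, kumVec_mul_of_mem hg, kumVec_mul_of_mem hh, add_dotProduct,
    mulVec_add, dotProduct_add]
  congr 1
  ring

variable (T) in
include T in
/-- Half of an `ℓ`-adic exponent, at the cost of raising the order of the root of unity. -/
theorem exists_half (s : ℕ) :
    ∃ u : ℤ_[ℓ], ∀ z, T.ex (s + twoExp ℓ) (2 * (u * z)) = T.ex s z := by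
  rcases T.prime.eq_two_or_odd' with h2 | hodd
  · refine ⟨1, fun z => ?_⟩
    rw [twoExp, if_pos h2]
    have h3 := ex_pow_mul (T := T) s 1 z
    have h4 : (ℓ : ℤ_[ℓ]) = 2 := by
      rw [← Nat.cast_ofNat (R := ℤ_[ℓ]), ← h2]
    rw [pow_one, h4] at h3
    rw [one_mul, h3]
  · obtain ⟨m, hm⟩ := hodd.pow (n := s)
    have h2 : ℓ ≠ 2 := by
      rintro rfl
      exact Nat.not_odd_iff_even.2 even_two hodd
    rw [twoExp, if_neg h2]
    refine ⟨((m + 1 : ℕ) : ℤ_[ℓ]), fun z => ?_⟩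
    have h1 : (2 : ℤ_[ℓ]) * (((m + 1 : ℕ) : ℤ_[ℓ]) * z) = z + ((ℓ ^ s : ℕ) : ℤ_[ℓ]) * z := by
      rw [hm]
      push_cast
      ring
    rw [add_zero, h1, ex_add, ex_natCast_mul, ex_pow_eq_one, mul_one]

/-- Symmetric symbols split on inertia: a primitive of the symbol is half of its quadratic form. -/
theorem splitsOn_sym_of_isSymm (s : ℕ) {M : Matrix (Fin d) (Fin d) ℤ_[ℓ]} (hM : M.IsSymm) :
    SplitsOn T.inertia (T.sym s M) := by
  obtain ⟨u, hu⟩ := T.exists_half s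
  refine ⟨fun g => T.ex (s + twoExp ℓ) (-(u * (T.kumVec g ⬝ᵥ M *ᵥ T.kumVec g))),
      isLocallyConstant_ex
    (continuous_const.mul (continuous_kumVec.dotProduct
      (continuous_const.matrix_mulVec continuous_kumVec))).neg _, fun g hg h _ => ?_⟩
  have hsymm : T.kumVec h ⬝ᵥ M *ᵥ T.kumVec g = T.kumVec g ⬝ᵥ M *ᵥ T.kumVec h := by
    rw [dotProduct_mulVec, ← mulVec_transpose, hM.eq, dotProduct_comm]
  rw [coboundary, T.smul_eq_of_pow_eq_one hg (ex_pow_eq_one _ _), ← ex_sub, ← ex_add, sym, ← hu]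
  congr 1
  simp only [kumVec_mul_of_mem hg, add_dotProduct, mulVec_add, dotProduct_add, hsymm]
  ring

/-- A symbol which splits on inertia is symmetric. -/
theorem dvd_sub_of_splitsOn_sym {s : ℕ} {M : Matrix (Fin d) (Fin d) ℤ_[ℓ]}
    (h : SplitsOn T.inertia (T.sym s M)) (i l : Fin d) : (ℓ : ℤ_[ℓ]) ^ s ∣ M i l - M l i := by
  have hroot : ∀ x : SepUnits F, ∃ y, y ^ ℓ ^ s = x := by
    intro x
    obtain ⟨S, hS, hd⟩ := exists_dvd_pow_sub_one (pow_pos T.prime.pos s) (T.coprime.pow_right s)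
    exact T.exists_root S hS _ hd x
  obtain ⟨f, hf, hft, hsf⟩ := h.exists_pow_eq_one hroot (fun g _ h _ => sym_pow_eq_one s M (g, h))
  have hadd : ∀ g ∈ T.inertia, ∀ h ∈ T.inertia, T.sym s M (g, h) * f (g * h) = f h * f g := by
    intro g hg h hh
    rw [hsf g hg h hh, coboundary, T.smul_eq_of_pow_eq_one hg (hft h hh), div_mul_eq_mul_div,
      div_mul_cancel]
  have hzero : ∀ g, ∀ h ∈ T.kumKer ∅, T.sym s M (g, h) = 1 := by
    intro g h hh
    have h0 : T.kumVec h = 0 := funext fun i => hh.2 i (Finset.notMem_empty i)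
    simp [sym, h0]
  have hf1 : ∀ g ∈ T.kumKer ∅, f g = 1 := by
    intro g hg
    refine eq_one_of_hom le_rfl hf (fun g hg h hh => ?_) (fun g hg => hft g hg.1) hg
    have := hadd g hg.1 h hh.1
    rwa [hzero g h hh, one_mul, mul_comm (f h)] at this
  have hx := T.tau_mem i
  have hy := T.tau_mem l
  set x := T.tau i
  set y := T.tau l
  -- the commutator of `x` and `y` is killed by all Kummer cocycles
  have hcomm : (y * x)⁻¹ * (x * y) ∈ T.kumKer ∅ := by
    refine ⟨mul_mem (inv_mem (mul_mem hy hx)) (mul_mem hx hy), fun j _ => ?_⟩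
    have h1 := T.kum_mul_of_mem (i := j) (mul_mem hy hx) ((y * x)⁻¹ * (x * y))
    rw [mul_inv_cancel_left, T.kum_mul_of_mem hx, T.kum_mul_of_mem hy] at h1
    linear_combination -h1
  have h1 : f (x * y) = f (y * x) := by
    have := hadd (y * x) (mul_mem hy hx) _ hcomm.1
    rwa [hzero _ _ hcomm, one_mul, mul_inv_cancel_left, hf1 _ hcomm, one_mul] at this
  have h2 : T.sym s M (x, y) = T.sym s M (y, x) := by
    have h3 := hadd x hx y hy
    rw [mul_comm (f y), ← hadd y hy x hx, h1] at h3
    exact mul_right_cancel h3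
  simp only [sym, x, y, kumVec_tau, single_one_dotProduct, mulVec_single_one] at h2
  rw [ex_eq_iff, PadicInt.toZModPow_eq_iff] at h2
  exact h2

/-! ### Brauer classes over the maximal unramified extension -/

/-- Over the maximal unramified extension every cocycle of `ℓ`-power order is cohomologous to a
symbol. The cocycle is split on larger and larger subgroups of inertia by adding a Kummer cocycle at
a time. -/
theorem exists_splitsOn_div_sym {c : GalSep F × GalSep F → SepUnits F} (hc : IsLocallyConstant c)
    (hcoc : CocycleOn T.inertia c) {s : ℕ} (hs : ∀ p, c p ^ ℓ ^ s = 1) :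
    ∃ (t : ℕ) (M : Matrix (Fin d) (Fin d) ℤ_[ℓ]), SplitsOn T.inertia (c / T.sym t M) := by
  suffices h : ∀ S : Finset (Fin d), ∃ (t : ℕ) (M : Matrix (Fin d) (Fin d) ℤ_[ℓ]),
      SplitsOn (T.kumKer S) (c / T.sym t M) by
    have := h Finset.univ
    rwa [kumKer_univ] at this
  intro S
  induction S using Finset.induction_on with
  | empty =>
    refine ⟨0, 0, ?_⟩
    have h1 := splitsOn_kumKer_empty hc (hcoc.mono (kumKer_le_inertia ∅)) hs
    refine h1.congr fun g _ h _ => ?_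
    simp [sym]
  | insert a S ha ih =>
    obtain ⟨t, M, hM⟩ := ih
    set c' := c / T.sym t M
    have hc' : IsLocallyConstant c' := hc.div (isLocallyConstant_sym t M)
    have hcoc' : CocycleOn (T.kumKer (insert a S)) c' :=
      (hcoc.div (cocycleOn_sym t M)).mono (kumKer_le_inertia _)
    -- the cocycle already splits where the new Kummer cocycle vanishes modulo some `ℓ ^ N`
    have hZ : ∀ N, IsLocallyConstant fun g => PadicInt.toZModPow N (T.kum a g) := fun N =>
      (PadicInt.isLocallyConstant_toZModPow N).comp_continuous (T.continuous_kum a)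
    let V : ℕ → Subgroup (GalSep F) := fun N =>
      { carrier := {g | g ∈ T.kumKer (insert a S) ∧ PadicInt.toZModPow N (T.kum a g) = 0}
        one_mem' := ⟨one_mem _, by rw [kum_one, map_zero]⟩
        mul_mem' := fun hx hy => ⟨mul_mem hx.1 hy.1, by
          rw [T.kum_mul_of_mem hx.1.1, map_add, hx.2, hy.2, add_zero]⟩
        inv_mem' := fun {x} hx => ⟨inv_mem hx.1, by
          have h1 := T.kum_mul_of_mem (i := a) hx.1.1 x⁻¹
          rw [mul_inv_cancel, kum_one] at h1
          rw [eq_neg_of_add_eq_zero_right h1.symm, map_neg, hx.2, neg_zero]⟩ }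
    have hanti : Antitone fun N => (V N : Set (GalSep F)) := by
      intro N N' hNN g hg
      refine ⟨hg.1, ?_⟩
      have h2 := hg.2
      rw [← map_zero (PadicInt.toZModPow _), PadicInt.toZModPow_eq_iff] at h2 ⊢
      exact (pow_dvd_pow _ hNN).trans h2
    obtain ⟨N, hN⟩ := hM.exists_of_directed (V := V) hanti.directed_ge
      (fun N => (isClosed_kumKer _).inter ((hZ N).isClosed_fiber 0)) (fun g hg => by
        refine ⟨(hg 0).1.1, fun i hi => ?_⟩
        by_cases hia : i = a
        · subst hia
          exact PadicInt.ext_of_toZModPow.1 fun N => by rw [map_zero, (hg N).2]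
        · exact (hg 0).1.2 i (by simp [hi, hia])) hc'
    have hNe : NeZero (ℓ ^ N) := ⟨pow_ne_zero _ T.prime.ne_zero⟩
    obtain ⟨α, hα, hsplit⟩ := SplitsOn.exists_carry (K' := V N) hc' hcoc' (hZ N)
      (fun g hg h _ => by rw [T.kum_mul_of_mem hg.1, map_add]) (fun g => Iff.rfl)
      (tau_mem_kumKer (Finset.mem_insert_self a S))
      (by rw [kum_tau, if_pos rfl, map_one]) hN
    -- the cyclic algebra is a symbol
    obtain ⟨S', hS', hd⟩ := exists_dvd_pow_sub_one (pow_pos T.prime.pos N) (T.coprime.pow_right N)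
    obtain ⟨y, rfl⟩ := T.exists_root S' hS' _ hd α
    have hyt : ∀ g ∈ T.kumKer (insert a S), (g • y / y) ^ ℓ ^ N = 1 := fun g hg => by
      rw [div_pow, ← smul_pow', hα g hg, div_self']
    obtain ⟨e, he⟩ := exists_eq_ex_sum (T := T) (s := insert a S) (κ := fun g => g • y / y)
      ((isLocallyConstant_galSep_smul y).comp (· / y)) (fun g hg h hh => by
        have h1 := T.smul_eq_of_pow_eq_one hg.1 (hyt h hh)
        rw [smul_div', ← mul_smul] at h1
        rw [← h1, mul_comm, div_mul_div_cancel]) hyt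
    set M' : Matrix (Fin d) (Fin d) ℤ_[ℓ] := fun i l => if i = a then (e l : ℤ_[ℓ]) else 0
    have hM' : SplitsOn (T.kumKer (insert a S)) ((fun p : GalSep F × GalSep F =>
        (y ^ ℓ ^ N) ^ carry (PadicInt.toZModPow N (T.kum a p.1))
          (PadicInt.toZModPow N (T.kum a p.2))) / T.sym N M') := by
      refine ⟨fun g => (g • y) ^ (PadicInt.toZModPow N (T.kum a g)).val,
        ((isLocallyConstant_galSep_smul y).prodMk (hZ N)).comp (fun p => p.1 ^ p.2.val),
        fun g hg h hh => ?_⟩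
      have h1 := cup_smul_div_mul_coboundary (χ := fun g => PadicInt.toZModPow N (T.kum a g))
        (y := y) (g := g) (h := h) (by rw [T.kum_mul_of_mem hg.1, map_add])
        (hα _ (mul_mem hg hh))
      rw [Pi.div_apply, div_eq_iff_eq_mul, ← h1, mul_comm]
      congr 1
      rw [T.smul_eq_of_pow_eq_one hg.1 (hyt h hh), he h hh, sym]
      have h2 : T.kumVec g ⬝ᵥ M' *ᵥ T.kumVec h =
          T.kum a g * ∑ i, (e i : ℤ_[ℓ]) * T.kum i h := by
        simp only [dotProduct, mulVec, M']
        rw [Finset.sum_eq_single a (fun i _ hi => by simp [hi]) (by simp)]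
        simp [kumVec]
      rw [h2, ← ex_natCast_mul, ex_eq_iff, map_mul, map_mul, map_natCast, ZMod.natCast_zmod_val]
    refine ⟨t + N, (ℓ : ℤ_[ℓ]) ^ N • M + (ℓ : ℤ_[ℓ]) ^ t • M', ?_⟩
    rw [sym_add, sym_pow_smul, add_comm t N, sym_pow_smul, ← div_div]
    exact hsplit.trans_div hM'

variable (T) in
include T in
theorem exists_inv_q : ∃ u : ℤ_[ℓ], q * u = 1 := by
  have : IsUnit (q : ℤ_[ℓ]) := by
    rw [PadicInt.isUnit_iff]
    exact PadicInt.norm_natCast_eq_one_iff.2 (Nat.Coprime.symm T.coprime)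
  exact this.exists_right_inv

/-- The conjugate of a cocycle by an element of the Galois group is cohomologous to it. -/
theorem splitsOn_conj_div {K : Subgroup (GalSep F)}
    {c : GalSep F × GalSep F → SepUnits F} (hc : IsLocallyConstant c) (hcoc : CocycleOn ⊤ c)
    (σ : GalSep F) :
    SplitsOn K ((fun p => σ • c (σ⁻¹ * p.1 * σ, σ⁻¹ * p.2 * σ)) / c) := by
  refine ⟨fun n => c (σ, σ⁻¹ * n * σ) / c (n, σ),
    (hc.comp_continuous (by fun_prop)).div (hc.comp_continuous (by fun_prop)),
    fun n' _ m' _ => ?_⟩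
  set n := σ⁻¹ * n' * σ with hn
  set m := σ⁻¹ * m' * σ with hm
  have e1 : n' * σ = σ * n := by rw [hn]; group
  have e2 : m' * σ = σ * m := by rw [hm]; group
  have e3 : σ⁻¹ * (n' * m') * σ = n * m := by rw [hn, hm]; group
  have i1 := hcoc σ trivial n trivial m trivial
  have i2 := hcoc n' trivial σ trivial m trivial
  have i3 := hcoc n' trivial m' trivial σ trivial
  rw [e1] at i2
  rw [e2] at i3
  simp only [coboundary, Pi.div_apply, e3, ← hn, ← hm, smul_div']
  rw [div_div_div_eq, div_mul_div_comm, div_eq_div_iff_mul_eq_mul]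
  calc σ • c (n, m) * (n' • c (m', σ) * c (σ, n * m) * c (n', σ))
      = (σ • c (n, m) * c (σ, n * m)) * n' • c (m', σ) * c (n', σ) := by ac_rfl
    _ = c (σ * n, m) * c (σ, n) * n' • c (m', σ) * c (n', σ) := by rw [← i1]
    _ = (c (σ * n, m) * c (n', σ)) * c (σ, n) * n' • c (m', σ) := by ac_rfl
    _ = n' • c (σ, m) * c (σ, n) * (n' • c (m', σ) * c (n', σ * m)) := by rw [i2]; ac_rfl
    _ = n' • c (σ, m) * c (σ, n) * (c (n' * m', σ) * c (n', m')) := by rw [i3]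
    _ = _ := by ac_rfl

/-- The symbol over the maximal unramified extension of a class defined over the base is invariant
under Frobenius. -/
theorem dvd_mul_sub_of_splitsOn {c : GalSep F × GalSep F → SepUnits F} (hc : IsLocallyConstant c)
    (hcoc : CocycleOn ⊤ c) {s : ℕ} {M : Matrix (Fin d) (Fin d) ℤ_[ℓ]}
    (h : SplitsOn T.inertia (c / T.sym s M)) (i l : Fin d) :
    (ℓ : ℤ_[ℓ]) ^ s ∣ (q - 1) * (M i l - M l i) := by
  obtain ⟨u, hu⟩ := T.exists_inv_q
  have hconj := splitsOn_conj_div (K := T.inertia) hc hcoc T.frob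
  have hmem : ∀ g ∈ T.inertia, T.frob⁻¹ * g * T.frob ∈ T.inertia := fun g hg => by
    have := Subgroup.Normal.conj_mem (inferInstance : T.inertia.Normal) g hg T.frob⁻¹
    rwa [inv_inv] at this
  -- the conjugate of the coboundary comparing `c` with the symbol
  have h1 : SplitsOn T.inertia (fun p => T.frob •
      (c / T.sym s M) (T.frob⁻¹ * p.1 * T.frob, T.frob⁻¹ * p.2 * T.frob)) := by
    obtain ⟨f, hf, hsf⟩ := h
    refine ⟨fun g => T.frob • f (T.frob⁻¹ * g * T.frob), (IsLocallyConstant.galSep_smul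
      continuous_const (hf.comp_continuous (by fun_prop))), fun g hg h hh => ?_⟩
    simp only [hsf _ (hmem g hg) _ (hmem h hh), coboundary, smul_mul', smul_div', ← mul_smul]
    rw [show T.frob⁻¹ * g * T.frob * (T.frob⁻¹ * h * T.frob) = T.frob⁻¹ * (g * h) * T.frob by group,
      show T.frob * (T.frob⁻¹ * g * T.frob) = g * T.frob by group]
  have hkum : ∀ g ∈ T.inertia, T.kumVec (T.frob⁻¹ * g * T.frob) = u • T.kumVec g := by
    intro g hg
    funext i
    have h2 := T.kum_conj_frob i (hmem g hg)
    rw [show T.frob * (T.frob⁻¹ * g * T.frob) * T.frob⁻¹ = g by group] at h2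
    simp only [kumVec, Pi.smul_apply, smul_eq_mul, h2, ← mul_assoc]
    rw [mul_comm u, hu, one_mul]
  have h3 : SplitsOn T.inertia (T.sym s ((u - 1) • M)) := by
    refine ((hconj.div h1).mul h).congr fun g hg h hh => ?_
    have h4 : T.frob • T.sym s M (T.frob⁻¹ * g * T.frob, T.frob⁻¹ * h * T.frob) =
        T.sym s (u • M) (g, h) := by
      simp only [sym, hkum g hg, hkum h hh, smul_ex, T.cyc_frob, smul_dotProduct, mulVec_smul,
        dotProduct_smul, smul_mulVec, smul_eq_mul]
      rw [← mul_assoc, ← mul_assoc, hu, one_mul]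
    simp only [Pi.mul_apply, Pi.div_apply, smul_div', h4, sub_smul, one_smul, sym_sub]
    rw [div_div_div_cancel_left, div_mul_div_cancel]
  have h5 := dvd_sub_of_splitsOn_sym h3 i l
  have h6 : (q - 1) * (M i l - M l i) = (-q) * (((u - 1) • M) i l - ((u - 1) • M) l i) := by
    simp only [Matrix.smul_apply, smul_eq_mul]
    linear_combination (M i l - M l i) * hu
  rw [h6]
  exact Dvd.dvd.mul_left h5 _

/-- Over the maximal unramified extension, a class of `ℓ`-power order defined over the base is a
strictly upper triangular symbol of exponent `ℓ ^ v`, where `ℓ ^ v` is the `ℓ`-part of `q - 1`. -/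
theorem exists_strictUpper_splitsOn {v : ℕ} {u : ℤ_[ℓ]} (hu : IsUnit u)
    (hv : (q : ℤ_[ℓ]) - 1 = ℓ ^ v * u) {c : GalSep F × GalSep F → SepUnits F}
    (hc : IsLocallyConstant c) (hcoc : CocycleOn ⊤ c) {s : ℕ} (hs : ∀ p, c p ^ ℓ ^ s = 1) :
    ∃ M : Matrix (Fin d) (Fin d) ℤ_[ℓ], (∀ i l, l ≤ i → M i l = 0) ∧
      SplitsOn T.inertia (c / T.sym v M) := by
  obtain ⟨t, M, hM⟩ := exists_splitsOn_div_sym (T := T) hc (hcoc.mono le_top) hs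
  set M₁ : Matrix (Fin d) (Fin d) ℤ_[ℓ] := (ℓ : ℤ_[ℓ]) ^ v • M with hM₁
  rw [← sym_pow_smul t v M, ← hM₁] at hM
  have hdvd : ∀ i l, (ℓ : ℤ_[ℓ]) ^ t ∣ M₁ i l - M₁ l i := by
    intro i l
    have h1 := dvd_mul_sub_of_splitsOn hc hcoc hM i l
    rw [hv, pow_add, mul_comm ((ℓ : ℤ_[ℓ]) ^ t), mul_assoc] at h1
    have h2 : (ℓ : ℤ_[ℓ]) ^ v ≠ 0 := pow_ne_zero _ (by exact_mod_cast T.prime.ne_zero)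
    exact (hu.dvd_mul_left).1 ((mul_dvd_mul_iff_left h2).1 h1)
  choose X hX using hdvd
  set M₂ : Matrix (Fin d) (Fin d) ℤ_[ℓ] := fun i l => if i < l then X i l else 0 with hM₂
  refine ⟨M₂, fun i l hil => if_neg (not_lt.2 hil), ?_⟩
  have hsymm : (M₁ - (ℓ : ℤ_[ℓ]) ^ t • M₂).IsSymm := by
    refine IsSymm.ext fun i l => ?_
    simp only [Matrix.sub_apply, Matrix.smul_apply, smul_eq_mul]
    simp only [hM₂]
    rcases lt_trichotomy i l with h | rfl | h
    · rw [if_pos h, if_neg (not_lt.2 h.le)]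
      linear_combination -(hX i l)
    · rfl
    · rw [if_pos h, if_neg (not_lt.2 h.le)]
      linear_combination hX l i
  have h1 := splitsOn_sym_of_isSymm (T := T) (t + v) hsymm
  rw [sym_sub, add_comm t v, sym_pow_smul, add_comm v t] at h1
  exact hM.trans_div h1

end KummerFrame

/-! ### Unramified cyclic algebras -/

theorem carry_assoc {N : ℕ} [NeZero N] (a b c : ZMod N) :
    carry (a + b) c + carry a b = carry b c + carry a (b + c) := by
  have h1 := val_add_add_carry (a + b) c
  have h2 := val_add_add_carry a b
  have h3 := val_add_add_carry b c
  have h4 := val_add_add_carry a (b + c)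
  rw [← add_assoc] at h4
  refine Nat.eq_of_mul_eq_mul_left (NeZero.pos N) ?_
  rw [mul_add, mul_add]
  omega

theorem carry_zero_left {N : ℕ} [NeZero N] (a : ZMod N) : carry 0 a = 0 := by
  rw [carry, ZMod.val_zero, zero_add, Nat.div_eq_of_lt a.val_lt]

namespace TameFrame

variable {F : Type*} [Field F] {ℓ q d : ℕ} (T : TameFrame F ℓ q d)

/-- The cocycle of the cyclic algebra attached to the unramified extension of degree `S`, its
Frobenius, and `α`. -/
def unram (S : ℕ) [NeZero S] (α : SepUnits F) : GalSep F × GalSep F → SepUnits F :=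
  fun p => α ^ carry (T.deg S p.1) (T.deg S p.2)

theorem isLocallyConstant_unram (S : ℕ) [NeZero S] (α : SepUnits F) :
    IsLocallyConstant (T.unram S α) :=
  (((T.isLocallyConstant_deg S).comp_continuous continuous_fst).prodMk
    ((T.isLocallyConstant_deg S).comp_continuous continuous_snd)).comp
      (fun p : ZMod S × ZMod S => α ^ carry p.1 p.2)

theorem cocycleOn_unram {S : ℕ} [NeZero S] {α : SepUnits F} (hα : ∀ g : GalSep F, g • α = α)
    (K : Subgroup (GalSep F)) : CocycleOn K (T.unram S α) := by
  intro g _ h _ j _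
  simp only [unram, smul_pow', hα, ← pow_add, deg_mul, carry_assoc]

theorem unram_mul (S : ℕ) [NeZero S] (α β : SepUnits F) :
    T.unram S (α * β) = T.unram S α * T.unram S β := by
  funext p
  exact mul_pow _ _ _

theorem unram_zpow (S : ℕ) [NeZero S] (α : SepUnits F) (e : ℤ) :
    T.unram S (α ^ e) = T.unram S α ^ e := by
  funext p
  change (α ^ e) ^ _ = (α ^ _) ^ e
  rw [← zpow_natCast, ← zpow_natCast, ← zpow_mul, ← zpow_mul, mul_comm]

theorem unram_one (S : ℕ) [NeZero S] : T.unram S 1 = 1 := by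
  funext p
  exact one_pow _

theorem unram_prod (S : ℕ) [NeZero S] {ι : Type*} (s : Finset ι) (α : ι → SepUnits F) :
    T.unram S (∏ i ∈ s, α i) = ∏ i ∈ s, T.unram S (α i) := by
  classical
  induction s using Finset.induction_on with
  | empty => simp [unram_one]
  | insert a s ha ih => rw [Finset.prod_insert ha, Finset.prod_insert ha, unram_mul, ih]

theorem splitsOn_unram_pow {S : ℕ} [NeZero S] {α : SepUnits F} (hα : ∀ g : GalSep F, g • α = α) :
    SplitsOn ⊤ (T.unram S (α ^ S)) := by
  refine ⟨fun g => α ^ (T.deg S g).val, (T.isLocallyConstant_deg S).comp fun a => α ^ a.val,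
    fun g _ h _ => ?_⟩
  have h1 := val_add_add_carry (T.deg S g) (T.deg S h)
  rw [← deg_mul] at h1
  simp only [unram, coboundary]
  rw [smul_pow', hα, ← pow_mul, div_mul_eq_mul_div, eq_div_iff_mul_eq', ← pow_add, ← pow_add,
    add_comm (S * _), h1, add_comm]

/-- Enlarging the degree of the unramified extension by the factor `e` divides the class of the
cyclic algebra by `e`. -/
theorem splitsOn_unram_mul {N e : ℕ} [NeZero N] [NeZero (N * e)] {α : SepUnits F}
    (hα : ∀ g : GalSep F, g • α = α) :
    SplitsOn ⊤ (T.unram (N * e) α ^ e / T.unram N α) := by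
  refine ⟨fun g => α ^ ((T.deg (N * e) g).val / N),
    (T.isLocallyConstant_deg (N * e)).comp fun a => α ^ (a.val / N), fun g _ h _ => ?_⟩
  have hmod : ∀ g, (T.deg N g).val = (T.deg (N * e) g).val % N := by
    intro g
    rw [← T.cast_deg (dvd_mul_right N e), ZMod.castHom_apply, ZMod.cast_eq_val, ZMod.val_natCast]
  have h1 := val_add_add_carry (T.deg (N * e) g) (T.deg (N * e) h)
  have h2 := val_add_add_carry (T.deg N g) (T.deg N h)
  rw [← deg_mul, hmod, hmod g, hmod h] at h2
  rw [← deg_mul] at h1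
  simp only [Pi.div_apply, Pi.pow_apply, unram, coboundary]
  rw [smul_pow', hα, ← pow_mul, div_mul_eq_mul_div, ← pow_add, div_eq_div_iff_mul_eq_mul, ←
    pow_add, ← pow_add]
  congr 1
  refine Nat.eq_of_mul_eq_mul_left (NeZero.pos N) ?_
  have e1 := Nat.mod_add_div (T.deg (N * e) g).val N
  have e2 := Nat.mod_add_div (T.deg (N * e) h).val N
  have e3 := Nat.mod_add_div (T.deg (N * e) (g * h)).val N
  rw [mul_add, mul_add, mul_add]
  have e4 : N * (carry (T.deg (N * e) g) (T.deg (N * e) h) * e) =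
      N * e * carry (T.deg (N * e) g) (T.deg (N * e) h) := by ring
  omega

/-- Unramified cyclic algebras attached to roots of unity split: roots of unity of order prime to
the residue characteristic are norms from unramified extensions. -/
theorem splitsOn_unram_of_pow_eq_one {S : ℕ} [NeZero S] {w : SepUnits F} (hw : w ^ (q - 1) = 1) :
    SplitsOn ⊤ (T.unram S w) := by
  set b : ℕ → ℕ := fun k => ∑ i ∈ Finset.range k, q ^ i with hb
  have hq : q - 1 + 1 = q := Nat.sub_add_cancel T.one_lt.le
  have hbS : b S * (q - 1) = q ^ S - 1 := by
    have := geom_sum_mul_add (q - 1) S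
    rw [hq] at this
    exact (Nat.sub_eq_of_eq_add this.symm).symm
  have hbadd : ∀ k j, b (k + j) = b k + q ^ k * b j := by
    intro k j
    simp only [hb, Finset.sum_range_add, Finset.mul_sum, pow_add]
  obtain ⟨η, rfl⟩ := T.exists_root S (NeZero.pos S) (b S) ⟨q - 1, hbS.symm⟩ w
  have hη : η ^ (q ^ S - 1) = 1 := by rw [← hbS, pow_mul, hw]
  have hwq : ∀ k, (η ^ b S) ^ q ^ k = η ^ b S := by
    intro k
    induction k with
    | zero => simp
    | succ k ih =>
      rw [pow_succ, pow_mul, ih]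
      conv_lhs => rw [← hq, pow_succ, hw, one_mul]
  have hbt : ∀ k t, η ^ b (k + S * t) = η ^ b k * (η ^ b S) ^ t := by
    intro k t
    induction t with
    | zero => simp
    | succ t ih =>
      rw [mul_add, mul_one, ← add_assoc, hbadd, pow_add, ih, mul_comm (q ^ _), pow_mul, hwq,
        pow_succ, mul_assoc]
  refine ⟨fun g => η ^ b (T.deg S g).val,
    (T.isLocallyConstant_deg S).comp fun a => η ^ b a.val, fun g _ h _ => ?_⟩
  have h1 := val_add_add_carry (T.deg S g) (T.deg S h)
  rw [← deg_mul] at h1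
  simp only [unram, coboundary]
  rw [smul_pow', T.smul_eq_pow_deg g hη, div_mul_eq_mul_div, eq_div_iff_mul_eq',
    mul_comm ((η ^ b S) ^ _), ← hbt, h1, hbadd, add_comm (b _), pow_add, pow_mul]

end TameFrame

namespace KummerFrame

open scoped Matrix

variable {F : Type*} [Field F] {ℓ q d : ℕ} (T : KummerFrame F ℓ q d) [Fact ℓ.Prime]

omit [Fact ℓ.Prime] in
include T in
theorem smul_eq_of_pow_sub_one_eq_one {w : SepUnits F} (hw : w ^ (q - 1) = 1) (g : GalSep F) :
    g • w = w := by
  have hpos : 0 < q - 1 := by have := T.one_lt; omega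
  refine T.smul_eq_of_inertia_of_frob
    (fun g hg => T.inertia_smul_eq hpos T.coprime_sub_one hw hg) ?_ g
  rw [T.frob_smul_eq hpos T.coprime_sub_one hw]
  conv_lhs => rw [← Nat.sub_add_cancel T.one_lt.le, pow_succ, hw, one_mul]

include T in
theorem exists_unit_q_sub_one :
    ∃ u : ℤ_[ℓ], IsUnit u ∧ (q : ℤ_[ℓ]) - 1 = ℓ ^ padicValNat ℓ (q - 1) * u := by
  have hpos : q - 1 ≠ 0 := by have := T.one_lt; omega
  obtain ⟨m, hm⟩ := pow_padicValNat_dvd (p := ℓ) (n := q - 1)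
  refine ⟨(m : ℤ_[ℓ]), ?_, ?_⟩
  · rw [PadicInt.isUnit_iff]
    refine PadicInt.norm_natCast_eq_one_iff.2 ?_
    rw [Nat.Prime.coprime_iff_not_dvd T.prime]
    rintro ⟨j, rfl⟩
    refine pow_succ_padicValNat_not_dvd (p := ℓ) hpos ⟨j, ?_⟩
    conv_lhs => rw [hm]
    ring
  · have h1 : ((q - 1 : ℕ) : ℤ_[ℓ]) = (q : ℤ_[ℓ]) - 1 := by
      rw [Nat.cast_sub T.one_lt.le, Nat.cast_one]
    rw [← h1]
    conv_lhs => rw [hm]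
    push_cast
    ring

theorem smul_ex_of_le {s : ℕ} (hs : s ≤ padicValNat ℓ (q - 1)) (g : GalSep F) (z : ℤ_[ℓ]) :
    g • T.ex s z = T.ex s z := by
  refine T.smul_eq_of_pow_sub_one_eq_one ?_ g
  obtain ⟨c, hc⟩ := (pow_dvd_pow ℓ hs).trans (pow_padicValNat_dvd (p := ℓ) (n := q - 1))
  rw [hc, pow_mul, ex_pow_eq_one, one_pow]

theorem cocycleOn_sym_of_le {s : ℕ} (hs : s ≤ padicValNat ℓ (q - 1))
    (M : Matrix (Fin d) (Fin d) ℤ_[ℓ]) (K : Subgroup (GalSep F)) : CocycleOn K (T.sym s M) := by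
  intro g _ h _ j _
  have h1 : ∀ (g : GalSep F) (z w : ℤ_[ℓ]), T.ex s (z + T.cyc g * w) = T.ex s (z + w) := by
    intro g z w
    rw [ex_add, ← smul_ex, T.smul_ex_of_le hs, ← ex_add]
  simp only [sym, T.smul_ex_of_le hs]
  simp only [← ex_add, kumVec_mul, add_dotProduct, Matrix.mulVec_add, dotProduct_add,
    smul_dotProduct, Matrix.mulVec_smul, dotProduct_smul, smul_eq_mul]
  rw [← add_assoc, h1 h, add_right_comm, h1 g]
  congr 1
  ring

omit [Fact ℓ.Prime] in
theorem unram_inertia {S : ℕ} [NeZero S] {α : SepUnits F} {g : GalSep F} (hg : g ∈ T.inertia)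
    (h : GalSep F) : T.unram S α (g, h) = 1 := by
  rw [TameFrame.unram, T.deg_inertia S hg, carry_zero_left, pow_zero]

/-- A Brauer class of `ℓ`-power order is the sum of a strictly upper triangular symbol and of
unramified cyclic algebras. -/
theorem exists_splitsOn_div {c : GalSep F × GalSep F → SepUnits F} (hc : IsLocallyConstant c)
    (hcoc : CocycleOn ⊤ c) {s : ℕ} (hs : ∀ p, c p ^ ℓ ^ s = 1) :
    ∃ (M : Matrix (Fin d) (Fin d) ℤ_[ℓ]) (t : ℕ) (_ : NeZero (ℓ ^ t)) (e : Fin d → ℤ),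
      (∀ i l, l ≤ i → M i l = 0) ∧ SplitsOn ⊤ (c / (T.sym (padicValNat ℓ (q - 1)) M *
        ∏ i, T.unram (ℓ ^ t) (T.unif i) ^ e i)) := by
  set v := padicValNat ℓ (q - 1)
  obtain ⟨u, hu, huv⟩ := T.exists_unit_q_sub_one
  obtain ⟨M, hM, hsplit⟩ := exists_strictUpper_splitsOn (T := T) hu huv hc hcoc hs
  set c' := c / T.sym v M
  have hc' : IsLocallyConstant c' := hc.div (isLocallyConstant_sym v M)
  have hcoc' : CocycleOn ⊤ c' := hcoc.div (T.cocycleOn_sym_of_le le_rfl M ⊤)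
  have hc't : ∀ p, c' p ^ ℓ ^ (s + v) = 1 := by
    intro p
    change (c p / T.sym v M p) ^ _ = 1
    rw [div_pow, pow_add, pow_mul, hs, one_pow, mul_comm, pow_mul, sym_pow_eq_one, one_pow, div_one]
  -- the class becomes trivial over a finite unramified extension
  have hne : Nonempty {S : ℕ // 0 < S} := ⟨⟨1, one_pos⟩⟩
  obtain ⟨⟨S, hS⟩, hSs⟩ := hsplit.exists_of_directed T.directed_level
    (fun S => T.isClosed_level S.1) (fun g hg => by
      rw [← SetLike.mem_coe, ← T.iInter_level]
      exact Set.mem_iInter.2 hg) hc'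
  have hSne : NeZero S := ⟨hS.ne'⟩
  obtain ⟨α, hα, hcyc⟩ := SplitsOn.exists_carry (K := ⊤) (K' := T.level S) hc' hcoc'
    (T.isLocallyConstant_deg S) (fun g _ h _ => T.deg_mul S g h)
    (fun g => by simp [T.deg_eq_zero_iff]) (σ := T.frob) trivial (T.deg_frob S) hSs
  change SplitsOn ⊤ (c' / T.unram S α) at hcyc
  have hα' : ∀ g : GalSep F, g • α = α := fun g => hα g trivial
  -- the part of the degree prime to `ℓ` does not matter
  obtain ⟨t, e, he, rfl⟩ := Nat.exists_eq_pow_mul_and_not_dvd hS.ne' ℓ T.prime.ne_one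
  have ht : NeZero (ℓ ^ t) := ⟨pow_ne_zero _ T.prime.ne_zero⟩
  have hcop : IsCoprime (e : ℤ) ((ℓ ^ (s + v) : ℕ) : ℤ) := by
    rw [Nat.isCoprime_iff_coprime]
    exact Nat.Coprime.pow_right _ ((Nat.Prime.coprime_iff_not_dvd T.prime).2 he).symm
  obtain ⟨a, b, hab⟩ := hcop
  have h1 : SplitsOn ⊤ (c' ^ e / T.unram (ℓ ^ t) α) := by
    have h2 := hcyc.pow e
    rw [div_pow] at h2
    exact h2.trans_div (T.splitsOn_unram_mul hα')
  have h2 : SplitsOn ⊤ (c' / T.unram (ℓ ^ t) (α ^ a)) := by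
    refine (h1.zpow a).congr fun g _ h _ => ?_
    rw [T.unram_zpow]
    change c' (g, h) / _ = (c' (g, h) ^ e / T.unram (ℓ ^ t) α (g, h)) ^ a
    rw [div_zpow]
    congr 1
    conv_lhs => rw [← zpow_one (c' (g, h)), ← hab, zpow_add, zpow_mul' _ b, zpow_natCast, hc't,
      one_zpow, mul_one, zpow_mul', zpow_natCast]
  obtain ⟨w, x, e', hw, hx, hαa⟩ := T.decomposition (α ^ a)
    (fun g => by rw [smul_zpow', hα']) t
  rw [hαa, T.unram_mul, T.unram_mul, T.unram_prod] at h2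
  refine ⟨M, t, ht, e', hM, ?_⟩
  have h3 := (h2.mul (T.splitsOn_unram_of_pow_eq_one (S := ℓ ^ t) hw)).mul
    (T.splitsOn_unram_pow (S := ℓ ^ t) hx)
  simp only [T.unram_zpow] at h3
  have h4 : ∀ A S P W X : GalSep F × GalSep F → SepUnits F,
      A / (S * P) = A / S / (W * X * P) * W * X := by
    intro A S P W X
    rw [div_div, div_mul_eq_mul_div, div_mul_eq_mul_div, div_eq_div_iff_mul_eq_mul]
    ac_rfl
  rw [h4]
  exact h3

/-- The summands in the decomposition of a Brauer class are independent. -/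
theorem dvd_of_splitsOn_mul {M : Matrix (Fin d) (Fin d) ℤ_[ℓ]} (hM : ∀ i l, l ≤ i → M i l = 0)
    {t : ℕ} [NeZero (ℓ ^ t)] {e : Fin d → ℤ}
    (h : SplitsOn ⊤ (T.sym (padicValNat ℓ (q - 1)) M *
        ∏ i, T.unram (ℓ ^ t) (T.unif i) ^ e i)) :
    (∀ i l, (ℓ : ℤ_[ℓ]) ^ padicValNat ℓ (q - 1) ∣ M i l) ∧ ∀ i, ((ℓ ^ t : ℕ) : ℤ) ∣ e i := by
  set v := padicValNat ℓ (q - 1)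
  have h1 : SplitsOn T.inertia (T.sym v M) := by
    refine (h.mono le_top).congr fun g hg h _ => ?_
    rw [Pi.mul_apply, Finset.prod_apply, Finset.prod_eq_one, mul_one]
    intro i _
    change T.unram _ _ _ ^ e i = 1
    rw [T.unram_inertia hg, one_zpow]
  have hdvd : ∀ i l, (ℓ : ℤ_[ℓ]) ^ v ∣ M i l := by
    intro i l
    rcases le_or_gt l i with hil | hil
    · rw [hM i l hil]
      exact dvd_zero _
    · have := dvd_sub_of_splitsOn_sym h1 i l
      rwa [hM l i hil.le, sub_zero] at this
  refine ⟨hdvd, ?_⟩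
  have hsym1 : T.sym v M = 1 := by
    funext p
    refine ex_eq_one_iff_dvd.2 ?_
    change _ ∣ ∑ i, _ * ∑ l, M i l * _
    refine Finset.dvd_sum fun i _ => Dvd.dvd.mul_left (Finset.dvd_sum fun l _ => ?_) _
    exact Dvd.dvd.mul_right (hdvd i l) _
  rw [hsym1, one_mul] at h
  -- replace the cyclic algebra by a cup product with values in the roots of unity
  set y : SepUnits F := ∏ i, T.root i t ^ e i with hy
  have hyt : y ^ ℓ ^ t = ∏ i, T.unif i ^ e i := by
    rw [hy, ← Finset.prod_pow]
    refine Finset.prod_congr rfl fun i _ => ?_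
    rw [← zpow_natCast, ← zpow_mul, mul_comm, zpow_mul, zpow_natCast, T.root_pow_eq_unif]
  have hyfix : ∀ g : GalSep F, g • y ^ ℓ ^ t = y ^ ℓ ^ t := by
    intro g
    rw [hyt, Finset.smul_prod']
    exact Finset.prod_congr rfl fun i _ => by rw [smul_zpow', T.unif_fixed]
  have hyg : ∀ g : GalSep F, g • y / y = T.ex t (∑ i, (e i : ℤ_[ℓ]) * T.kum i g) := by
    intro g
    rw [div_eq_iff_eq_mul, hy, Finset.smul_prod', ex_sum, ← Finset.prod_mul_distrib]
    refine Finset.prod_congr rfl fun i _ => ?_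
    rw [smul_zpow', smul_root, mul_zpow, ex_intCast_mul]
  set κ : GalSep F × GalSep F → SepUnits F :=
    fun p => (p.1 • (p.2 • y / y)) ^ (T.deg (ℓ ^ t) p.1).val with hκ
  have hκs : SplitsOn ⊤ κ := by
    have h2 : SplitsOn ⊤ (T.unram (ℓ ^ t) (y ^ ℓ ^ t)) := by
      rw [hyt, T.unram_prod]
      simpa only [T.unram_zpow] using h
    have h3 : IsLocallyConstant fun g => (g • y) ^ (T.deg (ℓ ^ t) g).val :=
      ((isLocallyConstant_galSep_smul y).prodMk (T.isLocallyConstant_deg (ℓ ^ t))).comp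
        (fun p => p.1 ^ p.2.val)
    refine (h2.div ⟨_, h3, fun g _ h _ => rfl⟩).congr fun g _ h _ => ?_
    rw [Pi.div_apply, eq_div_iff_mul_eq']
    exact cup_smul_div_mul_coboundary (T.deg_mul _ g h) (hyfix _)
  have hκt : ∀ p, κ p ^ ℓ ^ t = 1 := by
    intro p
    simp only [hκ]
    rw [← pow_mul, mul_comm, pow_mul, ← smul_pow', hyg, ex_pow_eq_one, smul_one, one_pow]
  have hroot : ∀ x : SepUnits F, ∃ y, y ^ ℓ ^ t = x := by
    intro x
    obtain ⟨S, hS, hd⟩ := exists_dvd_pow_sub_one (pow_pos T.prime.pos t) (T.coprime.pow_right t)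
    exact T.exists_root S hS _ hd x
  obtain ⟨f, hf, hft, hfs⟩ := hκs.exists_pow_eq_one hroot (fun g _ h _ => hκt (g, h))
  have hκ1 : ∀ g ∈ T.inertia, ∀ h, κ (g, h) = 1 := by
    intro g hg h
    simp only [hκ]
    rw [T.deg_inertia _ hg, ZMod.val_zero, pow_zero]
  have hadd : ∀ g ∈ T.inertia, ∀ h, f (g * h) = f g * f h := by
    intro g hg h
    have h2 := hfs g trivial h trivial
    rw [hκ1 g hg, coboundary, T.smul_eq_of_pow_eq_one hg (hft h trivial), div_mul_eq_mul_div,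
      eq_comm, div_eq_one] at h2
    rw [← h2, mul_comm]
  obtain ⟨e', he'⟩ := exists_eq_ex_sum (T := T) (s := Finset.univ) hf
    (fun g hg h _ => hadd g hg.1 h) (t := t) (fun g _ => hft g trivial)
  rw [kumKer_univ] at he'
  intro i
  -- compare the two sides of `σ τᵢ = (σ τᵢ σ⁻¹) σ`
  have hmem : T.frob * T.tau i * T.frob⁻¹ ∈ T.inertia :=
    Subgroup.Normal.conj_mem inferInstance _ (T.tau_mem i) T.frob
  have h2 := hfs T.frob trivial (T.tau i) trivial
  have h3 := hadd _ hmem T.frob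
  rw [inv_mul_cancel_right] at h3
  have h4 : T.frob • f (T.tau i) = f (T.frob * T.tau i * T.frob⁻¹) := by
    rw [he' _ (T.tau_mem i), he' _ hmem, smul_ex, T.cyc_frob, Finset.mul_sum]
    congr 1
    refine Finset.sum_congr rfl fun l _ => ?_
    rw [T.kum_conj_frob l (T.tau_mem i)]
    ring
  rw [coboundary, h3, h4, ← div_div, div_self', one_div, inv_mul_cancel] at h2
  simp only [hκ] at h2
  rcases Nat.eq_zero_or_pos t with rfl | ht
  · simp
  have h1t : Fact (1 < ℓ ^ t) := ⟨Nat.one_lt_pow ht.ne' T.prime.one_lt⟩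
  rw [T.deg_frob, ZMod.val_one, pow_one, ← eq_inv_smul_iff, smul_one, hyg,
    Finset.sum_eq_single i (fun l _ hl => by rw [kum_tau, if_neg hl, mul_zero]) (by simp), kum_tau,
    if_pos rfl, mul_one, ex_intCast, ← orderOf_dvd_iff_zpow_eq_one, T.orderOf_zeta] at h2
  exact h2

end KummerFrame

/-! ### Classes in the Brauer group -/

namespace BrGroup

variable {F : Type*} [Field F]

/-- The homomorphism sending a cocycle to its class. -/
def mkHom : Additive (contZ2 (GalSep F) (SepUnits F)) →+ BrGroup F :=
  MonoidHom.toAdditive (QuotientGroup.mk' ((contB2 (GalSep F) (SepUnits F)).subgroupOf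
    (contZ2 (GalSep F) (SepUnits F))))

theorem mk_eq_zero_iff {f : contZ2 (GalSep F) (SepUnits F)} :
    BrGroup.mk f = 0 ↔ SplitsOn ⊤ f.1 := by
  have h1 : BrGroup.mk f = 0 ↔ f ∈ (contB2 (GalSep F) (SepUnits F)).subgroupOf
      (contZ2 (GalSep F) (SepUnits F)) := QuotientGroup.eq_one_iff f
  rw [h1, Subgroup.mem_subgroupOf]
  constructor
  · rintro ⟨f, hf, h⟩
    exact ⟨f, hf, fun g _ j _ => (h g j).symm⟩
  · rintro ⟨f, hf, h⟩
    exact ⟨f, hf, fun g j => (h g trivial j trivial).symm⟩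

theorem mk_div (f g : contZ2 (GalSep F) (SepUnits F)) :
    BrGroup.mk (f / g) = BrGroup.mk f - BrGroup.mk g := rfl

theorem mk_one : BrGroup.mk (1 : contZ2 (GalSep F) (SepUnits F)) = 0 := rfl

theorem mk_eq_iff {f g : contZ2 (GalSep F) (SepUnits F)} :
    BrGroup.mk f = BrGroup.mk g ↔ SplitsOn ⊤ (f.1 / g.1) := by
  rw [← sub_eq_zero, ← mk_div, mk_eq_zero_iff]
  rfl

theorem mk_zpow (f : contZ2 (GalSep F) (SepUnits F)) (e : ℤ) :
    BrGroup.mk (f ^ e) = e • BrGroup.mk f := map_zsmul mkHom e (Additive.ofMul f)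

theorem mk_pow (f : contZ2 (GalSep F) (SepUnits F)) (e : ℕ) :
    BrGroup.mk (f ^ e) = e • BrGroup.mk f := map_nsmul mkHom e (Additive.ofMul f)

theorem mk_prod {ι : Type*} (s : Finset ι) (f : ι → contZ2 (GalSep F) (SepUnits F)) :
    BrGroup.mk (∏ i ∈ s, f i) = ∑ i ∈ s, BrGroup.mk (f i) :=
  map_sum mkHom (fun i => Additive.ofMul (f i)) s

theorem exists_mk (a : BrGroup F) : ∃ f, BrGroup.mk f = a := QuotientGroup.mk_surjective a

/-- A torsion class is represented by a cocycle with values in the roots of unity. -/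
theorem exists_mk_pow_eq_one {N : ℕ} (hN : ∀ x : SepUnits F, ∃ y, y ^ N = x) {a : BrGroup F}
    (ha : N • a = 0) : ∃ f, BrGroup.mk f = a ∧ ∀ p, f.1 p ^ N = 1 := by
  obtain ⟨f, rfl⟩ := exists_mk a
  rw [← mk_pow, mk_eq_zero_iff] at ha
  obtain ⟨f₀, hf₀, h⟩ := ha
  choose ρ hρ using hN
  have hf₁ : IsLocallyConstant (ρ ∘ f₀) := hf₀.comp ρ
  let b : contZ2 (GalSep F) (SepUnits F) := ⟨coboundary (ρ ∘ f₀), hf₁.coboundary,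
    fun g h j => cocycleOn_coboundary ⊤ _ g trivial h trivial j trivial⟩
  have hb : BrGroup.mk b = 0 := mk_eq_zero_iff.2 ⟨ρ ∘ f₀, hf₁, fun g _ h _ => rfl⟩
  refine ⟨f / b, by rw [mk_div, hb, sub_zero], fun p => ?_⟩
  have h1 : f.1 p ^ N = coboundary f₀ p := h p.1 trivial p.2 trivial
  change (f.1 p / coboundary (ρ ∘ f₀) p) ^ N = 1
  have h2 : (ρ ∘ f₀) ^ N = f₀ := funext fun g => hρ (f₀ g)
  rw [div_pow, h1, ← Pi.pow_apply, ← coboundary_pow, h2, div_self']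

end BrGroup

namespace KummerFrame

open scoped Matrix

variable {F : Type*} [Field F] {ℓ q d : ℕ} (T : KummerFrame F ℓ q d) [Fact ℓ.Prime]

omit [Fact ℓ.Prime] in
include T in
theorem exists_pow_root (s : ℕ) (x : SepUnits F) : ∃ y, y ^ ℓ ^ s = x := by
  obtain ⟨S, hS, hd⟩ := exists_dvd_pow_sub_one (pow_pos T.prime.pos s) (T.coprime.pow_right s)
  exact T.exists_root S hS _ hd x

/-- The symbol as a 2-cocycle, for a root of unity in the base field. -/
def symCocycle (M : Matrix (Fin d) (Fin d) ℤ_[ℓ]) : contZ2 (GalSep F) (SepUnits F) :=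
  ⟨T.sym (padicValNat ℓ (q - 1)) M, isLocallyConstant_sym _ M, fun g h j =>
    T.cocycleOn_sym_of_le le_rfl M ⊤ g trivial h trivial j trivial⟩

/-- The Brauer class of a symbol. -/
def symClass : Matrix (Fin d) (Fin d) ℤ_[ℓ] →+ BrGroup F :=
  AddMonoidHom.mk' (fun M => BrGroup.mk (T.symCocycle M)) fun M N => by
    rw [← BrGroup.mk_mul]
    congr 1
    exact Subtype.ext (sym_add _ M N)

/-- The cocycle of the unramified cyclic algebra of `unif i`. -/
def unramCocycle (N : ℕ) [NeZero N] (i : Fin d) : contZ2 (GalSep F) (SepUnits F) :=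
  ⟨T.unram N (T.unif i), T.isLocallyConstant_unram N _, fun g h j =>
    T.cocycleOn_unram (T.unif_fixed i) ⊤ g trivial h trivial j trivial⟩

/-- The Brauer class of the unramified cyclic algebra of `unif i`. -/
def unramClass (N : ℕ) [NeZero N] (i : Fin d) : BrGroup F := BrGroup.mk (T.unramCocycle N i)

omit [Fact ℓ.Prime] in
theorem unramClass_mul (N e : ℕ) [NeZero N] [NeZero (N * e)] (i : Fin d) :
    e • T.unramClass (N * e) i = T.unramClass N i := by
  rw [unramClass, ← BrGroup.mk_pow, unramClass, BrGroup.mk_eq_iff]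
  exact T.splitsOn_unram_mul (T.unif_fixed i)

omit [Fact ℓ.Prime] in
theorem nsmul_unramClass (N : ℕ) [NeZero N] (i : Fin d) : N • T.unramClass N i = 0 := by
  rw [unramClass, ← BrGroup.mk_pow, BrGroup.mk_eq_zero_iff]
  refine (T.splitsOn_unram_pow (S := N) (T.unif_fixed i)).congr fun g _ h _ => ?_
  change (T.unif i ^ _) ^ N = (T.unif i ^ N) ^ _
  rw [← pow_mul, ← pow_mul, mul_comm]

theorem symClass_eq_zero {M : Matrix (Fin d) (Fin d) ℤ_[ℓ]}
    (hM : ∀ i l, (ℓ : ℤ_[ℓ]) ^ padicValNat ℓ (q - 1) ∣ M i l) : T.symClass M = 0 := by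
  have h1 : T.symCocycle M = 1 := by
    refine Subtype.ext (funext fun p => ex_eq_one_iff_dvd.2 ?_)
    change _ ∣ ∑ i, _ * ∑ l, M i l * _
    refine Finset.dvd_sum fun i _ => Dvd.dvd.mul_left (Finset.dvd_sum fun l _ => ?_) _
    exact Dvd.dvd.mul_right (hM i l) _
  change BrGroup.mk (T.symCocycle M) = 0
  rw [h1, BrGroup.mk_one]

theorem mk_symCocycle_mul (M : Matrix (Fin d) (Fin d) ℤ_[ℓ]) (N : ℕ) [NeZero N] (e : Fin d → ℤ) :
    BrGroup.mk (T.symCocycle M * ∏ i, T.unramCocycle N i ^ e i) =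
      T.symClass M + ∑ i, e i • T.unramClass N i := by
  rw [BrGroup.mk_mul, BrGroup.mk_prod]
  simp only [BrGroup.mk_zpow]
  rfl

theorem val_symCocycle_mul (M : Matrix (Fin d) (Fin d) ℤ_[ℓ]) (N : ℕ) [NeZero N] (e : Fin d → ℤ) :
    (T.symCocycle M * ∏ i, T.unramCocycle N i ^ e i).1 =
      T.sym (padicValNat ℓ (q - 1)) M * ∏ i, T.unram N (T.unif i) ^ e i := by
  rw [Subgroup.coe_mul, Subgroup.val_finsetProd]
  rfl

/-- The structure of the `ℓ`-primary part of the Brauer group: generation. -/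
theorem exists_eq_symClass_add {a : BrGroup F} {s : ℕ} (ha : ℓ ^ s • a = 0) :
    ∃ (M : Matrix (Fin d) (Fin d) ℤ_[ℓ]) (t : ℕ) (_ : NeZero (ℓ ^ t)) (e : Fin d → ℤ),
      (∀ i l, l ≤ i → M i l = 0) ∧ a = T.symClass M + ∑ i, e i • T.unramClass (ℓ ^ t) i := by
  obtain ⟨f, rfl, hf⟩ := BrGroup.exists_mk_pow_eq_one (T.exists_pow_root s) ha
  obtain ⟨M, t, ht, e, hM, h⟩ := T.exists_splitsOn_div f.2.1
    (fun g _ h _ j _ => f.2.2 g h j) hf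
  refine ⟨M, t, ht, e, hM, ?_⟩
  rw [← T.mk_symCocycle_mul, BrGroup.mk_eq_iff, T.val_symCocycle_mul]
  exact h

/-- The structure of the `ℓ`-primary part of the Brauer group: independence. -/
theorem dvd_of_symClass_add_eq_zero {M : Matrix (Fin d) (Fin d) ℤ_[ℓ]}
    (hM : ∀ i l, l ≤ i → M i l = 0) {t : ℕ} [NeZero (ℓ ^ t)] {e : Fin d → ℤ}
    (h : T.symClass M + ∑ i, e i • T.unramClass (ℓ ^ t) i = 0) :
    (∀ i l, (ℓ : ℤ_[ℓ]) ^ padicValNat ℓ (q - 1) ∣ M i l) ∧ ∀ i, ((ℓ ^ t : ℕ) : ℤ) ∣ e i := by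
  rw [← T.mk_symCocycle_mul, BrGroup.mk_eq_zero_iff, T.val_symCocycle_mul] at h
  exact T.dvd_of_splitsOn_mul hM h

end KummerFrame

/-! ### Characters with values in `ℚ/ℤ` -/

section QmodZ

/-- The homomorphism `k ↦ k / N` from `ℤ/N` to `ℚ/ℤ`. -/
def divQmodZ (N : ℕ) [NeZero N] : ZMod N →+ QmodZ :=
  ZMod.lift N ⟨(QuotientAddGroup.mk' _).comp
    ((AddMonoidHom.mulRight ((N : ℚ)⁻¹)).comp (Int.castAddHom ℚ)), by
      refine (QuotientAddGroup.eq_zero_iff _).2 ?_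
      rw [AddSubgroup.mem_zmultiples_iff]
      refine ⟨1, ?_⟩
      have : (N : ℚ) ≠ 0 := by exact_mod_cast NeZero.ne N
      simp [this]⟩

theorem divQmodZ_intCast (N : ℕ) [NeZero N] (k : ℤ) :
    divQmodZ N (k : ZMod N) = (((k : ℚ) / (N : ℚ) : ℚ) : QmodZ) := by
  rw [divQmodZ, ZMod.lift_coe, div_eq_mul_inv]
  rfl

theorem divQmodZ_injective (N : ℕ) [NeZero N] : Function.Injective (divQmodZ N) := by
  rw [injective_iff_map_eq_zero]
  intro a ha
  obtain ⟨k, rfl⟩ := ZMod.intCast_surjective a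
  rw [divQmodZ_intCast, QuotientAddGroup.eq_zero_iff, AddSubgroup.mem_zmultiples_iff] at ha
  obtain ⟨c, hc⟩ := ha
  have hN : (N : ℚ) ≠ 0 := by exact_mod_cast NeZero.ne N
  rw [eq_div_iff hN] at hc
  rw [ZMod.intCast_zmod_eq_zero_iff_dvd]
  refine ⟨c, ?_⟩
  have : (k : ℚ) = N * c := by
    rw [← hc]
    simp [mul_comm]
  exact_mod_cast this

theorem nsmul_divQmodZ (N : ℕ) [NeZero N] (a : ZMod N) : N • divQmodZ N a = 0 := by
  rw [← map_nsmul]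
  simp

theorem exists_divQmodZ {N : ℕ} [NeZero N] {a : QmodZ} (ha : N • a = 0) :
    ∃ k : ℤ, divQmodZ N (k : ZMod N) = a :=
  ⟨numer N a, by rw [divQmodZ_intCast, numer_spec (NeZero.ne N) ha]⟩

theorem divQmodZ_mul (N e : ℕ) [NeZero N] [NeZero (N * e)] (k : ℤ) :
    divQmodZ (N * e) ((e * k : ℤ) : ZMod (N * e)) = divQmodZ N (k : ZMod N) := by
  rw [divQmodZ_intCast, divQmodZ_intCast]
  congr 1
  have h1 : (N : ℚ) ≠ 0 := by exact_mod_cast NeZero.ne N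
  have h2 : (e : ℚ) ≠ 0 := by
    have := NeZero.ne (N * e)
    exact_mod_cast right_ne_zero_of_mul this
  push_cast
  field_simp

theorem zpow_numer_divQmodZ {M : Type*} [CommGroup M] {N : ℕ} [NeZero N] {w : M} (hw : w ^ N = 1)
    (k : ℤ) : w ^ numer N (divQmodZ N (k : ZMod N)) = w ^ k := by
  apply zpow_eq_of_div_eq (NeZero.ne N) hw
  rw [numer_spec (NeZero.ne N) (nsmul_divQmodZ N _), divQmodZ_intCast]

variable {ℓ : ℕ} [Fact ℓ.Prime]

instance (s : ℕ) : NeZero (ℓ ^ s) := ⟨pow_ne_zero _ (Fact.out : ℓ.Prime).ne_zero⟩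

/-- The homomorphism `z ↦ z / ℓ ^ s` from the `ℓ`-adic integers to `ℚ/ℤ`. -/
def divPow (s : ℕ) : ℤ_[ℓ] →+ QmodZ :=
  (divQmodZ (ℓ ^ s)).comp (PadicInt.toZModPow s : ℤ_[ℓ] →+* ZMod (ℓ ^ s)).toAddMonoidHom

theorem divPow_eq (s : ℕ) (z : ℤ_[ℓ]) : divPow s z = divQmodZ (ℓ ^ s) (PadicInt.toZModPow s z) :=
  rfl

theorem divPow_intCast (s : ℕ) (k : ℤ) : divPow s (k : ℤ_[ℓ]) = divQmodZ (ℓ ^ s) (k : ZMod _) := by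
  rw [divPow_eq, map_intCast]

theorem divPow_eq_zero_iff {s : ℕ} {z : ℤ_[ℓ]} : divPow s z = 0 ↔ (ℓ : ℤ_[ℓ]) ^ s ∣ z := by
  rw [divPow_eq, map_eq_zero_iff _ (divQmodZ_injective _), ← map_zero (PadicInt.toZModPow s),
    PadicInt.toZModPow_eq_iff, sub_zero]

theorem divPow_pow_mul (s t : ℕ) (z : ℤ_[ℓ]) :
    divPow (s + t) ((ℓ : ℤ_[ℓ]) ^ t * z) = divPow s z := by
  obtain ⟨k, hk⟩ : ∃ k : ℤ, PadicInt.toZModPow (s + t) z = k :=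
    ⟨(PadicInt.toZModPow (s + t) z).val, by simp⟩
  rw [← map_intCast (PadicInt.toZModPow (p := ℓ) (s + t)), PadicInt.toZModPow_eq_iff] at hk
  obtain ⟨w, hw⟩ := hk
  rw [sub_eq_iff_eq_add] at hw
  have h1 : divPow s z = divPow s (k : ℤ_[ℓ]) := by
    rw [hw, map_add, divPow_eq_zero_iff.2 ⟨(ℓ : ℤ_[ℓ]) ^ t * w, by rw [pow_add, mul_assoc]⟩,
      zero_add]
  have h2 : (ℓ : ℤ_[ℓ]) ^ t * z = (ℓ : ℤ_[ℓ]) ^ (s + t) * (ℓ ^ t * w) + ((ℓ ^ t * k : ℤ) : ℤ_[ℓ])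
      := by
    rw [hw]
    push_cast
    ring
  rw [h1, h2, map_add, divPow_eq_zero_iff.2 (dvd_mul_right _ _), zero_add, divPow_intCast,
    divPow_intCast]
  have h3 : NeZero (ℓ ^ s * ℓ ^ t) := ⟨by rw [← pow_add]; exact NeZero.ne _⟩
  have h4 := divQmodZ_mul (ℓ ^ s) (ℓ ^ t) k
  rw [divQmodZ_intCast] at h4 ⊢
  rw [← h4, pow_add]
  push_cast
  rfl

theorem nsmul_divPow (s t : ℕ) (z : ℤ_[ℓ]) : ℓ ^ t • divPow (s + t) z = divPow s z := by
  rw [← map_nsmul, nsmul_eq_mul, Nat.cast_pow, divPow_pow_mul]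

end QmodZ

/-! ### Torsion of twice a group, and the number `m'` -/

/-- The `ℓ ^ r`-torsion of `2 A` is the image under `ℓ ^ twoExp ℓ` of the
`ℓ ^ (r + twoExp ℓ)`-torsion of `A`. For odd `ℓ` the factor `2` is invisible. -/
theorem mem_nTorsionOfTwice_iff {ℓ : ℕ} (hℓ : ℓ.Prime) (r : ℕ) {A : Type*} [AddCommGroup A]
    {a : A} : a ∈ nTorsionOfTwice (ℓ ^ r) A ↔
      ∃ b, ℓ ^ twoExp ℓ • b = a ∧ ℓ ^ (r + twoExp ℓ) • b = 0 := by
  have h0 : a ∈ nTorsionOfTwice (ℓ ^ r) A ↔ ℓ ^ r • a = 0 ∧ ∃ b, 2 • b = a := Iff.rfl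
  rw [h0]
  rcases hℓ.eq_two_or_odd' with rfl | hodd
  · simp only [twoExp, if_true, pow_one]
    constructor
    · rintro ⟨h, b, rfl⟩
      exact ⟨b, rfl, by rw [pow_succ, mul_smul, h]⟩
    · rintro ⟨b, rfl, h⟩
      exact ⟨by rw [← mul_smul, ← pow_succ, h], b, rfl⟩
  · have h2 : ℓ ≠ 2 := by
      rintro rfl
      exact Nat.not_odd_iff_even.2 even_two hodd
    simp only [twoExp, if_neg h2, pow_zero, one_smul, add_zero, exists_eq_left]
    refine and_iff_left_of_imp fun h => ?_
    obtain ⟨m, hm⟩ := hodd.pow (n := r)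
    refine ⟨(m + 1) • a, ?_⟩
    rw [← mul_smul, show 2 * (m + 1) = ℓ ^ r + 1 by omega, add_smul, h, one_smul, zero_add]

/-- A description of `m'` that is uniform in `ℓ`: with `v` the exponent of `ℓ` in `q - 1`, the
number `m'` is `ℓ ^ μ` where `μ` is `min v (r + 1) - 1` for `ℓ = 2` and `min v r` for odd `ℓ`. -/
theorem exists_mPrime_eq {ℓ : ℕ} (hℓ : ℓ.Prime) (r : ℕ) {q : ℕ} (hq : 1 < q) (hqℓ : q.Coprime ℓ) :
    ∃ μ, mPrime q (ℓ ^ r) = ℓ ^ μ ∧ μ + twoExp ℓ = min (padicValNat ℓ (q - 1)) (r + twoExp ℓ) := by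
  have hfact : Fact ℓ.Prime := ⟨hℓ⟩
  have hne : q - 1 ≠ 0 := by omega
  have hgcd : (q - 1).gcd (ℓ ^ r) = ℓ ^ min (padicValNat ℓ (q - 1)) r := by
    obtain ⟨k, hk, hk'⟩ := (Nat.dvd_prime_pow hℓ).1 (Nat.gcd_dvd_right (q - 1) (ℓ ^ r))
    rw [hk']
    congr 1
    apply le_antisymm
    · refine le_min ?_ hk
      rw [← padicValNat_dvd_iff_le hne, ← hk']
      exact Nat.gcd_dvd_left _ _
    · rw [← Nat.pow_dvd_pow_iff_le_right hℓ.one_lt, ← hk']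
      exact Nat.dvd_gcd ((pow_dvd_pow _ (min_le_left _ _)).trans pow_padicValNat_dvd)
        (pow_dvd_pow _ (min_le_right _ _))
  unfold mPrime
  rw [hgcd]
  rcases hℓ.eq_two_or_odd' with rfl | hodd
  · have hv : 1 ≤ padicValNat 2 (q - 1) := by
      rw [← padicValNat_dvd_iff_le hne, pow_one]
      have := Nat.coprime_two_right.1 hqℓ
      obtain ⟨m, rfl⟩ := this
      exact ⟨m, by omega⟩
    simp only [twoExp, if_true]
    set v := padicValNat 2 (q - 1)
    rcases Nat.eq_zero_or_pos r with rfl | hr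
    · exact ⟨0, by simp, by omega⟩
    · rcases le_or_gt v r with hvr | hvr
      · refine ⟨v - 1, ?_, by omega⟩
        rw [min_eq_left hvr, if_pos ⟨dvd_pow_self 2 hr.ne', rfl⟩]
        conv_lhs => rw [show v = v - 1 + 1 by omega, pow_succ]
        simp
      · refine ⟨r, ?_, by omega⟩
        rw [min_eq_right hvr.le, if_neg]
        rintro ⟨-, h⟩
        exact hvr.ne (Nat.pow_right_injective le_rfl h)
  · have h2 : ℓ ≠ 2 := by
      rintro rfl
      exact Nat.not_odd_iff_even.2 even_two hodd
    refine ⟨min (padicValNat ℓ (q - 1)) r, ?_, by simp [twoExp, if_neg h2]⟩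
    rw [if_neg]
    rintro ⟨h, -⟩
    exact h2 ((Nat.prime_dvd_prime_iff_eq Nat.prime_two hℓ).1 (Nat.prime_two.dvd_of_dvd_pow h)).symm

/-! ### Evaluation of characters and cocycles -/

section Eval

variable {F : Type*} [Field F] {n : ℕ}

theorem CharTwice.ext {θ η : CharTwice F n} (h : ∀ g, θ.val g = η.val g) : θ = η :=
  Subtype.ext (Subtype.ext (funext h))

theorem KummerZ1.ext {z w : KummerZ1 F n} (h : ∀ g, z.val g = w.val g) : z = w :=
  Additive.toMul.injective (Subtype.ext (funext h))

/-- Evaluation of characters at an element of the Galois group. -/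
def CharGroup.evalHom (g : GalSep F) : CharGroup F →+ QmodZ :=
  (Pi.evalAddMonoidHom _ g).comp (CharGroup F).subtype

/-- Evaluation of characters at an element of the Galois group. -/
def CharTwice.evalHom (g : GalSep F) : CharTwice F n →+ QmodZ :=
  (CharGroup.evalHom g).comp (nTorsionOfTwice n (CharGroup F)).subtype

theorem CharTwice.evalHom_apply (g : GalSep F) (θ : CharTwice F n) :
    CharTwice.evalHom g θ = θ.val g := rfl

/-- Evaluation of Kummer cocycles at an element of the Galois group. -/
def KummerZ1.evalHom (g : GalSep F) : KummerZ1 F n →+ Additive (SepUnits F) :=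
  MonoidHom.toAdditive
    ((Pi.evalMonoidHom _ g).comp (contZ1Torsion (GalSep F) (SepUnits F) n).subtype)

theorem KummerZ1.evalHom_apply (g : GalSep F) (z : KummerZ1 F n) :
    KummerZ1.evalHom g z = Additive.ofMul (z.val g) := rfl

theorem KummerZ1.val_add (z w : KummerZ1 F n) (g : GalSep F) :
    (z + w).val g = z.val g * w.val g := rfl

theorem KummerZ1.val_sum_zsmul {ι : Type*} (s : Finset ι) (c : ι → ℤ) (z : ι → KummerZ1 F n)
    (g : GalSep F) : (∑ i ∈ s, c i • z i).val g = ∏ i ∈ s, (z i).val g ^ c i := by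
  have := map_sum (KummerZ1.evalHom g) (fun i => c i • z i) s
  simp only [map_zsmul, KummerZ1.evalHom_apply] at this
  exact congrArg Additive.toMul this

theorem CharTwice.val_sum_zsmul {ι : Type*} (s : Finset ι) (c : ι → ℤ) (θ : ι → CharTwice F n)
    (g : GalSep F) : (∑ i ∈ s, c i • θ i).val g = ∑ i ∈ s, c i • (θ i).val g := by
  have := map_sum (CharTwice.evalHom g) (fun i => c i • θ i) s
  simpa only [map_zsmul, CharTwice.evalHom_apply] using this

theorem CharGroup.val_sum_zsmul {ι : Type*} (s : Finset ι) (c : ι → ℤ) (χ : ι → CharGroup F)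
    (g : GalSep F) : (∑ i ∈ s, c i • χ i).1 g = ∑ i ∈ s, c i • (χ i).1 g := by
  have := map_sum (CharGroup.evalHom g) (fun i => c i • χ i) s
  simp only [map_zsmul] at this
  exact this

theorem KummerZ1.val_one (z : KummerZ1 F n) : z.val 1 = 1 := by
  have h := z.prop.2.1 1 1
  rw [mul_one, one_smul, left_eq_mul] at h
  exact h

theorem CharGroup.map_one (χ : CharGroup F) : χ.1 1 = 0 := by
  have h := χ.2.2 1 1
  rwa [mul_one, left_eq_add] at h

namespace TameFrame

variable {ℓ q d : ℕ} (T : TameFrame F ℓ q d)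

include T in
/-- A character is determined by its values on inertia and at the Frobenius. -/
theorem charGroup_ext {χ η : CharGroup F} (h1 : ∀ g ∈ T.inertia, χ.1 g = η.1 g)
    (h2 : χ.1 T.frob = η.1 T.frob) : χ = η := by
  let U : Subgroup (GalSep F) :=
    { carrier := {g | χ.1 g = η.1 g}
      one_mem' := by rw [Set.mem_ofPred_eq, CharGroup.map_one, CharGroup.map_one]
      mul_mem' := fun {a b} ha hb => by
        rw [Set.mem_ofPred_eq] at *
        rw [χ.2.2, η.2.2, ha, hb]
      inv_mem' := fun {a} ha => by
        rw [Set.mem_ofPred_eq] at *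
        have h3 := χ.2.2 a a⁻¹
        have h4 := η.2.2 a a⁻¹
        rw [mul_inv_cancel, CharGroup.map_one] at h3 h4
        rw [h3, ha] at h4
        exact add_left_cancel h4 }
  have hU : IsOpen (U : Set (GalSep F)) := by
    have := (χ.2.1.sub η.2.1).isOpen_fiber 0
    convert this using 1
    ext g
    exact sub_eq_zero.symm
  have h3 := T.eq_top_of_isOpen hU h1 h2
  refine Subtype.ext (funext fun g => ?_)
  exact (h3 ▸ trivial : g ∈ U)

include T in
/-- A Kummer cocycle is determined by its values on inertia and at the Frobenius. -/
theorem kummerZ1_ext {z w : KummerZ1 F n} (h1 : ∀ g ∈ T.inertia, z.val g = w.val g)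
    (h2 : z.val T.frob = w.val T.frob) : z = w := by
  let U : Subgroup (GalSep F) :=
    { carrier := {g | z.val g = w.val g}
      one_mem' := by rw [Set.mem_ofPred_eq, KummerZ1.val_one, KummerZ1.val_one]
      mul_mem' := fun {a b} ha hb => by
        rw [Set.mem_ofPred_eq] at *
        rw [z.prop.2.1, w.prop.2.1, ha, hb]
      inv_mem' := fun {a} ha => by
        rw [Set.mem_ofPred_eq] at *
        have h3 := z.prop.2.1 a a⁻¹
        have h4 := w.prop.2.1 a a⁻¹
        rw [mul_inv_cancel, KummerZ1.val_one] at h3 h4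
        rw [h3, ha, mul_left_inj] at h4
        exact MulAction.injective a h4 }
  have hU : IsOpen (U : Set (GalSep F)) := by
    have := (z.prop.1.div w.prop.1).isOpen_fiber 1
    convert this using 1
    ext g
    exact div_eq_one.symm
  have h3 := T.eq_top_of_isOpen hU h1 h2
  exact KummerZ1.ext fun g => (h3 ▸ trivial : g ∈ U)

/-- The unramified character of order `N`. -/
def unramChar (N : ℕ) [NeZero N] : CharGroup F :=
  ⟨fun g => divQmodZ N (T.deg N g), (T.isLocallyConstant_deg N).comp _, fun g h => by
    dsimp only
    rw [deg_mul, map_add]⟩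

theorem nsmul_unramChar (N e : ℕ) [NeZero N] [NeZero (N * e)] :
    e • T.unramChar (N * e) = T.unramChar N := by
  refine Subtype.ext (funext fun g => ?_)
  obtain ⟨k, hk⟩ := ZMod.intCast_surjective (T.deg (N * e) g)
  have h1 : T.deg N g = (k : ZMod N) := by
    rw [← T.cast_deg (dvd_mul_right N e), ← hk, map_intCast]
  change e • divQmodZ (N * e) (T.deg (N * e) g) = divQmodZ N (T.deg N g)
  rw [← hk, h1, ← map_nsmul, ← divQmodZ_mul N e k]
  simp

end TameFrame

end Eval

theorem zsmul_eq_zero_of_dvd {A : Type*} [AddCommGroup A] {N : ℕ} {a : A} (h : N • a = 0) {b : ℤ}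
    (hb : (N : ℤ) ∣ b) : b • a = 0 := by
  obtain ⟨c, rfl⟩ := hb
  rw [mul_comm, mul_smul, natCast_zsmul, h, smul_zero]

theorem CharTwice.nsmul_eq_zero {F : Type*} [Field F] {n : ℕ} (θ : CharTwice F n) : n • θ = 0 :=
  CharTwice.ext fun g => θ.nsmul_apply g

theorem KummerZ1.nsmul_eq_zero {F : Type*} [Field F] {n : ℕ} (z : KummerZ1 F n) : n • z = 0 :=
  KummerZ1.ext fun g => z.prop.2.2 g

section DivPow

variable {ℓ : ℕ} [Fact ℓ.Prime]

theorem pow_nsmul_divPow (s : ℕ) (z : ℤ_[ℓ]) : ℓ ^ s • divPow s z = 0 := nsmul_divQmodZ _ _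

theorem dvd_of_zsmul_divPow_one {s : ℕ} {b : ℤ} (h : b • divPow s (1 : ℤ_[ℓ]) = 0) :
    (ℓ : ℤ) ^ s ∣ b := by
  rw [← map_zsmul, divPow_eq_zero_iff, zsmul_one] at h
  exact (PadicInt.pow_p_dvd_int_iff _ _).1 h

theorem divPow_one (s : ℕ) : divPow s (1 : ℤ_[ℓ]) = divQmodZ (ℓ ^ s) 1 := by
  rw [divPow_eq, map_one]

end DivPow

/-! ### A basis of the characters and of the Kummer cocycles -/

namespace KummerFrame

variable {F : Type*} [Field F] {ℓ q d : ℕ} (T : KummerFrame F ℓ q d) [Fact ℓ.Prime]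

theorem divPow_cyc_mul {s : ℕ} (hs : s ≤ padicValNat ℓ (q - 1)) (g : GalSep F) (z : ℤ_[ℓ]) :
    divPow s (T.cyc g * z) = divPow s z := by
  have h := T.smul_ex_of_le hs g z
  rw [smul_ex, ex_eq_iff] at h
  rw [divPow_eq, h, divPow_eq]

theorem isLocallyConstant_divPow {X : Type*} [TopologicalSpace X] {f : X → ℤ_[ℓ]}
    (hf : Continuous f) (s : ℕ) : IsLocallyConstant fun x => divPow s (f x) :=
  ((PadicInt.isLocallyConstant_toZModPow s).comp_continuous hf).comp (divQmodZ (ℓ ^ s))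

/-- The tamely ramified character `kum i / ℓ ^ s`; it is a character because the roots of unity of
order `ℓ ^ s` lie in the base field. -/
def ramChar {s : ℕ} (hs : s ≤ padicValNat ℓ (q - 1)) (i : Fin d) : CharGroup F :=
  ⟨fun g => divPow s (T.kum i g), isLocallyConstant_divPow (T.continuous_kum i) s, fun g h => by
    dsimp only
    rw [kum_mul, map_add, T.divPow_cyc_mul hs]⟩

theorem nsmul_ramChar {s t : ℕ} (hst : s + t ≤ padicValNat ℓ (q - 1)) (i : Fin d) :
    ℓ ^ t • T.ramChar hst i = T.ramChar ((Nat.le_add_right s t).trans hst) i :=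
  Subtype.ext (funext fun _ => nsmul_divPow s t _)

theorem pow_nsmul_unramChar (s t : ℕ) :
    ℓ ^ t • T.unramChar (ℓ ^ (s + t)) = T.unramChar (ℓ ^ s) := by
  have h : NeZero (ℓ ^ s * ℓ ^ t) := ⟨mul_ne_zero (NeZero.ne _) (NeZero.ne _)⟩
  simp only [pow_add]
  exact T.nsmul_unramChar (ℓ ^ s) (ℓ ^ t)

theorem divQmodZ_eq_divPow_of_zpow_eq {s : ℕ} {k : ℤ} {z : ℤ_[ℓ]} (h : T.zeta s ^ k = T.ex s z) :
    divQmodZ (ℓ ^ s) (k : ZMod (ℓ ^ s)) = divPow s z := by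
  rw [← ex_intCast, ex_eq_iff, map_intCast] at h
  rw [divPow_eq, h]

/-- A character of `ℓ`-power order is a combination of unramified and tamely ramified
characters. -/
theorem exists_eq_sum_char {s : ℕ} {θ : CharGroup F} (hθ : ℓ ^ s • θ = 0) {t : ℕ}
    (ht : t = min (padicValNat ℓ (q - 1)) s) :
    ∃ (k : ℤ) (e : Fin d → ℤ), θ = k • T.unramChar (ℓ ^ s) +
      ∑ i, e i • T.ramChar (ht.trans_le (min_le_left _ _)) i := by
  have hθg : ∀ g, ℓ ^ s • θ.1 g = 0 := fun g => congrFun (congrArg Subtype.val hθ) g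
  have hts : t ≤ s := ht.trans_le (min_le_right _ _)
  set κ : GalSep F → SepUnits F := fun g => T.zeta s ^ numer (ℓ ^ s) (θ.1 g) with hκ
  have hκm : ∀ g h, κ (g * h) = κ g * κ h := fun g h => by
    simp only [hκ, θ.2.2]
    exact zpow_numer_add (NeZero.ne _) (T.zeta_pow_eq_one s) (hθg g) (hθg h)
  have hκc : IsLocallyConstant κ := θ.2.1.comp fun a => T.zeta s ^ numer (ℓ ^ s) a
  have hκ1 : ∀ g, κ g ^ ℓ ^ s = 1 := fun g => by
    rw [hκ]
    dsimp only
    rw [← zpow_natCast, ← zpow_mul, mul_comm, zpow_mul, zpow_natCast, T.zeta_pow_eq_one, one_zpow]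
  have hκθ : ∀ g z, κ g = T.ex s z → θ.1 g = divPow s z := fun g z h => by
    rw [← T.divQmodZ_eq_divPow_of_zpow_eq h, divQmodZ_intCast,
      numer_spec (NeZero.ne _) (hθg g)]
  obtain ⟨e, he⟩ := exists_eq_ex_sum (T := T) (s := Finset.univ) hκc (fun g _ h _ => hκm g h)
    (fun g _ => hκ1 g)
  rw [kumKer_univ] at he
  -- Conjugation by the Frobenius multiplies `kum i` by `q` and fixes `κ`.
  have hdvd : ∀ i, (ℓ : ℤ) ^ (s - t) ∣ e i := by
    intro i
    have h1 : T.frob * T.tau i * T.frob⁻¹ ∈ T.inertia :=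
      Subgroup.Normal.conj_mem inferInstance _ (T.tau_mem i) T.frob
    have h2 : κ (T.frob * T.tau i * T.frob⁻¹) = κ (T.tau i) := by
      have h3 := hκm (T.frob * T.tau i * T.frob⁻¹) T.frob
      rw [inv_mul_cancel_right, hκm, mul_comm, mul_left_inj] at h3
      exact h3.symm
    rw [he _ h1, he _ (T.tau_mem i), ex_eq_iff, PadicInt.toZModPow_eq_iff] at h2
    simp only [T.kum_conj_frob _ (T.tau_mem i), T.kum_tau] at h2
    simp only [mul_ite, mul_one, mul_zero, Finset.sum_ite_eq',
      Finset.mem_univ, if_true] at h2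
    obtain ⟨u, hu, hq⟩ := T.exists_unit_q_sub_one
    have h4 : (e i : ℤ_[ℓ]) * q - e i = u * (ℓ ^ padicValNat ℓ (q - 1) * e i) := by
      linear_combination (e i : ℤ_[ℓ]) * hq
    rw [h4, hu.dvd_mul_left] at h2
    have h5 : (ℓ : ℤ_[ℓ]) ^ (s - t) ∣ (e i : ℤ_[ℓ]) := by
      rcases le_total s (padicValNat ℓ (q - 1)) with hle | hle
      · rw [min_eq_right hle] at ht
        rw [ht, Nat.sub_self, pow_zero]
        exact one_dvd _
      · rw [min_eq_left hle] at ht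
        rw [ht] at hts ⊢
        rw [← Nat.add_sub_cancel' hts, pow_add] at h2
        exact (mul_dvd_mul_iff_left (pow_ne_zero _ (by exact_mod_cast T.prime.ne_zero))).1 h2
    exact (PadicInt.pow_p_dvd_int_iff _ _).1 h5
  choose e' he' using hdvd
  have hin : ∀ g ∈ T.inertia, θ.1 g = ∑ i, e' i • divPow t (T.kum i g) := by
    intro g hg
    rw [hκθ g _ (he g hg)]
    have h1 : ∑ i, (e i : ℤ_[ℓ]) * T.kum i g = ℓ ^ (s - t) * ∑ i, (e' i : ℤ_[ℓ]) * T.kum i g := by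
      rw [Finset.mul_sum]
      refine Finset.sum_congr rfl fun i _ => ?_
      rw [he' i]
      push_cast
      ring
    have h2 := divPow_pow_mul t (s - t) (∑ i, (e' i : ℤ_[ℓ]) * T.kum i g)
    rw [Nat.add_sub_cancel' hts] at h2
    rw [h1, h2, map_sum]
    refine Finset.sum_congr rfl fun i _ => ?_
    rw [← zsmul_eq_mul, map_zsmul]
  have hval : ∀ g, (∑ i, e' i • T.ramChar (ht.trans_le (min_le_left _ _)) i).1 g =
      ∑ i, e' i • divPow t (T.kum i g) := fun g => CharGroup.val_sum_zsmul _ _ _ g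
  obtain ⟨k, hk⟩ : ∃ k : ℤ, divQmodZ (ℓ ^ s) (k : ZMod (ℓ ^ s)) =
      θ.1 T.frob - ∑ i, e' i • divPow t (T.kum i T.frob) := by
    apply exists_divQmodZ
    rw [smul_sub, hθg, zero_sub, neg_eq_zero, Finset.smul_sum]
    refine Finset.sum_eq_zero fun i _ => ?_
    rw [smul_comm, ← Nat.sub_add_cancel hts, pow_add, mul_smul, pow_nsmul_divPow, smul_zero,
      smul_zero]
  refine ⟨k, e', T.charGroup_ext (fun g hg => ?_) ?_⟩
  · change _ = k • divQmodZ (ℓ ^ s) (T.deg (ℓ ^ s) g) + _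
    rw [hval, hin g hg, T.deg_inertia _ hg, map_zero, smul_zero, zero_add]
  · change _ = k • divQmodZ (ℓ ^ s) (T.deg (ℓ ^ s) T.frob) + _
    rw [hval, T.deg_frob, ← map_zsmul, zsmul_one, hk, sub_add_cancel]


section Basis

variable {T} {r μ : ℕ}

omit [Fact ℓ.Prime] in
theorem le_of_add_twoExp_eq (hμ : μ + twoExp ℓ = min (padicValNat ℓ (q - 1)) (r + twoExp ℓ)) :
    μ ≤ padicValNat ℓ (q - 1) ∧ μ ≤ r := by
  omega

variable (T) (hμ : μ + twoExp ℓ = min (padicValNat ℓ (q - 1)) (r + twoExp ℓ))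

/-- The unramified character of order `ℓ ^ r`. -/
def charZero (r : ℕ) : CharTwice F (ℓ ^ r) :=
  ⟨T.unramChar (ℓ ^ r), (mem_nTorsionOfTwice_iff T.prime r).2
    ⟨T.unramChar (ℓ ^ (r + twoExp ℓ)), T.pow_nsmul_unramChar r _,
    Subtype.ext (funext fun _ => nsmul_divQmodZ _ _)⟩⟩

/-- The tamely ramified characters of order `ℓ ^ μ`. -/
def charSucc (i : Fin d) : CharTwice F (ℓ ^ r) :=
  ⟨T.ramChar (le_of_add_twoExp_eq hμ).1 i, (mem_nTorsionOfTwice_iff T.prime r).2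
    ⟨T.ramChar (hμ.trans_le (min_le_left _ _)) i, T.nsmul_ramChar _ i,
    Subtype.ext (funext fun g => by
      change ℓ ^ (r + twoExp ℓ) • divPow (μ + twoExp ℓ) _ = 0
      have h := (le_of_add_twoExp_eq hμ).2
      rw [show r + twoExp ℓ = (r - μ) + (μ + twoExp ℓ) by omega, pow_add, mul_smul,
        pow_nsmul_divPow, smul_zero])⟩⟩

/-- The basis of the character group. -/
def charBasis : Fin (d + 1) → CharTwice F (ℓ ^ r) := Fin.cons (T.charZero r) (T.charSucc hμ)

theorem charBasis_zero : T.charBasis hμ 0 = T.charZero r := rfl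

theorem val_charZero (g : GalSep F) : (T.charZero r).val g = divQmodZ (ℓ ^ r) (T.deg (ℓ ^ r) g) :=
  rfl

theorem val_charSucc (i : Fin d) (g : GalSep F) :
    (T.charSucc hμ i).val g = divPow μ (T.kum i g) := rfl

theorem val_sum_charBasis (b : Fin (d + 1) → ℤ) (g : GalSep F) :
    (∑ i, b i • T.charBasis hμ i).val g = b 0 • divQmodZ (ℓ ^ r) (T.deg (ℓ ^ r) g) +
      ∑ i : Fin d, b i.succ • divPow μ (T.kum i g) := by
  rw [CharTwice.val_sum_zsmul, Fin.sum_univ_succ]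
  rfl

theorem val_sum_charBasis_tau (b : Fin (d + 1) → ℤ) (i : Fin d) :
    (∑ i, b i • T.charBasis hμ i).val (T.tau i) = b i.succ • divPow μ (1 : ℤ_[ℓ]) := by
  rw [val_sum_charBasis, T.deg_inertia _ (T.tau_mem i), map_zero, smul_zero, zero_add,
    Finset.sum_eq_single i]
  · rw [kum_tau, if_pos rfl]
  · intro j _ hj
    rw [kum_tau, if_neg hj, map_zero, smul_zero]
  · simp

theorem pow_nsmul_charSucc (i : Fin d) : ℓ ^ μ • T.charSucc hμ i = 0 :=
  CharTwice.ext fun _ => pow_nsmul_divPow _ _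

/-- A character in twice the character group is `ℓ ^ twoExp ℓ` times one killed by
`ℓ ^ (r + twoExp ℓ)`, and multiplication by `ℓ ^ twoExp ℓ` takes the unramified and tamely ramified
characters of that level to the basis. -/
theorem exists_eq_sum_charBasis (θ : CharTwice F (ℓ ^ r)) :
    ∃ b : Fin (d + 1) → ℤ, θ = ∑ i, b i • T.charBasis hμ i := by
  obtain ⟨η, hη, hη'⟩ := (mem_nTorsionOfTwice_iff T.prime r).1 θ.2
  obtain ⟨k, e, h⟩ := T.exists_eq_sum_char hη' hμ
  refine ⟨Fin.cons k e, CharTwice.ext fun g => ?_⟩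
  have h1 : θ.val g = ℓ ^ twoExp ℓ • η.1 g := congrFun (congrArg Subtype.val hη.symm) g
  have h2 : η.1 g = k • (T.unramChar (ℓ ^ (r + twoExp ℓ))).1 g +
      ∑ i, e i • (T.ramChar (hμ.trans_le (min_le_left _ _)) i).1 g := by
    rw [← CharGroup.val_sum_zsmul]
    exact congrFun (congrArg Subtype.val h) g
  rw [val_sum_charBasis, h1, h2, smul_add, smul_comm, Finset.smul_sum]
  congr 1
  · congr 1
    exact congrFun (congrArg Subtype.val (T.pow_nsmul_unramChar r (twoExp ℓ))) g
  · refine Finset.sum_congr rfl fun i _ => ?_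
    rw [smul_comm]
    congr 1
    exact nsmul_divPow _ _ _

theorem isAbelianBasis_charBasis : IsAbelianBasis (T.charBasis hμ) := by
  refine ⟨eq_top_iff.2 fun θ _ => ?_, fun b hb => ?_⟩
  · obtain ⟨b, rfl⟩ := T.exists_eq_sum_charBasis hμ θ
    exact sum_mem fun i _ => zsmul_mem (AddSubgroup.subset_closure (Set.mem_range_self i)) _
  · have hsucc : ∀ i : Fin d, (ℓ : ℤ) ^ μ ∣ b i.succ := fun i => by
      have h1 := T.val_sum_charBasis_tau hμ b i
      rw [hb] at h1
      exact dvd_of_zsmul_divPow_one h1.symm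
    refine Fin.cases ?_ fun i => ?_
    · have h1 := T.val_sum_charBasis hμ b T.frob
      rw [hb, Finset.sum_eq_zero, add_zero, T.deg_frob, ← divPow_one] at h1
      · refine zsmul_eq_zero_of_dvd (CharTwice.nsmul_eq_zero _) ?_
        exact_mod_cast dvd_of_zsmul_divPow_one h1.symm
      · exact fun i _ => zsmul_eq_zero_of_dvd (pow_nsmul_divPow μ _) (by exact_mod_cast hsucc i)
    · exact zsmul_eq_zero_of_dvd (T.pow_nsmul_charSucc hμ i) (by exact_mod_cast hsucc i)

/-- A character killed by `ℓ ^ μ` and taking the value `1 / ℓ ^ μ` has order `ℓ ^ μ`. -/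
theorem addOrderOf_eq {θ : CharTwice F (ℓ ^ r)} (h : ℓ ^ μ • θ = 0) {g : GalSep F}
    (hg : θ.val g = divPow μ (1 : ℤ_[ℓ])) : addOrderOf θ = ℓ ^ μ := by
  refine dvd_antisymm (addOrderOf_dvd_of_nsmul_eq_zero h) ?_
  have h1 : addOrderOf θ • θ.val g = 0 := by
    rw [← CharTwice.evalHom_apply, ← map_nsmul, addOrderOf_nsmul_eq_zero, map_zero]
  rw [hg, ← natCast_zsmul] at h1
  exact_mod_cast dvd_of_zsmul_divPow_one h1

theorem addOrderOf_charZero : addOrderOf (T.charZero r) = ℓ ^ r := by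
  refine addOrderOf_eq (CharTwice.nsmul_eq_zero _) (g := T.frob) ?_
  rw [val_charZero, T.deg_frob, divPow_one]

theorem addOrderOf_charSucc (i : Fin d) : addOrderOf (T.charSucc hμ i) = ℓ ^ μ := by
  refine addOrderOf_eq (T.pow_nsmul_charSucc hμ i) (g := T.tau i) ?_
  rw [val_charSucc, kum_tau, if_pos rfl]

end Basis

end KummerFrame

namespace KummerFrame

open scoped Matrix

variable {F : Type*} [Field F] {ℓ q d : ℕ} (T : KummerFrame F ℓ q d) [Fact ℓ.Prime]

/-- The Kummer cocycle of `unif i`. -/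
def cocycleSucc (r : ℕ) (i : Fin d) : KummerZ1 F (ℓ ^ r) :=
  Additive.ofMul ⟨fun g => T.ex r (T.kum i g), isLocallyConstant_ex (T.continuous_kum i) r,
    fun g h => by
      dsimp only
      rw [kum_mul, ex_add, smul_ex, mul_comm], fun g => ex_pow_eq_one r _⟩

theorem val_cocycleSucc (r : ℕ) (i : Fin d) (g : GalSep F) :
    (T.cocycleSucc r i).val g = T.ex r (T.kum i g) := rfl

omit [Fact ℓ.Prime] in
theorem exists_unramRoot (r : ℕ) : ∃ y : SepUnits F, y ^ (q - 1) = T.zeta r :=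
  T.exists_root 1 one_pos (q - 1) (by rw [pow_one]) _

/-- A root of unity whose power with exponent `q - 1` has order `ℓ ^ r`. -/
def unramRoot (r : ℕ) : SepUnits F := (T.exists_unramRoot r).choose

omit [Fact ℓ.Prime] in
theorem unramRoot_pow (r : ℕ) : T.unramRoot r ^ (q - 1) = T.zeta r :=
  (T.exists_unramRoot r).choose_spec

omit [Fact ℓ.Prime] in
theorem smul_unramRoot_pow (r : ℕ) (g : GalSep F) :
    g • T.unramRoot r ^ ℓ ^ r = T.unramRoot r ^ ℓ ^ r := by
  refine T.smul_eq_of_pow_sub_one_eq_one ?_ g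
  rw [← pow_mul, mul_comm, pow_mul, unramRoot_pow, zeta_pow_eq_one]

/-- The unramified Kummer cocycle: that of the root of unity `unramRoot r ^ ℓ ^ r` of the field. It
takes the value `zeta r` at the Frobenius. -/
def cocycleZero (r : ℕ) : KummerZ1 F (ℓ ^ r) :=
  Additive.ofMul ⟨fun g => g • T.unramRoot r / T.unramRoot r,
    (isLocallyConstant_galSep_smul _).comp (· / T.unramRoot r),
    fun g h => by
      dsimp only
      rw [smul_div', mul_smul, div_mul_div_cancel], fun g => by
      rw [div_pow, ← smul_pow', smul_unramRoot_pow, div_self']⟩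

omit [Fact ℓ.Prime] in
theorem val_cocycleZero (r : ℕ) (g : GalSep F) :
    (T.cocycleZero r).val g = g • T.unramRoot r / T.unramRoot r := rfl

omit [Fact ℓ.Prime] in
theorem unramRoot_pow_eq_one (r : ℕ) : T.unramRoot r ^ ((q - 1) * ℓ ^ r) = 1 := by
  rw [pow_mul, unramRoot_pow, zeta_pow_eq_one]

omit [Fact ℓ.Prime] in
theorem val_cocycleZero_inertia (r : ℕ) {g : GalSep F} (hg : g ∈ T.inertia) :
    (T.cocycleZero r).val g = 1 := by
  have hpos : 0 < (q - 1) * ℓ ^ r :=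
    Nat.mul_pos (by have := T.one_lt; omega) (pow_pos T.prime.pos r)
  rw [val_cocycleZero, T.inertia_smul_eq hpos
    (T.coprime_sub_one.mul_right (T.coprime.pow_right r)) (T.unramRoot_pow_eq_one r) hg, div_self']

omit [Fact ℓ.Prime] in
theorem val_cocycleZero_frob (r : ℕ) : (T.cocycleZero r).val T.frob = T.zeta r := by
  have hpos : 0 < (q - 1) * ℓ ^ r :=
    Nat.mul_pos (by have := T.one_lt; omega) (pow_pos T.prime.pos r)
  rw [val_cocycleZero, T.frob_smul_eq hpos
    (T.coprime_sub_one.mul_right (T.coprime.pow_right r)) (T.unramRoot_pow_eq_one r),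
    div_eq_iff_eq_mul, ← T.unramRoot_pow, ← pow_succ, Nat.sub_add_cancel T.one_lt.le]

/-- The basis of the group of Kummer cocycles. -/
def cocycleBasis (r : ℕ) : Fin (d + 1) → KummerZ1 F (ℓ ^ r) :=
  Fin.cons (T.cocycleZero r) (T.cocycleSucc r)

theorem cocycleBasis_zero (r : ℕ) : T.cocycleBasis r 0 = T.cocycleZero r := rfl

theorem cocycleBasis_succ (r : ℕ) (i : Fin d) : T.cocycleBasis r i.succ = T.cocycleSucc r i := rfl

theorem val_sum_cocycleBasis {r : ℕ} (b : Fin (d + 1) → ℤ) (g : GalSep F) :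
    (∑ i, b i • T.cocycleBasis r i).val g = (T.cocycleZero r).val g ^ b 0 *
      T.ex r (∑ i : Fin d, (b i.succ : ℤ_[ℓ]) * T.kum i g) := by
  rw [KummerZ1.val_sum_zsmul, Fin.prod_univ_succ, ex_sum]
  simp only [ex_intCast_mul]
  rfl

theorem exists_eq_sum_cocycleBasis {r : ℕ} (z : KummerZ1 F (ℓ ^ r)) :
    ∃ b : Fin (d + 1) → ℤ, z = ∑ i, b i • T.cocycleBasis r i := by
  obtain ⟨e, he⟩ := exists_eq_ex_sum (T := T) (s := Finset.univ) z.prop.1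
    (fun g hg h _ => by
      rw [z.prop.2.1, T.smul_eq_of_pow_eq_one hg.1 (z.prop.2.2 h), mul_comm])
    (fun g _ => z.prop.2.2 g)
  rw [kumKer_univ] at he
  obtain ⟨k, hk⟩ := exists_zpow_eq (T := T) (s := r)
    (w := z.val T.frob / T.ex r (∑ i, (e i : ℤ_[ℓ]) * T.kum i T.frob))
    (by rw [div_pow, z.prop.2.2, ex_pow_eq_one, div_one])
  refine ⟨Fin.cons k e, T.kummerZ1_ext (fun g hg => ?_) ?_⟩
  · rw [val_sum_cocycleBasis, T.val_cocycleZero_inertia r hg, one_zpow, one_mul, he g hg]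
    rfl
  · rw [val_sum_cocycleBasis, T.val_cocycleZero_frob]
    exact div_eq_iff_eq_mul.1 hk

theorem isAbelianBasis_cocycleBasis (r : ℕ) : IsAbelianBasis (T.cocycleBasis r) := by
  refine ⟨eq_top_iff.2 fun z _ => ?_, fun b hb => ?_⟩
  · obtain ⟨b, rfl⟩ := T.exists_eq_sum_cocycleBasis z
    exact sum_mem fun i _ => zsmul_mem (AddSubgroup.subset_closure (Set.mem_range_self i)) _
  · have hval : ∀ g, (T.cocycleZero r).val g ^ b 0 *
        T.ex r (∑ i : Fin d, (b i.succ : ℤ_[ℓ]) * T.kum i g) = 1 := fun g => by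
      rw [← val_sum_cocycleBasis, hb]
      rfl
    have hsucc : ∀ i : Fin d, (ℓ : ℤ_[ℓ]) ^ r ∣ (b i.succ : ℤ_[ℓ]) := fun i => by
      have h1 := hval (T.tau i)
      rw [T.val_cocycleZero_inertia r (T.tau_mem i), one_zpow, one_mul, ex_eq_one_iff_dvd] at h1
      simpa [T.kum_tau] using h1
    refine Fin.cases ?_ fun i => ?_
    · refine zsmul_eq_zero_of_dvd (KummerZ1.nsmul_eq_zero _) ?_
      have h1 := hval T.frob
      rw [T.val_cocycleZero_frob, ex_eq_one_iff_dvd.2 (Finset.dvd_sum fun i _ =>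
        Dvd.dvd.mul_right (hsucc i) _), mul_one, ← orderOf_dvd_iff_zpow_eq_one,
        T.orderOf_zeta] at h1
      exact h1
    · refine zsmul_eq_zero_of_dvd (KummerZ1.nsmul_eq_zero _) ?_
      exact_mod_cast (PadicInt.pow_p_dvd_int_iff _ _).1 (hsucc i)

/-! ### Cup products of basis elements -/

/-- The pairing `(1/ℓ^r)ℤ/ℤ ⊗ μ → μ` in terms of `ℓ`-adic exponents. -/
theorem zpow_numer_divPow {r μ : ℕ} (hμ : μ ≤ r) (a b : ℤ_[ℓ]) :
    T.ex r b ^ numer (ℓ ^ r) (divPow μ a) = T.ex μ (a * b) := by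
  obtain ⟨k, hk⟩ := exists_int_approx r ((ℓ : ℤ_[ℓ]) ^ (r - μ) * a)
  have h1 := divPow_pow_mul μ (r - μ) a
  have h2 := ex_pow_mul (T := T) μ (r - μ) (a * b)
  rw [Nat.add_sub_cancel' hμ] at h1 h2
  rw [← h1, divPow_eq, hk, zpow_numer_divQmodZ (ex_pow_eq_one r b), ← ex_intCast_mul, ← h2,
    ex_eq_iff, ← mul_assoc, map_mul, map_mul, hk, map_intCast]

theorem cupCochain_charSucc {r μ : ℕ}
    (hμ : μ + twoExp ℓ = min (padicValNat ℓ (q - 1)) (r + twoExp ℓ)) (i j : Fin d) :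
    cupCochain (T.charSucc hμ i) (T.cocycleSucc r j) = T.sym (padicValNat ℓ (q - 1))
      ((ℓ : ℤ_[ℓ]) ^ (padicValNat ℓ (q - 1) - μ) • Matrix.single i j 1) := by
  obtain ⟨h1, h2⟩ := le_of_add_twoExp_eq hμ
  funext p
  have h3 := sym_pow_smul (T := T) μ (padicValNat ℓ (q - 1) - μ) (Matrix.single i j 1)
  rw [Nat.add_sub_cancel' h1] at h3
  rw [h3, cupCochain, val_charSucc, val_cocycleSucc, smul_ex, T.zpow_numer_divPow h2,
    mul_left_comm, ← smul_ex, T.smul_ex_of_le h1, sym]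
  congr 1
  simp [Matrix.single_mulVec, kumVec, dotProduct, Function.update_apply]

theorem cupClass_charSucc {r μ : ℕ}
    (hμ : μ + twoExp ℓ = min (padicValNat ℓ (q - 1)) (r + twoExp ℓ)) (i j : Fin d) :
    cupClass (T.charSucc hμ i) (T.cocycleSucc r j) = T.symClass
      ((ℓ : ℤ_[ℓ]) ^ (padicValNat ℓ (q - 1) - μ) • Matrix.single i j 1) :=
  congrArg BrGroup.mk (Subtype.ext (T.cupCochain_charSucc hμ i j))

/-- The cup product of the unramified character with the cocycle of a root is the class of an
unramified cyclic algebra. -/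
theorem splitsOn_cupCochain_charZero {r : ℕ} {z : KummerZ1 F (ℓ ^ r)} {y : SepUnits F}
    (hz : ∀ g, z.val g = g • y / y) (hy : ∀ g : GalSep F, g • y ^ ℓ ^ r = y ^ ℓ ^ r) :
    SplitsOn ⊤ (cupCochain (T.charZero r) z / T.unram (ℓ ^ r) (y ^ ℓ ^ r)) := by
  have hlc : IsLocallyConstant fun g : GalSep F => (g • y) ^ (T.deg (ℓ ^ r) g).val :=
    ((isLocallyConstant_galSep_smul y).prodMk (T.isLocallyConstant_deg (ℓ ^ r))).comp
      fun p : SepUnits F × ZMod (ℓ ^ r) => p.1 ^ p.2.val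
  refine SplitsOn.congr (SplitsOn.inv ⟨_, hlc, fun g _ h _ => rfl⟩) fun g _ h _ => ?_
  have h1 := cup_smul_div_mul_coboundary (y := y) (T.deg_mul (ℓ ^ r) g h) (hy (g * h))
  have h2 : cupCochain (T.charZero r) z (g, h) = (g • (h • y / y)) ^ (T.deg (ℓ ^ r) g).val := by
    have h3 : (T.charZero r).val g =
        divQmodZ (ℓ ^ r) (((T.deg (ℓ ^ r) g).val : ℤ) : ZMod (ℓ ^ r)) := by
      rw [val_charZero]
      simp
    simp only [cupCochain]
    rw [h3, zpow_numer_divQmodZ (z.smul_pow_eq_one g h), hz, zpow_natCast]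
  rw [Pi.div_apply, Pi.inv_apply, h2, TameFrame.unram, ← h1, div_mul_cancel_left]

theorem cupClass_charZero_cocycleSucc (r : ℕ) (j : Fin d) :
    cupClass (T.charZero r) (T.cocycleSucc r j) = T.unramClass (ℓ ^ r) j := by
  refine BrGroup.mk_eq_iff.2 ?_
  have h := T.splitsOn_cupCochain_charZero (z := T.cocycleSucc r j) (y := T.root j r)
    (fun g => by rw [val_cocycleSucc, smul_root, mul_div_cancel_right])
    (fun g => by rw [root_pow_eq_unif, T.unif_fixed])
  rwa [T.root_pow_eq_unif] at h

theorem cupClass_charZero_cocycleZero (r : ℕ) :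
    cupClass (T.charZero r) (T.cocycleZero r) = 0 := by
  refine BrGroup.mk_eq_zero_iff.2 ?_
  refine SplitsOn.of_div_right (T.splitsOn_cupCochain_charZero (T.val_cocycleZero r)
    (T.smul_unramRoot_pow r)) (T.splitsOn_unram_of_pow_eq_one ?_)
  rw [← pow_mul, mul_comm, unramRoot_pow_eq_one]

end KummerFrame

/-! ### The characters attached to Kummer cocycles -/

namespace KummerFrame

variable {F : Type*} [Field F] {ℓ q d : ℕ} (T : KummerFrame F ℓ q d) [Fact ℓ.Prime] {r μ : ℕ}

/-- The isomorphism `ζ` sends `zeta r` to `1 / ℓ ^ r`. -/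
def IsCompatible (T : KummerFrame F ℓ q d) (ζ : RootsIso F (ℓ ^ r)) : Prop :=
  (Additive.toMul (ζ.symm ⟨divQmodZ (ℓ ^ r) 1, nsmul_divQmodZ _ _⟩)).1 = T.zeta r

variable {T} {ζ : RootsIso F (ℓ ^ r)} (hζ : T.IsCompatible ζ)

include hζ in
/-- On the value `ζ ^ a` of a cocycle, `ζ` of order `ℓ ^ r`, the attached character of level `ℓ ^ μ`
is `a / ℓ ^ μ`. -/
theorem starChar_eq (hμ : μ ≤ r) {z : KummerZ1 F (ℓ ^ r)} {g : GalSep F} {a : ℤ_[ℓ]}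
    (hz : z.val g = T.ex r a) : starChar ζ z (ℓ ^ μ) g = divPow μ a := by
  obtain ⟨k, hk⟩ := exists_int_approx r a
  rw [ex_eq_zpow_of_toZModPow hk] at hz
  set w : Additive (rootsOfUnity (ℓ ^ r) (SeparableClosure F)) :=
    ζ.symm ⟨divQmodZ (ℓ ^ r) 1, nsmul_divQmodZ _ _⟩ with hw
  have h1 : starChar ζ z (ℓ ^ μ) g = (ζ (ℓ ^ (r - μ) • k • w)).1 := by
    unfold starChar
    congr 2
    refine Additive.toMul.injective (Subtype.ext ?_)
    change z.val g ^ (ℓ ^ r / ℓ ^ μ) = ((Additive.toMul w).1 ^ k) ^ ℓ ^ (r - μ)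
    have h2 : (Additive.toMul w).1 = T.zeta r := hζ
    rw [h2, Nat.pow_div hμ T.prime.pos, hz]
    rfl
  rw [h1, map_nsmul, map_zsmul, hw, AddEquiv.apply_symm_apply]
  change ℓ ^ (r - μ) • k • divQmodZ (ℓ ^ r) 1 = _
  have h3 := nsmul_divPow μ (r - μ) a
  rw [Nat.add_sub_cancel' hμ] at h3
  rw [← h3, divPow_eq r, hk, ← map_zsmul, zsmul_one]

include T in
theorem exists_val_eq_ex (z : KummerZ1 F (ℓ ^ r)) :
    ∃ a : GalSep F → ℤ, IsLocallyConstant a ∧ ∀ g, z.val g = T.ex r (a g : ℤ_[ℓ]) := by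
  have h : ∀ w : SepUnits F, ∃ k : ℤ, w ^ ℓ ^ r = 1 → w = T.ex r (k : ℤ_[ℓ]) := fun w => by
    by_cases hw : w ^ ℓ ^ r = 1
    · obtain ⟨k, hk⟩ := exists_zpow_eq (T := T) hw
      exact ⟨k, fun _ => by rw [ex_intCast, hk]⟩
    · exact ⟨0, fun h => absurd h hw⟩
  choose α hα using h
  exact ⟨α ∘ z.val, z.prop.1.comp α, fun g => hα _ (z.prop.2.2 g)⟩

include hζ in
theorem starChar_add (hμ : μ ≤ r) (z w : KummerZ1 F (ℓ ^ r)) :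
    starChar ζ (z + w) (ℓ ^ μ) = starChar ζ z (ℓ ^ μ) + starChar ζ w (ℓ ^ μ) := by
  obtain ⟨a, -, ha⟩ := exists_val_eq_ex (T := T) z
  obtain ⟨b, -, hb⟩ := exists_val_eq_ex (T := T) w
  funext g
  rw [Pi.add_apply, starChar_eq hζ hμ (ha g), starChar_eq hζ hμ (hb g), ← map_add,
    starChar_eq hζ hμ]
  rw [KummerZ1.val_add, ha, hb, ex_add]

include hζ in
/-- The cup product of a cocycle with its own character vanishes. -/
theorem cupClass_eq_zero_of_val_eq_starChar
    (hμ : μ + twoExp ℓ = min (padicValNat ℓ (q - 1)) (r + twoExp ℓ)) {θ : CharTwice F (ℓ ^ r)}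
    {z : KummerZ1 F (ℓ ^ r)} (h : θ.val = starChar ζ z (ℓ ^ μ)) : cupClass θ z = 0 := by
  obtain ⟨hv, hr⟩ := le_of_add_twoExp_eq hμ
  refine BrGroup.mk_eq_zero_iff.2 ?_
  obtain ⟨a, hac, ha⟩ := exists_val_eq_ex (T := T) z
  have hcup : ∀ g h, cupCochain θ z (g, h) = T.ex μ ((a g : ℤ_[ℓ]) * a h) := fun g j => by
    simp only [cupCochain]
    rw [h, starChar_eq hζ hr (ha g), ha, smul_ex, T.zpow_numer_divPow hr, mul_left_comm,
      ← smul_ex, T.smul_ex_of_le hv]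
  rcases Nat.eq_zero_or_pos μ with rfl | hpos
  · refine SplitsOn.one.congr fun g _ j _ => ?_
    change cupCochain θ z (g, j) = 1
    rw [hcup, ex_eq_one_iff_dvd, pow_zero]
    exact one_dvd _
  -- A primitive is half the square of the exponent of `z`; replacing the exponent by a congruent
  -- one modulo `ℓ ^ μ` does not change it because `μ + twoExp ℓ ≤ 2 * μ`.
  obtain ⟨u, hu⟩ := T.exists_half μ
  refine ⟨fun g => T.ex (μ + twoExp ℓ) (-(u * ((a g : ℤ) : ℤ_[ℓ]) ^ 2)),
    hac.comp fun k : ℤ => T.ex (μ + twoExp ℓ) (-(u * (k : ℤ_[ℓ]) ^ 2)), fun g _ j _ => ?_⟩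
  have hadd : ∃ c : ℤ_[ℓ], (a (g * j) : ℤ_[ℓ]) = a g + a j + ℓ ^ μ * c := by
    have h1 : T.ex μ (a (g * j) : ℤ_[ℓ]) = T.ex μ (a g + a j) := by
      have h2 := ha (g * j)
      rw [z.prop.2.1, ha, ha, smul_ex, ← ex_add, ex_eq_iff, PadicInt.toZModPow_eq_iff] at h2
      have h3 : T.ex μ (T.cyc g * a j + a g) = T.ex μ (a (g * j) : ℤ_[ℓ]) := by
        rw [ex_eq_iff, PadicInt.toZModPow_eq_iff]
        exact (pow_dvd_pow _ hr).trans h2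
      rw [← h3, ex_add, ← smul_ex, T.smul_ex_of_le hv, ← ex_add, add_comm]
    rw [ex_eq_iff, PadicInt.toZModPow_eq_iff] at h1
    obtain ⟨c, hc⟩ := h1
    exact ⟨c, by linear_combination hc⟩
  obtain ⟨c, hc⟩ := hadd
  have htwo : μ + twoExp ℓ ≤ 2 * μ := by
    have : twoExp ℓ ≤ 1 := by unfold twoExp; split_ifs <;> omega
    omega
  have h4 : T.ex (μ + twoExp ℓ) (2 * (u * (ℓ ^ μ * ((a g + a j) * c)))) = 1 := by
    rw [hu, ex_eq_one_iff_dvd]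
    exact dvd_mul_right _ _
  have h5 : T.ex (μ + twoExp ℓ) (ℓ ^ (2 * μ) * (u * c ^ 2)) = 1 := by
    rw [ex_eq_one_iff_dvd]
    exact (pow_dvd_pow _ htwo).trans (dvd_mul_right _ _)
  refine (hcup g j).trans ?_
  rw [coboundary]
  dsimp only
  rw [T.smul_ex_of_le (hμ.trans_le (min_le_left _ _)), ← ex_sub, ← ex_add, hc, ← hu]
  have h6 : -(u * (a j : ℤ_[ℓ]) ^ 2) - -(u * (a g + a j + ℓ ^ μ * c) ^ 2) + -(u * (a g : ℤ_[ℓ]) ^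
    2) =
      2 * (u * (a g * a j)) + 2 * (u * (ℓ ^ μ * ((a g + a j) * c))) +
        ℓ ^ (2 * μ) * (u * c ^ 2) := by
    ring
  rw [h6, ex_add, ex_add, h4, h5, mul_one, mul_one]

include hζ in
theorem val_charSucc_eq_starChar
    (hμ : μ + twoExp ℓ = min (padicValNat ℓ (q - 1)) (r + twoExp ℓ)) (i : Fin d) :
    (T.charSucc hμ i).val = starChar ζ (T.cocycleSucc r i) (ℓ ^ μ) :=
  funext fun g => (starChar_eq hζ (le_of_add_twoExp_eq hμ).2 (T.val_cocycleSucc r i g)).symm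

include hζ in
/-- Both sides are unramified characters, and they agree at the Frobenius. -/
theorem val_charZero_eq_starChar
    (hμ : μ + twoExp ℓ = min (padicValNat ℓ (q - 1)) (r + twoExp ℓ)) :
    (ℓ ^ (r - μ) • T.charZero r).val = starChar ζ (T.cocycleZero r) (ℓ ^ μ) := by
  obtain ⟨hv, hr⟩ := le_of_add_twoExp_eq hμ
  obtain ⟨a, hac, ha⟩ := exists_val_eq_ex (T := T) (T.cocycleZero r)
  have hstar : ∀ g, starChar ζ (T.cocycleZero r) (ℓ ^ μ) g = divPow μ (a g : ℤ_[ℓ]) := fun g =>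
    starChar_eq hζ hr (ha g)
  let η : CharGroup F := ⟨starChar ζ (T.cocycleZero r) (ℓ ^ μ), by
    rw [funext hstar]
    exact hac.comp fun k : ℤ => divPow μ (k : ℤ_[ℓ]), fun g h => by
      have h1 : (T.cocycleZero r).val (g * h) = T.ex r (T.cyc g * a h + a g) := by
        rw [(T.cocycleZero r).prop.2.1, ha, ha, smul_ex, ex_add]
      rw [starChar_eq hζ hr h1, map_add, T.divPow_cyc_mul hv, hstar, hstar, add_comm]⟩
  have h2 : (ℓ ^ (r - μ) • T.charZero r).1 = η := by
    refine T.charGroup_ext (fun g hg => ?_) ?_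
    · change ℓ ^ (r - μ) • divQmodZ (ℓ ^ r) (T.deg (ℓ ^ r) g) =
        starChar ζ (T.cocycleZero r) (ℓ ^ μ) g
      rw [T.deg_inertia _ hg, map_zero, smul_zero,
        starChar_eq hζ hr (a := 0) (by rw [T.val_cocycleZero_inertia r hg, ex_zero]), map_zero]
    · change ℓ ^ (r - μ) • divQmodZ (ℓ ^ r) (T.deg (ℓ ^ r) T.frob) =
        starChar ζ (T.cocycleZero r) (ℓ ^ μ) T.frob
      have h3 := nsmul_divPow μ (r - μ) (1 : ℤ_[ℓ])
      rw [Nat.add_sub_cancel' hr] at h3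
      rw [starChar_eq hζ hr (a := 1) (by rw [T.val_cocycleZero_frob, ex_one]), T.deg_frob,
        ← divPow_one, h3]
  exact congrArg Subtype.val h2

/-- A pair whose character has order `ℓ ^ μ` and is attached to the cocycle is normalized. -/
theorem isNormalized_of_val_eq {θ : CharTwice F (ℓ ^ r)} {z : KummerZ1 F (ℓ ^ r)}
    (h : θ.val = starChar ζ z (ℓ ^ μ)) (hθ : addOrderOf θ = ℓ ^ μ) :
    IsNormalized (ℓ ^ μ) ζ θ z := by
  unfold IsNormalized
  rw [hθ, Nat.gcd_self, Nat.div_self (NeZero.pos _), one_smul, h]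

include hζ in
/-- Adapted bases exist: the bases of the unramified and the tamely ramified characters and of the
unramified cocycle and the Kummer cocycles of the elements `unif i`. -/
theorem isAdaptedBasis (hμ : μ + twoExp ℓ = min (padicValNat ℓ (q - 1)) (r + twoExp ℓ)) :
    IsAdaptedBasis (ℓ ^ μ) d ζ (T.charBasis hμ) (T.cocycleBasis r) where
  basis_char := T.isAbelianBasis_charBasis hμ
  order_zero := T.addOrderOf_charZero
  order_succ := by
    refine Fin.cases (fun h => absurd rfl h) fun i _ => ?_
    exact T.addOrderOf_charSucc hμ i
  basis_cocycle := T.isAbelianBasis_cocycleBasis r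
  cup_zero := T.cupClass_charZero_cocycleZero r
  normalized := by
    refine Fin.cases ?_ fun i => ?_
    · unfold IsNormalized
      have hr := (le_of_add_twoExp_eq hμ).2
      rw [charBasis_zero, cocycleBasis_zero, addOrderOf_charZero,
        Nat.gcd_eq_right (pow_dvd_pow ℓ hr), Nat.pow_div hr T.prime.pos,
        val_charZero_eq_starChar hζ hμ]
    · exact isNormalized_of_val_eq (val_charSucc_eq_starChar hζ hμ i) (T.addOrderOf_charSucc hμ i)

end KummerFrame

/-! ### Bilinear combinations modulo the relations of an alternating form -/

/-- A bilinear combination of the values of a form `A` satisfying `A i i = 0`,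
`A i j = - A j i` for `i, j ≠ 0`, and `A j 0 = - k • A 0 j`, only involves `A i j` with `i < j`. -/
theorem sum_sum_zsmul_eq {d : ℕ} {B : Type*} [AddCommGroup B] {A : Fin (d + 1) → Fin (d + 1) → B}
    {k : ℕ} (hdiag : ∀ i, A i i = 0)
    (hanti : ∀ i j : Fin d, i ≠ j → A i.succ j.succ + A j.succ i.succ = 0)
    (hzero : ∀ j : Fin d, k • A 0 j.succ + A j.succ 0 = 0) (a : Fin (d + 1) → Fin (d + 1) → ℤ) :
    ∑ i, ∑ j, a i j • A i j = ∑ j : Fin d, (a 0 j.succ - k * a j.succ 0) • A 0 j.succ +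
      ∑ i : Fin d, ∑ j : Fin d,
        (if i < j then a i.succ j.succ - a j.succ i.succ else 0) • A i.succ j.succ := by
  have h1 : ∀ i : Fin d, A i.succ 0 = -((k : ℤ) • A 0 i.succ) := fun i => by
    rw [natCast_zsmul]
    exact (neg_eq_of_add_eq_zero_right (hzero i)).symm
  have h2 : ∑ i : Fin d, ∑ j : Fin d, a i.succ j.succ • A i.succ j.succ =
      ∑ i : Fin d, ∑ j : Fin d,
        (if i < j then a i.succ j.succ - a j.succ i.succ else 0) • A i.succ j.succ := by
    rw [← sub_eq_zero, ← Finset.sum_sub_distrib]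
    simp_rw [← Finset.sum_sub_distrib, ← sub_smul]
    rw [← Finset.sum_product' (f := fun i j : Fin d => (a i.succ j.succ -
      if i < j then a i.succ j.succ - a j.succ i.succ else 0) • A i.succ j.succ)]
    have key : ∀ i j : Fin d, i < j →
        (a i.succ j.succ - if i < j then a i.succ j.succ - a j.succ i.succ else 0) •
          A i.succ j.succ +
        (a j.succ i.succ - if j < i then a j.succ i.succ - a i.succ j.succ else 0) •
          A j.succ i.succ = 0 := fun i j hij => by
      rw [if_pos hij, if_neg hij.not_gt, sub_sub_cancel, sub_zero, ← smul_add,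
        hanti i j hij.ne, smul_zero]
    refine Finset.sum_involution (fun p _ => p.swap) ?_ ?_ (by simp) (by simp)
    · rintro ⟨i, j⟩ -
      rcases lt_trichotomy i j with h | rfl | h
      · exact key i j h
      · simp [hdiag]
      · rw [add_comm]
        exact key j i h
    · rintro ⟨i, j⟩ - h h'
      have : j = i := congrArg Prod.fst h'
      subst this
      simp [hdiag] at h
  rw [Fin.sum_univ_succ, Fin.sum_univ_succ, hdiag, smul_zero, zero_add]
  simp_rw [Fin.sum_univ_succ (n := d) (f := fun j => a (Fin.succ _) j • A (Fin.succ _) j)]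
  rw [Finset.sum_add_distrib, h2, ← add_assoc, ← Finset.sum_add_distrib]
  congr 1
  refine Finset.sum_congr rfl fun j _ => ?_
  rw [h1, smul_neg, ← mul_smul, sub_smul, sub_eq_add_neg, mul_comm]

namespace KummerFrame

variable {F : Type*} [Field F] {ℓ q d : ℕ} {T : KummerFrame F ℓ q d} [Fact ℓ.Prime] {r μ : ℕ}
  {ζ : RootsIso F (ℓ ^ r)} (hζ : T.IsCompatible ζ)
  (hμ : μ + twoExp ℓ = min (padicValNat ℓ (q - 1)) (r + twoExp ℓ))

/-! ### The cup product vanishes on matched pairs -/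

section Adapted

variable {χ : Fin (d + 1) → CharTwice F (ℓ ^ r)} {x : Fin (d + 1) → KummerZ1 F (ℓ ^ r)}
  (h : IsAdaptedBasis (ℓ ^ μ) d ζ χ x)

theorem cupClass_sum_sum (b c : Fin (d + 1) → ℤ) :
    cupClass (∑ i, b i • χ i) (∑ i, c i • x i) =
      ∑ i, ∑ j, (b i * c j) • cupClass (χ i) (x j) := by
  change cupBihom F (ℓ ^ r) (∑ i, b i • χ i) (∑ i, c i • x i) = _
  rw [map_sum (cupBihom F (ℓ ^ r)), AddMonoidHom.finsetSum_apply]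
  refine Finset.sum_congr rfl fun i _ => ?_
  rw [map_zsmul, AddMonoidHom.zsmul_apply, map_sum, Finset.smul_sum]
  refine Finset.sum_congr rfl fun j _ => ?_
  rw [map_zsmul, smul_smul]
  rfl

include hμ h in
theorem val_eq_starChar_of_isAdaptedBasis :
    (ℓ ^ (r - μ) • χ 0).val = starChar ζ (x 0) (ℓ ^ μ) ∧
      ∀ i : Fin d, (χ i.succ).val = starChar ζ (x i.succ) (ℓ ^ μ) := by
  have hr := (le_of_add_twoExp_eq hμ).2
  constructor
  · have h1 := h.normalized 0
    unfold IsNormalized at h1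
    rwa [h.order_zero, Nat.gcd_eq_right (pow_dvd_pow ℓ hr),
      Nat.pow_div hr (Fact.out : ℓ.Prime).pos] at h1
  · intro i
    have h1 := h.normalized i.succ
    unfold IsNormalized at h1
    rwa [h.order_succ _ (Fin.succ_ne_zero i), Nat.gcd_self, Nat.div_self (NeZero.pos _),
      one_smul] at h1

include hζ hμ h in
/-- The relations of an alternating form hold among the cup products of an adapted basis, because
the cup product of a sum of normalized pairs with characters of the same level vanishes again. -/
theorem cupClass_relations :
    (∀ i, cupClass (χ i) (x i) = 0) ∧
    (∀ i j : Fin d, i ≠ j →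
      cupClass (χ i.succ) (x j.succ) + cupClass (χ j.succ) (x i.succ) = 0) ∧
    ∀ j : Fin d, ℓ ^ (r - μ) • cupClass (χ 0) (x j.succ) + cupClass (χ j.succ) (x 0) = 0 := by
  have hr := (le_of_add_twoExp_eq hμ).2
  obtain ⟨h0, hs⟩ := val_eq_starChar_of_isAdaptedBasis hμ h
  have hz : cupClass (χ 0) (x 0) = 0 := h.cup_zero
  have hd : ∀ i : Fin d, cupClass (χ i.succ) (x i.succ) = 0 := fun i =>
    cupClass_eq_zero_of_val_eq_starChar hζ hμ (hs i)
  refine ⟨Fin.cases hz hd, fun i j _ => ?_, fun j => ?_⟩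
  · have h1 : (χ i.succ + χ j.succ).val = starChar ζ (x i.succ + x j.succ) (ℓ ^ μ) := by
      rw [starChar_add hζ hr, ← hs, ← hs]
      rfl
    have h2 := cupClass_eq_zero_of_val_eq_starChar hζ hμ h1
    rwa [cupClass_add_left, cupClass_add_right, cupClass_add_right, hd, hd, zero_add,
      add_zero] at h2
  · have h1 : (ℓ ^ (r - μ) • χ 0 + χ j.succ).val = starChar ζ (x 0 + x j.succ) (ℓ ^ μ) := by
      rw [starChar_add hζ hr, ← hs, ← h0]
      rfl
    have h2 := cupClass_eq_zero_of_val_eq_starChar hζ hμ h1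
    have h3 : ∀ z, cupClass (ℓ ^ (r - μ) • χ 0) z = ℓ ^ (r - μ) • cupClass (χ 0) z := fun z => by
      have := map_nsmul (AddMonoidHom.flip (cupBihom F (ℓ ^ r)) z) (ℓ ^ (r - μ)) (χ 0)
      exact this
    rwa [cupClass_add_left, cupClass_add_right, cupClass_add_right, hd, add_zero, h3, h3, hz,
      smul_zero, zero_add] at h2

theorem nsmul_cupClass_eq_zero {N : ℕ} {θ : CharTwice F (ℓ ^ r)} (hθ : N • θ = 0)
    (z : KummerZ1 F (ℓ ^ r)) : N • cupClass θ z = 0 := by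
  have h1 := map_nsmul (AddMonoidHom.flip (cupBihom F (ℓ ^ r)) z) N θ
  rw [hθ, map_zero] at h1
  exact h1.symm

include hζ hμ in
theorem matchedSubgroup_le_ker : matchedSubgroup (ℓ ^ μ) d ζ ≤ (cupProduct F (ℓ ^ r)).ker := by
  refine (AddSubgroup.closure_le _).2 ?_
  rintro _ ⟨θ, z, ⟨⟨χ, x, b, c, h, rfl, rfl, h1, h2⟩, -⟩, rfl⟩
  obtain ⟨hdiag, hanti, hzero⟩ := cupClass_relations hζ hμ h
  change cupClass _ _ = 0
  rw [cupClass_sum_sum, sum_sum_zsmul_eq hdiag hanti hzero fun i j => b i * c j]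
  have hr := (le_of_add_twoExp_eq hμ).2
  rw [Finset.sum_eq_zero, Finset.sum_eq_zero, add_zero]
  · refine fun i _ => Finset.sum_eq_zero fun j _ => zsmul_eq_zero_of_dvd (N := ℓ ^ μ)
      (nsmul_cupClass_eq_zero ?_ _) ?_
    · rw [← h.order_succ _ (Fin.succ_ne_zero i), addOrderOf_nsmul_eq_zero]
    · split_ifs
      · have := (h2 i.succ j.succ (Fin.succ_ne_zero i) (Fin.succ_ne_zero j)).symm.dvd
        rwa [mul_comm (c i.succ)] at this
      · exact dvd_zero _
  · refine fun j _ => zsmul_eq_zero_of_dvd (N := ℓ ^ r)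
      (nsmul_cupClass_eq_zero (CharTwice.nsmul_eq_zero _) _) ?_
    have := (h1 j.succ (Fin.succ_ne_zero j)).symm.dvd
    rwa [Nat.pow_div hr (Fact.out : ℓ.Prime).pos, mul_assoc, mul_comm (c 0)] at this

end Adapted

end KummerFrame

namespace KummerFrame

variable {F : Type*} [Field F] {ℓ q d : ℕ} {T : KummerFrame F ℓ q d} [Fact ℓ.Prime] {r μ : ℕ}
  {ζ : RootsIso F (ℓ ^ r)} (hζ : T.IsCompatible ζ)
  (hμ : μ + twoExp ℓ = min (padicValNat ℓ (q - 1)) (r + twoExp ℓ))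

/-! ### Relations in the wedge product -/

include hζ in
/-- The character attached to a cocycle, in coordinates. -/
theorem val_sum_charBasis_eq_starChar {b c : Fin (d + 1) → ℤ}
    (h0 : b 0 = ((ℓ ^ (r - μ) : ℕ) : ℤ) * c 0) (hs : ∀ i : Fin d, b i.succ = c i.succ) :
    (∑ i, b i • T.charBasis hμ i).val = starChar ζ (∑ i, c i • T.cocycleBasis r i) (ℓ ^ μ) := by
  have hr := (le_of_add_twoExp_eq hμ).2
  let starHom : KummerZ1 F (ℓ ^ r) →+ (GalSep F → QmodZ) :=
    AddMonoidHom.mk' (fun z => starChar ζ z (ℓ ^ μ)) (starChar_add hζ hr)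
  change _ = starHom _
  rw [map_sum starHom]
  funext g
  rw [CharTwice.val_sum_zsmul, Finset.sum_apply]
  refine Finset.sum_congr rfl fun i _ => ?_
  rw [map_zsmul]
  change _ = c i • starChar ζ (T.cocycleBasis r i) (ℓ ^ μ) g
  refine Fin.cases ?_ (fun i => ?_) i
  · rw [cocycleBasis_zero, ← val_charZero_eq_starChar hζ hμ, h0, mul_comm, mul_smul, natCast_zsmul]
    rfl
  · rw [cocycleBasis_succ, ← val_charSucc_eq_starChar hζ hμ, hs]
    rfl

include hζ in
/-- If the coordinates of a cocycle are `c`, those of its character are `b`, and the order of the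
character is `ℓ ^ μ` because of a coefficient `1`, then character and cocycle are matched. -/
theorem tmul_mem_matchedSubgroup {b c : Fin (d + 1) → ℤ}
    (h0 : b 0 = ((ℓ ^ (r - μ) : ℕ) : ℤ) * c 0) (hs : ∀ i : Fin d, b i.succ = c i.succ)
    {l : Fin d} (hl : c l.succ = 1) :
    (∑ i, b i • T.charBasis hμ i) ⊗ₜ[ℤ] (∑ i, c i • T.cocycleBasis r i) ∈
      matchedSubgroup (ℓ ^ μ) d ζ := by
  have hr := (le_of_add_twoExp_eq hμ).2
  refine AddSubgroup.subset_closure ⟨_, _, ⟨⟨_, _, b, c, isAdaptedBasis hζ hμ, rfl, rfl,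
    fun j hj => ?_, fun i j hi hj => ?_⟩, isNormalized_of_val_eq
      (val_sum_charBasis_eq_starChar hζ hμ h0 hs) (addOrderOf_eq ?_ (g := T.tau l) ?_)⟩, rfl⟩
  · obtain ⟨j, rfl⟩ := Fin.exists_succ_eq.2 hj
    rw [h0, hs, Nat.pow_div hr T.prime.pos]
  · obtain ⟨i, rfl⟩ := Fin.exists_succ_eq.2 hi
    obtain ⟨j, rfl⟩ := Fin.exists_succ_eq.2 hj
    rw [hs, hs]
  · rw [Finset.smul_sum]
    refine Finset.sum_eq_zero fun i _ => ?_
    rw [← natCast_zsmul, smul_smul]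
    refine Fin.cases ?_ (fun i => ?_) i
    · refine zsmul_eq_zero_of_dvd (CharTwice.nsmul_eq_zero _) ?_
      rw [h0, ← mul_assoc, ← Nat.cast_mul, ← pow_add, Nat.add_sub_cancel' hr]
      exact dvd_mul_right _ _
    · exact zsmul_eq_zero_of_dvd (T.pow_nsmul_charSucc hμ i) (dvd_mul_right _ _)
  · rw [val_sum_charBasis_tau, hs, hl, one_smul]

include hζ in
theorem charZero_tmul_mem_matchedSubgroup :
    T.charBasis hμ 0 ⊗ₜ[ℤ] T.cocycleBasis r 0 ∈ matchedSubgroup (ℓ ^ μ) d ζ := by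
  have h := isAdaptedBasis hζ hμ
  refine AddSubgroup.subset_closure ⟨_, _, ⟨⟨_, _, Pi.single 0 1, Pi.single 0 1, h, ?_, ?_,
    fun j hj => ?_, fun i j hi hj => ?_⟩, h.normalized 0⟩, rfl⟩
  · simp [Pi.single_apply, ite_smul]
  · simp [Pi.single_apply, ite_smul]
  · simp [Pi.single_eq_of_ne hj]
  · simp [Pi.single_eq_of_ne hi]

/-- The image in the wedge product of a tensor of basis elements. -/
def wedgeBasis (ζ : RootsIso F (ℓ ^ r)) (i j : Fin (d + 1)) : WedgeProduct (ℓ ^ μ) d ζ :=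
  QuotientAddGroup.mk (T.charBasis hμ i ⊗ₜ[ℤ] T.cocycleBasis r j)

include hζ in
/-- The tensors of basis elements satisfy in the wedge product the relations satisfied by their cup
products: sums of two basis elements, with coefficient `ℓ ^ (r - μ)` at the unramified character,
form matched pairs. -/
theorem wedgeBasis_relations :
    (∀ i, wedgeBasis (T := T) hμ ζ i i = 0) ∧
    (∀ i j : Fin d, i ≠ j →
      wedgeBasis (T := T) hμ ζ i.succ j.succ + wedgeBasis (T := T) hμ ζ j.succ i.succ = 0) ∧
    ∀ j : Fin d, ℓ ^ (r - μ) • wedgeBasis (T := T) hμ ζ 0 j.succ +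
      wedgeBasis (T := T) hμ ζ j.succ 0 = 0 := by
  have hz : wedgeBasis (T := T) hμ ζ 0 0 = 0 :=
    (QuotientAddGroup.eq_zero_iff _).2 (charZero_tmul_mem_matchedSubgroup hζ hμ)
  have hd : ∀ i : Fin d, wedgeBasis (T := T) hμ ζ i.succ i.succ = 0 := fun i => by
    refine (QuotientAddGroup.eq_zero_iff _).2 ?_
    have h1 := tmul_mem_matchedSubgroup hζ hμ (b := Pi.single i.succ 1) (c := Pi.single i.succ 1)
      (by simp [Fin.succ_ne_zero]) (fun _ => rfl) (l := i) (by simp)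
    simpa [Pi.single_apply, ite_smul] using h1
  refine ⟨Fin.cases hz hd, fun i j hij => ?_, fun j => ?_⟩
  · have h1 := tmul_mem_matchedSubgroup hζ hμ (b := Pi.single i.succ 1 + Pi.single j.succ 1)
      (c := Pi.single i.succ 1 + Pi.single j.succ 1)
      (by simp [Fin.succ_ne_zero]) (fun _ => rfl) (l := i)
      (by simp [hij])
    have h2 : (T.charBasis hμ i.succ + T.charBasis hμ j.succ) ⊗ₜ[ℤ]
        (T.cocycleBasis r i.succ + T.cocycleBasis r j.succ) ∈ matchedSubgroup (ℓ ^ μ) d ζ := by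
      simpa [Pi.single_apply, ite_smul, add_smul, Finset.sum_add_distrib] using h1
    rw [← QuotientAddGroup.eq_zero_iff, TensorProduct.add_tmul, TensorProduct.tmul_add,
      TensorProduct.tmul_add] at h2
    change wedgeBasis (T := T) hμ ζ i.succ i.succ + wedgeBasis (T := T) hμ ζ i.succ j.succ +
      (wedgeBasis (T := T) hμ ζ j.succ i.succ + wedgeBasis (T := T) hμ ζ j.succ j.succ) = 0 at h2
    rwa [hd, hd, zero_add, add_zero] at h2
  · have h1 := tmul_mem_matchedSubgroup hζ hμ
      (b := Pi.single 0 ((ℓ ^ (r - μ) : ℕ) : ℤ) + Pi.single j.succ 1)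
      (c := Pi.single 0 1 + Pi.single j.succ 1)
      (by simp [Fin.succ_ne_zero]) (fun i => by simp) (l := j) (by simp)
    have h2 : (ℓ ^ (r - μ) • T.charBasis hμ 0 + T.charBasis hμ j.succ) ⊗ₜ[ℤ]
        (T.cocycleBasis r 0 + T.cocycleBasis r j.succ) ∈ matchedSubgroup (ℓ ^ μ) d ζ := by
      rw [← natCast_zsmul]
      simpa [Pi.single_apply, ite_smul, add_smul, Finset.sum_add_distrib] using h1
    rw [← QuotientAddGroup.eq_zero_iff, TensorProduct.add_tmul, TensorProduct.tmul_add,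
      TensorProduct.tmul_add, ← TensorProduct.smul_tmul', ← TensorProduct.smul_tmul'] at h2
    change ℓ ^ (r - μ) • wedgeBasis (T := T) hμ ζ 0 0 +
      ℓ ^ (r - μ) • wedgeBasis (T := T) hμ ζ 0 j.succ +
      (wedgeBasis (T := T) hμ ζ j.succ 0 + wedgeBasis (T := T) hμ ζ j.succ j.succ) = 0 at h2
    rwa [hd, hz, smul_zero, zero_add, add_zero] at h2

theorem exists_eq_sum_tmul (t : CupTensor F (ℓ ^ r)) : ∃ a : Fin (d + 1) → Fin (d + 1) → ℤ,
    t = ∑ i, ∑ j, a i j • (T.charBasis hμ i ⊗ₜ[ℤ] T.cocycleBasis r j) := by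
  induction t using TensorProduct.induction_on with
  | zero => exact ⟨0, by simp⟩
  | tmul θ z =>
    obtain ⟨b, rfl⟩ := T.exists_eq_sum_charBasis hμ θ
    obtain ⟨c, rfl⟩ := T.exists_eq_sum_cocycleBasis z
    refine ⟨fun i j => b i * c j, ?_⟩
    rw [TensorProduct.sum_tmul]
    refine Finset.sum_congr rfl fun i _ => ?_
    rw [TensorProduct.tmul_sum]
    refine Finset.sum_congr rfl fun j _ => ?_
    rw [TensorProduct.tmul_smul, ← TensorProduct.smul_tmul', smul_smul, mul_comm]
  | add t u ht hu =>
    obtain ⟨a, rfl⟩ := ht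
    obtain ⟨b, rfl⟩ := hu
    refine ⟨a + b, ?_⟩
    simp only [← Finset.sum_add_distrib, Pi.add_apply, add_smul]

/-- The combinations of `χ₀ ⊗ xⱼ` and of `χᵢ ⊗ xⱼ`, for `i` and `j` different from `0`. With `f`
strictly upper triangular they represent every element of the wedge product. -/
def reducedTensor (e : Fin d → ℤ) (f : Fin d → Fin d → ℤ) : CupTensor F (ℓ ^ r) :=
  ∑ j : Fin d, e j • (T.charZero r ⊗ₜ[ℤ] T.cocycleSucc r j) +
    ∑ i : Fin d, ∑ j : Fin d, f i j • (T.charSucc hμ i ⊗ₜ[ℤ] T.cocycleSucc r j)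

include hζ in
theorem exists_sub_reducedTensor_mem (t : CupTensor F (ℓ ^ r)) :
    ∃ (e : Fin d → ℤ) (f : Fin d → Fin d → ℤ), (∀ i j, j ≤ i → f i j = 0) ∧
      t - reducedTensor (T := T) hμ e f ∈ matchedSubgroup (ℓ ^ μ) d ζ := by
  obtain ⟨a, rfl⟩ := exists_eq_sum_tmul (T := T) hμ t
  obtain ⟨hdiag, hanti, hzero⟩ := wedgeBasis_relations hζ hμ
  have h1 := sum_sum_zsmul_eq hdiag hanti hzero a
  refine ⟨fun j => a 0 j.succ - ((ℓ ^ (r - μ) : ℕ) : ℤ) * a j.succ 0,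
    fun i j => if i < j then a i.succ j.succ - a j.succ i.succ else 0,
    fun i j hij => if_neg hij.not_gt, (QuotientAddGroup.eq_zero_iff _).1
      ((map_sub (QuotientAddGroup.mk' (matchedSubgroup (ℓ ^ μ) d ζ)) _ _).trans
        (sub_eq_zero.2 ?_))⟩
  unfold reducedTensor
  simp only [map_add, map_sum, map_zsmul]
  exact h1

theorem cupProduct_reducedTensor (e : Fin d → ℤ) (f : Fin d → Fin d → ℤ) :
    cupProduct F (ℓ ^ r) (reducedTensor (T := T) hμ e f) =
      T.symClass (Matrix.of fun i j =>
        (ℓ : ℤ_[ℓ]) ^ (padicValNat ℓ (q - 1) - μ) * (f i j : ℤ_[ℓ])) +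
      ∑ j, e j • T.unramClass (ℓ ^ r) j := by
  have hcup : ∀ (θ : CharTwice F (ℓ ^ r)) z, cupProduct F (ℓ ^ r) (θ ⊗ₜ[ℤ] z) = cupClass θ z :=
    fun _ _ => rfl
  unfold reducedTensor
  simp only [map_add, map_sum, map_zsmul, hcup, cupClass_charSucc, cupClass_charZero_cocycleSucc]
  rw [add_comm]
  congr 1
  simp_rw [← map_zsmul, ← map_sum]
  congr 1
  ext i j
  simp [Matrix.sum_apply, Matrix.single_apply, mul_comm, ite_and]

/-- The cup product is injective on reduced tensors, by the independence of symbols and unramified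
cyclic algebras in the Brauer group. -/
theorem reducedTensor_eq_zero {e : Fin d → ℤ} {f : Fin d → Fin d → ℤ}
    (hf : ∀ i j, j ≤ i → f i j = 0)
    (h : cupProduct F (ℓ ^ r) (reducedTensor (T := T) hμ e f) = 0) :
    reducedTensor (T := T) hμ e f = 0 := by
  obtain ⟨hv, hr⟩ := le_of_add_twoExp_eq hμ
  rw [cupProduct_reducedTensor] at h
  obtain ⟨h1, h2⟩ := T.dvd_of_symClass_add_eq_zero (fun i j hij => by simp [hf i j hij]) h
  have h3 : ∀ i j, ((ℓ ^ μ : ℕ) : ℤ) ∣ f i j := fun i j => by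
    have h4 := h1 i j
    rw [Matrix.of_apply, ← Nat.sub_add_cancel hv, Nat.add_sub_cancel, pow_add] at h4
    have h5 := (mul_dvd_mul_iff_left
      (pow_ne_zero _ (by exact_mod_cast T.prime.ne_zero : (ℓ : ℤ_[ℓ]) ≠ 0))).1 h4
    exact_mod_cast (PadicInt.pow_p_dvd_int_iff _ _).1 h5
  unfold reducedTensor
  rw [Finset.sum_eq_zero, Finset.sum_eq_zero, add_zero]
  · refine fun i _ => Finset.sum_eq_zero fun j _ => zsmul_eq_zero_of_dvd ?_ (h3 i j)
    rw [TensorProduct.smul_tmul', T.pow_nsmul_charSucc, TensorProduct.zero_tmul]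
  · refine fun j _ => zsmul_eq_zero_of_dvd ?_ (h2 j)
    rw [TensorProduct.smul_tmul', CharTwice.nsmul_eq_zero, TensorProduct.zero_tmul]

include hζ hμ in
theorem ker_cupProduct : (cupProduct F (ℓ ^ r)).ker = matchedSubgroup (ℓ ^ μ) d ζ := by
  refine le_antisymm (fun t ht => ?_) (matchedSubgroup_le_ker hζ hμ)
  obtain ⟨e, f, hf, h⟩ := exists_sub_reducedTensor_mem hζ hμ t
  have h1 := matchedSubgroup_le_ker hζ hμ h
  rw [AddMonoidHom.mem_ker] at ht h1
  rw [map_sub, ht, zero_sub, neg_eq_zero] at h1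
  rwa [reducedTensor_eq_zero hμ hf h1, sub_zero] at h

/-! ### The image of the cup product -/

theorem pow_nsmul_unramClass (s t : ℕ) (i : Fin d) :
    ℓ ^ t • T.unramClass (ℓ ^ (s + t)) i = T.unramClass (ℓ ^ s) i := by
  have h : NeZero (ℓ ^ s * ℓ ^ t) := ⟨mul_ne_zero (NeZero.ne _) (NeZero.ne _)⟩
  simp only [pow_add]
  exact T.unramClass_mul (ℓ ^ s) (ℓ ^ t) i

include hζ hμ in
theorem cupProduct_mem_brTwice (t : CupTensor F (ℓ ^ r)) :
    cupProduct F (ℓ ^ r) t ∈ BrTwice F (ℓ ^ r) := by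
  obtain ⟨e, f, hf, h⟩ := exists_sub_reducedTensor_mem hζ hμ t
  have h1 := matchedSubgroup_le_ker hζ hμ h
  rw [AddMonoidHom.mem_ker, map_sub, sub_eq_zero, cupProduct_reducedTensor] at h1
  rw [h1]
  refine (mem_nTorsionOfTwice_iff T.prime r).2 ⟨T.symClass (Matrix.of fun i j =>
    (ℓ : ℤ_[ℓ]) ^ (padicValNat ℓ (q - 1) - (μ + twoExp ℓ)) * (f i j : ℤ_[ℓ])) +
      ∑ j, e j • T.unramClass (ℓ ^ (r + twoExp ℓ)) j, ?_, ?_⟩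
  · rw [smul_add, ← map_nsmul, Finset.smul_sum]
    congr 1
    · congr 1
      ext i j
      rw [Matrix.smul_apply, Matrix.of_apply, Matrix.of_apply, nsmul_eq_mul, Nat.cast_pow,
        ← mul_assoc, ← pow_add]
      congr 2
      omega
    · refine Finset.sum_congr rfl fun j _ => ?_
      rw [smul_comm, pow_nsmul_unramClass]
  · rw [smul_add, ← map_nsmul, Finset.smul_sum, T.symClass_eq_zero, zero_add]
    · refine Finset.sum_eq_zero fun j _ => ?_
      rw [smul_comm, T.nsmul_unramClass, smul_zero]
    · intro i j
      rw [Matrix.smul_apply, Matrix.of_apply, nsmul_eq_mul, Nat.cast_pow, ← mul_assoc, ← pow_add]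
      exact Dvd.dvd.mul_right (pow_dvd_pow _ (by omega)) _

include T hμ in
/-- A class in twice the Brauer group is `ℓ ^ twoExp ℓ` times a symbol plus unramified cyclic
algebras killed by `ℓ ^ (r + twoExp ℓ)`; the resulting divisibility of the coordinates makes it the
cup product of a reduced tensor. -/
theorem exists_cupProduct_eq {a : BrGroup F} (ha : a ∈ BrTwice F (ℓ ^ r)) :
    ∃ t, cupProduct F (ℓ ^ r) t = a := by
  obtain ⟨hv, hr⟩ := le_of_add_twoExp_eq hμ
  obtain ⟨b, rfl, hb⟩ := (mem_nTorsionOfTwice_iff T.prime r).1 ha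
  obtain ⟨M, t, _, e, hM, rfl⟩ := T.exists_eq_symClass_add hb
  have h1 : T.symClass (ℓ ^ (r + twoExp ℓ) • M) +
      ∑ i, (((ℓ ^ (r + twoExp ℓ) : ℕ) : ℤ) * e i) • T.unramClass (ℓ ^ t) i = 0 := by
    rw [← hb, smul_add, map_nsmul, Finset.smul_sum]
    congr 1
    refine Finset.sum_congr rfl fun i _ => ?_
    rw [mul_smul, natCast_zsmul]
  obtain ⟨hM', he⟩ := T.dvd_of_symClass_add_eq_zero
    (fun i j hij => by rw [Matrix.smul_apply, hM i j hij, smul_zero]) h1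
  choose c hc using he
  have hℓ0 : (ℓ : ℤ_[ℓ]) ≠ 0 := by exact_mod_cast T.prime.ne_zero
  -- The entries of `ℓ ^ twoExp ℓ • M` are divisible by `ℓ ^ (v - μ)`, with integral quotients
  -- modulo `ℓ ^ v`.
  have hf : ∀ i j, ∃ f : ℤ, (ℓ : ℤ_[ℓ]) ^ padicValNat ℓ (q - 1) ∣ ℓ ^ twoExp ℓ * M i j -
      ℓ ^ (padicValNat ℓ (q - 1) - μ) * (f : ℤ_[ℓ]) := fun i j => by
    have h2 : (ℓ : ℤ_[ℓ]) ^ (padicValNat ℓ (q - 1) - μ) ∣ ℓ ^ twoExp ℓ * M i j := by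
      have h3 := hM' i j
      rw [Matrix.smul_apply, nsmul_eq_mul, Nat.cast_pow, add_comm r, pow_add, mul_assoc] at h3
      rcases le_total (padicValNat ℓ (q - 1)) (r + twoExp ℓ) with hle | hle
      · rw [min_eq_left hle] at hμ
        rw [← hμ, Nat.add_sub_cancel_left]
        exact dvd_mul_right _ _
      · rw [min_eq_right hle] at hμ
        have hμr : μ = r := by omega
        rw [mul_left_comm, hμr.symm, ← Nat.add_sub_cancel' hv, pow_add] at h3
        exact (mul_dvd_mul_iff_left (pow_ne_zero _ hℓ0)).1 h3
    obtain ⟨w, hw⟩ := h2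
    obtain ⟨f, hf⟩ := exists_int_approx μ w
    refine ⟨f, ?_⟩
    rw [← map_intCast (PadicInt.toZModPow (p := ℓ) μ), PadicInt.toZModPow_eq_iff] at hf
    rw [hw, ← mul_sub]
    conv_lhs => rw [← Nat.sub_add_cancel hv, pow_add]
    exact mul_dvd_mul_left _ hf
  choose f hf using hf
  refine ⟨reducedTensor (T := T) hμ c f, ?_⟩
  rw [cupProduct_reducedTensor, smul_add, ← map_nsmul, Finset.smul_sum]
  congr 1
  · refine (sub_eq_zero.1 ?_).symm
    rw [← map_sub]
    refine T.symClass_eq_zero fun i j => ?_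
    rw [Matrix.sub_apply, Matrix.smul_apply, Matrix.of_apply, nsmul_eq_mul, Nat.cast_pow]
    exact hf i j
  · refine Finset.sum_congr rfl fun i _ => ?_
    have h2 : e i • T.unramClass (ℓ ^ t) i = c i • T.unramClass (ℓ ^ (r + twoExp ℓ)) i := by
      rw [← T.pow_nsmul_unramClass t (r + twoExp ℓ), ← T.pow_nsmul_unramClass (r + twoExp ℓ) t,
        ← natCast_zsmul, ← natCast_zsmul, smul_smul, smul_smul, mul_comm (e i), hc, mul_comm (c i)]
      simp only [add_comm t]
    rw [h2, smul_comm, pow_nsmul_unramClass]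

end KummerFrame

end

theorem mainTheorem3 {F : Type*} [Field F]
    {Γ₀ : Type*} [LinearOrderedCommGroupWithZero Γ₀] (v : Valuation F Γ₀)
    [HenselianLocalRing v.valuationSubring]
    [Finite (IsLocalRing.ResidueField v.valuationSubring)]
    (d : ℕ) (hd : 1 ≤ d)
    (hΓ : Nonempty
      (Additive (MonoidWithZeroHom.valueGroup (MonoidWithZeroHom.ofClass v)) ≃+ (Fin d → ℤ)))
    (p : ℕ) [CharP (IsLocalRing.ResidueField v.valuationSubring) p]
    (ℓ : ℕ) (hℓ : ℓ.Prime) (hℓp : ℓ ≠ p)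
    (n : ℕ) [NeZero n] (hn : ∃ r : ℕ, n = ℓ ^ r)
    (ζ : RootsIso F n)
    (m' : ℕ) (hm' : m' = mPrime (Nat.card (IsLocalRing.ResidueField v.valuationSubring)) n) :
    (cupProduct F n).ker = matchedSubgroup m' d ζ ∧
    ∃ e : WedgeProduct m' d ζ ≃+ BrTwice F n,
      ∀ t : CupTensor F n,
        (e (QuotientAddGroup.mk t) : BrGroup F) = cupProduct F n t := by
  obtain ⟨r, rfl⟩ := hn
  have hfact : Fact ℓ.Prime := ⟨hℓ⟩
  obtain ⟨T₀⟩ := exists_tameFrame v hΓ p hℓ hℓp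
  obtain ⟨μ, hμ', hμ⟩ := exists_mPrime_eq hℓ r T₀.one_lt T₀.coprime
  rw [hμ'] at hm'
  subst hm'
  -- The element of order `ℓ ^ r` corresponding to `1 / ℓ ^ r`.
  set w : Additive (rootsOfUnity (ℓ ^ r) (SeparableClosure F)) :=
    ζ.symm ⟨divQmodZ (ℓ ^ r) 1, nsmul_divQmodZ _ _⟩ with hw
  have hord : orderOf ((Additive.toMul w).1 : SepUnits F) = ℓ ^ r := by
    have h1 : addOrderOf w = ℓ ^ r := by
      rw [hw, AddEquiv.addOrderOf_eq, ← AddSubgroup.addOrderOf_coe]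
      change addOrderOf (divQmodZ (ℓ ^ r) 1) = _
      rw [addOrderOf_injective _ (divQmodZ_injective _), ZMod.addOrderOf_one]
    exact (Subgroup.orderOf_coe (Additive.toMul w)).trans h1
  obtain ⟨T, hT⟩ := T₀.exists_kummerFrame r _ hord
  have hζ : T.IsCompatible ζ := hT.symm
  have hker := KummerFrame.ker_cupProduct hζ hμ
  refine ⟨hker, ?_⟩
  have hrange : (cupProduct F (ℓ ^ r)).range = BrTwice F (ℓ ^ r) := by
    refine le_antisymm ?_ fun a ha => KummerFrame.exists_cupProduct_eq (T := T) hμ ha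
    rintro _ ⟨t, rfl⟩
    exact KummerFrame.cupProduct_mem_brTwice hζ hμ t
  exact ⟨((QuotientAddGroup.quotientAddEquivOfEq hker.symm).trans
    (QuotientAddGroup.quotientKerEquivRange _)).trans (AddEquiv.addSubgroupCongr hrange),
    fun t => rfl⟩
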